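/- **Model.** Let $\gamma\neq 0$ and $K$ be real with $|K|\ne|\gamma|$. On $N$ spins $\tfrac12$ ($N\ge 2$ even, periodic boundary conditions) consider the non-Hermitian iKSEA Hamiltonian $$H_N(h)=\sum_{j=1}^N \tfrac{1+i\gamma}{4}\sigma^x_j\sigma^x_{j+1}+\tfrac{1-i\gamma}{4}\sigma^y_j\sigma^y_{j+1}+\tfrac K4(\sigma^x_j\sigma^y_{j+1}+\sigma^y_j\sigma^x_{j+1})+\tfrac h2\sigma^z_j ,$$ restricted to the even parity sector $\prod_j\sigma^z_j=1$. Its ground state is the right eigenvector, of Dirac norm $1$, whose eigenvalue has maximal imaginary part and, among those, least real part (so the lowest energy when the spectrum is real). For a family $\psi_h$ of normalized states, differentiable in $h$, the quantum Fisher information (QFI) is $4\,\mathrm{Re}\big(\langle d_h\psi|d_h\psi\rangle-|\langle d_h\psi|\psi\rangle|^2\big)$. Put $\phi_p=(2p-1)\pi/N$ for $1\le p\le N/2$, $g_p=h+\cos\phi_p$, $\alpha_p^\pm=(\gamma\pm K)\sin\phi_p$, $\epsilon^2(\phi)=(h+\cos\phi)^2+(K^2-\gamma^2)\sin^2\phi$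 and $\mathcal H_p(h)=\begin{pmatrix}-g_p&-\alpha^+_p\\ \alpha^-_p&g_p\end{pmatrix}$, whose eigenvalues are $\pm\epsilon(\phi_p)$. Call $N$ *non-defective at $h$* if $\epsilon^2(\phi_p)\ne0$ for all $p$. For $\eta>0$ and $\omega\in(0,\pi)$ call $N$ *$\eta$-off-resonant for $\omega$* if $|\phi_p-\omega|\ge\eta\pi/N$ for all $p$. **Theorem 1.** (0) If $\epsilon^2(\phi_p)\ne 0$, the QFI $f_h(N,p)$ of the ground state of $\mathcal H_p(h)$ with respect to $h$ is well defined (a choice of normalized ground states near $h$ that is differentiable at $h$ exists, and the value does not depend on it). If $N$ is non-defective at $h$, the QFI $F_h(N)$ of the ground state of $H_N(h)$ in the even sector is well defined and $F_h(N)=\sum_{p=1}^{N/2} f_h(N,p)$. Below, $c,C,a,b$ are constants with $c,a>0$ that depend only on $\gamma,K$ (and on $\eta$, where $\eta$ is given); $N$ is even. (1) *Critical point $h_c=1$, $|K|>|\gamma|$.* Every $N$ is non-defective at $1$, and $cN^2\le F_1(N)\le CN^2$ for all large $N$. For all large $N$ the largest block contribution is that of $p=N/2$, and $f_1(N,N/2)\big/(N/\pi)^2\to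 1/K^2$. (2) *Critical point $h_c=1$, $|K|<|\gamma|$.* Let $\omega=\arccos\frac{\gamma^2-K^2-1}{\gamma^2-K^2+1}$ be the zero of $\epsilon$ in $(0,\pi)$. Then $F_1(N)\ge cN^2$ for all large $N$ that are non-defective at $1$. For every $\eta>0$, all large $N$ that are $\eta$-off-resonant for $\omega$ are non-defective and satisfy $F_1(N)\le CN^2$. Also $f_1(N,N/2)\big/(N/\pi)^2\to1/\gamma^2$. (3) *Exceptional point $h_e=\sqrt{1+\gamma^2-K^2}$, $|K|<|\gamma|$.* Let $\omega=\arccos(-1/h_e)$ be the zero of $\epsilon$ in $(0,\pi)$. Then $F_{h_e}(N)\ge cN^2$ for all large $N$ that are non-defective at $h_e$. For every $\eta>0$, all large $N$ that are $\eta$-off-resonant for $\omega$ are non-defective and satisfy $F_{h_e}(N)\le CN^2$, and there is a $p$ with $|\phi_p-\omega|\le\pi/N$ and $a\,\frac{(N/\pi)^2}{\gamma^2-K^2}\le f_{h_e}(N,p)\le b\,\frac{(N/\pi)^2}{\gamma^2-K^2}$. In (2) and (3) there is an $\eta>0$ such that for every even $N$ at least one of $N$, $N+2$ is $\eta$-off-resonant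 for $\omega$. So the QFI of the ground state grows at least quadratically at $h_c$ and at $h_e$, and exactly quadratically along these sizes. -/

import Mathlib

open Filter Topology

noncomputable section

namespace IKSEA

/-! ### Ground states and quantum Fisher information -/

section General

variable {ι : Type*} [Fintype ι] [DecidableEq ι]

/-- `ψ` is an eigenvector of `H` for the eigenvalue `E`, lying in the sector `S`. -/
def IsEigenpairOn (H : Matrix ι ι ℂ) (S : Submodule ℂ (EuclideanSpace ℂ ι))
    (E : ℂ) (ψ : EuclideanSpace ℂ ι) : Prop :=
  ψ ∈ S ∧ Module.End.HasEigenvector (Matrix.toEuclideanLin H) E ψ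

/-- Dirac-normalised ground state of a non-Hermitian Hamiltonian `H` within the sector `S`: a right
eigenvector of norm one whose eigenvalue has the maximal imaginary part and, among the eigenvalues
with that imaginary part, the least real part. If all eigenvalues in the sector are real (unbroken
phase), this is the eigenvector of lowest energy. -/
def IsGroundState (H : Matrix ι ι ℂ) (S : Submodule ℂ (EuclideanSpace ℂ ι))
    (ψ : EuclideanSpace ℂ ι) : Prop :=
  ‖ψ‖ = 1 ∧ ∃ E : ℂ, IsEigenpairOn H S E ψ ∧
    ∀ (E' : ℂ) (φ : EuclideanSpace ℂ ι), IsEigenpairOn H S E' φ →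
      E'.im < E.im ∨ (E'.im = E.im ∧ E.re ≤ E'.re)

/-- Pure-state quantum Fisher information at parameter value `h` of a family `ψ` of Dirac-normalised
states: `4 Re (⟨dψ|dψ⟩ - |⟨dψ|ψ⟩|²)`. -/
def qfi (ψ : ℝ → EuclideanSpace ℂ ι) (h : ℝ) : ℝ :=
  4 * ((inner ℂ (deriv ψ h) (deriv ψ h)).re - ‖inner ℂ (deriv ψ h) (ψ h)‖ ^ 2)

/-- A family of vectors that near `h` consists of normalised ground states of `H h'` in the sector
`S` and that is differentiable at `h`. -/
def IsGroundBranch (H : ℝ → Matrix ι ι ℂ) (S : Submodule ℂ (EuclideanSpace ℂ ι))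
    (h : ℝ) (ψ : ℝ → EuclideanSpace ℂ ι) : Prop :=
  DifferentiableAt ℝ ψ h ∧ ∀ᶠ h' in 𝓝 h, IsGroundState (H h') S (ψ h')

/-- The quantum Fisher information of the ground state at `h` is well defined (a differentiable
choice of ground states exists, and all such choices give the same value) and equals `F`. -/
def HasGroundQFI (H : ℝ → Matrix ι ι ℂ) (S : Submodule ℂ (EuclideanSpace ℂ ι))
    (h F : ℝ) : Prop :=
  (∃ ψ, IsGroundBranch H S h ψ) ∧ ∀ ψ, IsGroundBranch H S h ψ → qfi ψ h = F

end General

/-! ### The spin chain -/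

def pauliX : Matrix (Fin 2) (Fin 2) ℂ := !![0, 1; 1, 0]

def pauliY : Matrix (Fin 2) (Fin 2) ℂ := !![0, -Complex.I; Complex.I, 0]

def pauliZ : Matrix (Fin 2) (Fin 2) ℂ := !![1, 0; 0, -1]

/-- The one-site operator `A` acting on site `j` of `N` spins one half (identity elsewhere), in the
product basis of `(ℂ²)^{⊗N}` indexed by `Fin N → Fin 2`. -/
def siteOp {N : ℕ} (A : Matrix (Fin 2) (Fin 2) ℂ) (j : Fin N) :
    Matrix (Fin N → Fin 2) (Fin N → Fin 2) ℂ :=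
  Matrix.of fun s t => if ∀ k, k ≠ j → s k = t k then A (s j) (t j) else 0

/-- The iKSEA Hamiltonian on `N` sites with periodic boundary conditions; `finRotate N` is the
cyclic shift `j ↦ j + 1`. -/
def chainH (N : ℕ) (γ K h : ℝ) : Matrix (Fin N → Fin 2) (Fin N → Fin 2) ℂ :=
  ∑ j : Fin N,
    (((1 + Complex.I * γ) / 4) • (siteOp pauliX j * siteOp pauliX (finRotate N j))
      + ((1 - Complex.I * γ) / 4) • (siteOp pauliY j * siteOp pauliY (finRotate N j))
      + ((K : ℂ) / 4) • (siteOp pauliX j * siteOp pauliY (finRotate N j)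
          + siteOp pauliY j * siteOp pauliX (finRotate N j))
      + ((h : ℂ) / 2) • siteOp pauliZ j)

/-- The parity operator `σᶻ ⊗ ⋯ ⊗ σᶻ`. -/
def parity (N : ℕ) : Matrix (Fin N → Fin 2) (Fin N → Fin 2) ℂ :=
  Matrix.of fun s t => ∏ j, pauliZ (s j) (t j)

/-- The even parity sector. -/
def evenSector (N : ℕ) : Submodule ℂ (EuclideanSpace ℂ (Fin N → Fin 2)) :=
  Module.End.eigenspace (Matrix.toEuclideanLin (parity N)) 1

/-! ### The momentum blocks -/

/-- The momenta `φ_p = (2p - 1)π/N`, used for `1 ≤ p ≤ N/2`. -/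
def momentum (N p : ℕ) : ℝ := (2 * (p : ℝ) - 1) * Real.pi / N

/-- The `2 × 2` Hamiltonian at momentum `φ`. -/
def blockH (γ K φ h : ℝ) : Matrix (Fin 2) (Fin 2) ℂ :=
  !![((-(h + Real.cos φ) : ℝ) : ℂ), ((-((γ + K) * Real.sin φ) : ℝ) : ℂ);
     (((γ - K) * Real.sin φ : ℝ) : ℂ), ((h + Real.cos φ : ℝ) : ℂ)]

/-- The squared single-particle energy `ε²(φ)`; the block at `φ` has eigenvalues `±ε(φ)`. -/
def energySq (γ K h φ : ℝ) : ℝ :=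
  (h + Real.cos φ) ^ 2 + (K ^ 2 - γ ^ 2) * Real.sin φ ^ 2

/-- No momentum of the chain of size `N` sits exactly at a zero of `ε`. -/
def NonDefective (γ K h : ℝ) (N : ℕ) : Prop :=
  ∀ p ∈ Finset.Icc 1 (N / 2), energySq γ K h (momentum N p) ≠ 0

/-- All momenta of the chain of size `N` stay away from `ω` by at least the fraction `η` of the
scale `π/N` (neighbouring momenta are `2π/N` apart). -/
def OffResonant (η ω : ℝ) (N : ℕ) : Prop :=
  ∀ p ∈ Finset.Icc 1 (N / 2), η * (Real.pi / N) ≤ |momentum N p - ω|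

/-- The exceptional point `h_e`. -/
def hExc (γ K : ℝ) : ℝ := √(1 + γ ^ 2 - K ^ 2)

/-- The zero in `(0, π)` of `ε` at the exceptional point: `cos ω = -1/h_e`. -/
def omegaExc (γ K : ℝ) : ℝ := Real.arccos (-1 / hExc γ K)

/-- The zero in `(0, π)` of `ε` at the critical point `h = 1`, when `|K| < |γ|`. -/
def omegaCrit (γ K : ℝ) : ℝ :=
  Real.arccos ((γ ^ 2 - K ^ 2 - 1) / (γ ^ 2 - K ^ 2 + 1))

end IKSEA

end

/-!
In the sector of even parity the Jordan-Wigner transformation turns the chain into free fermions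
with antiperiodic boundary conditions, and a discrete Fourier transform splits the Hamiltonian into
commuting pieces, one for each pair of momenta `±φ_p` (`chainH_mul`, `fermionH_eq_sum_pairOp`).
With `D` the operator that creates such a pair, a piece is `pairOp D M`, where
`M = blockH γ K φ_p h` acts on the span of the empty and the full pair, and the piece
vanishes on half filled pairs.

A piece has the eigenvalues `0, e_p, -e_p`, where `e_p` is the ground energy of the block and `0` is
worse than `e_p` in the order that selects ground states. This order is a linear order on the group
of complex numbers (`energyRank`), so an eigenvalue of the sum of the pieces is at most `∑ e_p`,
with equality only for joint eigenvectors having all pairs in their ground states. Such a vector is a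
multiple of the product state, because the vacuum is unique. The argument uses no basis of the Fock
space and no diagonalizability beyond the cubic relation `T³ = e_p² T` for each piece, and it covers
real and imaginary `e_p` alike.

The quantum Fisher information of a family of rays is a normalized Gram determinant of any
differentiable spanning vector and its derivative (`gram_deriv_of_ray`). Hence it is well defined,
and it is additive for product states (`IsPairFamily.gram_productState`). For a single block this
gives the closed form `blockQFI`, from which `0 ≤ f ≤ 1 / |ε²|`.

The asymptotics only need this bound and the behaviour near the zeros of `ε²`. At `h = 1` one has
`ε² ~ (K² - γ²) x²` for `φ = π - x`, and `x² f` tends to `1 / K²` or `1 / γ²`; if `|K| < |γ|` there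
is a second, simple zero `ω`, and off resonance each of the `N / 2` blocks has `1 / |ε²|` at most of
order `N` from that zero, so that it contributes `O(N²)` in all. At the exceptional point
`ε² = (1 + h cos φ)²` has a double zero at `ω`, with `f` comparable to `1 / (φ - ω)²` near it, and
the sum of the inverse squared distances of the momenta to `ω` is `O(N²)` off resonance.
-/

noncomputable section

namespace IKSEA

/-! ### Quantum Fisher information of a differentiable ray -/

section Gram

variable {V : Type*} [NormedAddCommGroup V] [InnerProductSpace ℂ V]

/-- The Gram determinant `‖x‖²‖y‖² - |⟨x|y⟩|²` of two vectors. -/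
def gram (x y : V) : ℝ := ‖x‖ ^ 2 * ‖y‖ ^ 2 - ‖inner ℂ x y‖ ^ 2

theorem coe_gram (x y : V) :
    (gram x y : ℂ) = inner ℂ x x * inner ℂ y y - inner ℂ x y * inner ℂ y x := by
  rw [inner_self_eq_norm_sq_to_K, inner_self_eq_norm_sq_to_K, ← inner_conj_symm y x,
    Complex.mul_conj, Complex.normSq_eq_norm_sq]
  simp [gram]

theorem gram_smul_add_smul (x y : V) (a b c : ℂ) :
    gram (b • x + a • y) (c • y) = ‖b‖ ^ 2 * ‖c‖ ^ 2 * gram x y := by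
  have key : (gram (b • x + a • y) (c • y) : ℂ) =
      ((‖b‖ ^ 2 * ‖c‖ ^ 2 * gram x y : ℝ) : ℂ) := by
    push_cast
    rw [coe_gram, coe_gram, ← Complex.mul_conj' b, ← Complex.mul_conj' c]
    simp only [inner_add_left, inner_add_right, inner_smul_left, inner_smul_right]
    ring
  exact_mod_cast key

/-- The derivative of a normalized family on the ray of `v` has the Gram determinant with the
state itself that `v` has, rescaled. Both the value and the gauge independence of the quantum
Fisher information come from this. -/
theorem gram_deriv_of_ray {v ψ : ℝ → V} {v' : V} {h : ℝ} (hv : HasDerivAt v v' h)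
    (hv0 : v h ≠ 0) (hψ : DifferentiableAt ℝ ψ h)
    (hray : ∀ᶠ t in 𝓝 h, ‖ψ t‖ = 1 ∧ ∃ c : ℂ, ψ t = c • v t) :
    ‖deriv ψ h‖ ^ 2 - ‖inner ℂ (deriv ψ h) (ψ h)‖ ^ 2 = gram v' (v h) / ‖v h‖ ^ 4 := by
  -- the coefficient along the ray, recovered by projection, is differentiable
  set c : ℝ → ℂ := fun t => inner ℂ (v t) (ψ t) / inner ℂ (v t) (v t) with hc
  have hvd : DifferentiableAt ℝ v h := hv.differentiableAt
  have hcd : DifferentiableAt ℝ c h :=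
    (hvd.inner ℂ hψ).div (hvd.inner ℂ hvd) (by simpa using hv0)
  have hev : ψ =ᶠ[𝓝 h] fun t => c t • v t := by
    have hne : ∀ᶠ t in 𝓝 h, v t ≠ 0 := hv.continuousAt.eventually_ne hv0
    filter_upwards [hray, hne] with t ⟨_, d, hd⟩ ht
    have : inner ℂ (v t) (v t) ≠ 0 := by simpa using ht
    simp only [hc, hd, inner_smul_right]
    rw [mul_div_assoc, div_self this, mul_one]
  have hder : deriv ψ h = c h • v' + deriv c h • v h := by
    rw [hev.deriv_eq]
    exact (hcd.hasDerivAt.smul hv).deriv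
  have h1 : ψ h = c h • v h := hev.self_of_nhds
  have hn : ‖ψ h‖ = 1 := hray.self_of_nhds.1
  have hg : ‖deriv ψ h‖ ^ 2 - ‖inner ℂ (deriv ψ h) (ψ h)‖ ^ 2 = gram (deriv ψ h) (ψ h) := by
    simp [gram, hn]
  rw [hg, hder, h1, gram_smul_add_smul]
  rw [h1, norm_smul] at hn
  have hvn : ‖v h‖ ≠ 0 := by simpa using hv0
  have : ‖c h‖ = 1 / ‖v h‖ := eq_div_of_mul_eq hvn hn
  rw [this]
  field_simp

end Gram

section Ground

/-- Ranks eigenvalues by imaginary part and then by decreasing real part, so that the ground state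
is the eigenvector of largest rank. -/
def energyRank : ℂ →+ ℝ ×ₗ ℝ where
  toFun z := toLex (z.im, -z.re)
  map_zero' := by simp
  map_add' z w := by
    rw [Complex.add_im, Complex.add_re, neg_add]; rfl

theorem energyRank_le_iff (z w : ℂ) :
    energyRank z ≤ energyRank w ↔ z.im < w.im ∨ (z.im = w.im ∧ w.re ≤ z.re) := by
  simp [energyRank, Prod.Lex.le_iff]

theorem energyRank_injective : Function.Injective energyRank := by
  intro z w hzw
  have h1 := (energyRank_le_iff z w).1 hzw.le
  have h2 := (energyRank_le_iff w z).1 hzw.ge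
  apply Complex.ext
  · rcases h1 with h1 | h1 <;> rcases h2 with h2 | h2 <;> linarith [h1, h2]
  · rcases h1 with h1 | h1 <;> rcases h2 with h2 | h2 <;> linarith [h1, h2]

variable {ι : Type*} [Fintype ι] [DecidableEq ι]

theorem isEigenpairOn_iff {H : Matrix ι ι ℂ} {S : Submodule ℂ (EuclideanSpace ℂ ι)} {E : ℂ}
    {ψ : EuclideanSpace ℂ ι} :
    IsEigenpairOn H S E ψ ↔ ψ ∈ S ∧ Matrix.toEuclideanLin H ψ = E • ψ ∧ ψ ≠ 0 := by
  simp [IsEigenpairOn, Module.End.hasEigenvector_iff]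

/-- `v` spans the space of ground states of `H` in the sector `S`: it is an eigenvector of
maximal rank, and its eigenvalue is geometrically simple in the sector. -/
def IsGroundLine (H : Matrix ι ι ℂ) (S : Submodule ℂ (EuclideanSpace ℂ ι))
    (v : EuclideanSpace ℂ ι) : Prop :=
  ∃ E : ℂ, IsEigenpairOn H S E v ∧
    (∀ (E' : ℂ) (φ : EuclideanSpace ℂ ι), IsEigenpairOn H S E' φ →
      energyRank E' ≤ energyRank E) ∧
    ∀ φ : EuclideanSpace ℂ ι, IsEigenpairOn H S E φ → ∃ c : ℂ, φ = c • v

theorem IsGroundLine.ne_zero {H : Matrix ι ι ℂ} {S : Submodule ℂ (EuclideanSpace ℂ ι)}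
    {v : EuclideanSpace ℂ ι} (hv : IsGroundLine H S v) : v ≠ 0 := by
  obtain ⟨E, hE, -⟩ := hv
  exact (isEigenpairOn_iff.1 hE).2.2

theorem IsGroundLine.exists_smul {H : Matrix ι ι ℂ} {S : Submodule ℂ (EuclideanSpace ℂ ι)}
    {v ψ : EuclideanSpace ℂ ι} (hv : IsGroundLine H S v) (hψ : IsGroundState H S ψ) :
    ∃ c : ℂ, ψ = c • v := by
  obtain ⟨E, hE, hmax, hline⟩ := hv
  obtain ⟨-, E', hE', hmax'⟩ := hψ
  have : E' = E := energyRank_injective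
    (le_antisymm (hmax _ _ hE') ((energyRank_le_iff _ _).2 (hmax' _ _ hE)))
  exact hline ψ (this ▸ hE')

theorem IsGroundLine.isGroundState {H : Matrix ι ι ℂ} {S : Submodule ℂ (EuclideanSpace ℂ ι)}
    {v : EuclideanSpace ℂ ι} (hv : IsGroundLine H S v) :
    IsGroundState H S (((‖v‖⁻¹ : ℝ) : ℂ) • v) := by
  have h0 := hv.ne_zero
  have hn : ‖v‖ ≠ 0 := by simpa using h0
  obtain ⟨E, hE, hmax, -⟩ := hv
  refine ⟨by simp [norm_smul, hn], E, ?_, fun E' φ h' => (energyRank_le_iff _ _).1 (hmax E' φ h')⟩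
  obtain ⟨h1, h2, -⟩ := isEigenpairOn_iff.1 hE
  refine isEigenpairOn_iff.2 ⟨S.smul_mem _ h1, ?_, ?_⟩
  · rw [map_smul, h2, smul_comm]
  · simp [h0]

/-- If the ground states near `h` form a line spanned by a vector that is differentiable at `h`,
the quantum Fisher information is well defined and is a normalized Gram determinant. -/
theorem hasGroundQFI_of_isGroundLine {H : ℝ → Matrix ι ι ℂ}
    {S : Submodule ℂ (EuclideanSpace ℂ ι)} {h : ℝ} {v : ℝ → EuclideanSpace ℂ ι}
    {v' : EuclideanSpace ℂ ι} (hv : HasDerivAt v v' h)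
    (hline : ∀ᶠ t in 𝓝 h, IsGroundLine (H t) S (v t)) :
    HasGroundQFI H S h (4 * (gram v' (v h) / ‖v h‖ ^ 4)) := by
  have h0 : v h ≠ 0 := hline.self_of_nhds.ne_zero
  refine ⟨⟨fun t => ((‖v t‖⁻¹ : ℝ) : ℂ) • v t, ?_, ?_⟩, ?_⟩
  · have hn : DifferentiableAt ℝ (fun t => ‖v t‖⁻¹) h :=
      (hv.differentiableAt.norm ℂ h0).inv (by simpa using h0)
    exact (Complex.ofRealCLM.differentiableAt.comp h hn).smul hv.differentiableAt
  · filter_upwards [hline] with t ht using ht.isGroundState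
  · rintro ψ ⟨hψ, hg⟩
    have key := gram_deriv_of_ray hv h0 hψ (by
      filter_upwards [hline, hg] with t ht hgt using ⟨hgt.1, ht.exists_smul hgt⟩)
    rw [qfi, ← key]
    congr 2
    rw [inner_self_eq_norm_sq_to_K]
    norm_cast

end Ground

/-! ### Ground states of the momentum blocks -/

/-- The ground state energy of a block as a function of `q = ε²`: `-√q` if the energies are real,
`i√(-q)` if they are imaginary. -/
def groundEnergy (q : ℝ) : ℂ :=
  if 0 < q then ((-√q : ℝ) : ℂ) else Complex.I * ((√(-q) : ℝ) : ℂ)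

theorem groundEnergy_sq (q : ℝ) : groundEnergy q ^ 2 = q := by
  unfold groundEnergy
  split_ifs with hq
  · rw [← Complex.ofReal_pow, neg_sq, Real.sq_sqrt hq.le]
  · rw [mul_pow, Complex.I_sq, ← Complex.ofReal_pow, Real.sq_sqrt (by linarith)]
    push_cast; ring

theorem groundEnergy_ne_zero {q : ℝ} (hq : q ≠ 0) : groundEnergy q ≠ 0 := by
  intro h
  have := groundEnergy_sq q
  rw [h] at this
  simp only [ne_eq, OfNat.ofNat_ne_zero, not_false_eq_true, zero_pow] at this
  exact hq (by exact_mod_cast this.symm)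

theorem energyRank_groundEnergy_pos {q : ℝ} (hq : q ≠ 0) : 0 < energyRank (groundEnergy q) := by
  rw [lt_iff_le_and_ne]
  constructor
  · rw [← map_zero energyRank, energyRank_le_iff]
    unfold groundEnergy
    split_ifs with h
    · right
      constructor
      · simp
      · simp
    · left
      have : 0 < -q := lt_of_le_of_ne (by linarith) (by intro h; exact hq (by linarith))
      simpa using this
  · intro h
    exact groundEnergy_ne_zero hq (energyRank_injective (by rw [← h, map_zero]))

/-- The derivative of the ground state energy along a differentiable family of `ε²`. -/
theorem hasDerivAt_groundEnergy {q : ℝ → ℝ} {q' h : ℝ} (hq : HasDerivAt q q' h) (h0 : q h ≠ 0) :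
    HasDerivAt (fun t => groundEnergy (q t)) (q' / (2 * groundEnergy (q h))) h := by
  have hc : ContinuousAt q h := hq.continuousAt
  rcases lt_or_gt_of_ne h0 with hneg | hpos
  · have hev : (fun t => groundEnergy (q t)) =ᶠ[𝓝 h]
        fun t => Complex.I * ((√(-q t) : ℝ) : ℂ) := by
      filter_upwards [hc.eventually_lt continuousAt_const hneg] with t ht
      simp only [groundEnergy, if_neg (not_lt.2 ht.le)]
    have hs : HasDerivAt (fun t => √(-q t)) (-q' / (2 * √(-q h))) h :=
      (hq.neg).sqrt (by simpa using h0)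
    have := (hs.ofReal_comp.const_mul Complex.I).congr_of_eventuallyEq hev
    refine this.congr_deriv ?_
    rw [groundEnergy, if_neg (not_lt.2 hneg.le)]
    have : ((√(-q h) : ℝ) : ℂ) ≠ 0 := by
      have : √(-q h) ≠ 0 := (Real.sqrt_pos.2 (by linarith)).ne'
      exact_mod_cast this
    push_cast
    field_simp
    rw [Complex.I_sq]; ring
  · have hev : (fun t => groundEnergy (q t)) =ᶠ[𝓝 h] fun t => ((-√(q t) : ℝ) : ℂ) := by
      filter_upwards [continuousAt_const.eventually_lt hc hpos] with t ht
      simp only [groundEnergy, if_pos ht]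
    have hs := (hq.sqrt h0).neg.ofReal_comp.congr_of_eventuallyEq hev
    refine hs.congr_deriv ?_
    rw [groundEnergy, if_pos hpos]
    push_cast
    rw [mul_neg, div_neg]

/-- The coefficients, in the basis of the block at momentum `φ`, of an unnormalized ground state
of that block. -/
def blockCoeff (γ K φ h : ℝ) : Fin 2 → ℂ :=
  ![(((γ + K) * Real.sin φ : ℝ) : ℂ),
    -((h + Real.cos φ : ℝ) + groundEnergy (energySq γ K h φ))]

/-- The derivative of `blockCoeff` with respect to `h`. -/
def blockCoeffDeriv (γ K φ h : ℝ) : Fin 2 → ℂ :=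
  ![0, -(1 + ((h + Real.cos φ : ℝ) : ℂ) / groundEnergy (energySq γ K h φ))]

theorem hasDerivAt_energySq (γ K φ h : ℝ) :
    HasDerivAt (fun t => energySq γ K t φ) (2 * (h + Real.cos φ)) h := by
  have := ((((hasDerivAt_id h).add_const (Real.cos φ)).pow 2).add_const
    ((K ^ 2 - γ ^ 2) * Real.sin φ ^ 2))
  refine this.congr_deriv ?_
  simp only [id_eq]
  ring

theorem hasDerivAt_blockCoeff {γ K φ h : ℝ} (h0 : energySq γ K h φ ≠ 0) :
    HasDerivAt (blockCoeff γ K φ) (blockCoeffDeriv γ K φ h) h := by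
  rw [hasDerivAt_pi]
  intro i
  fin_cases i
  · simpa [blockCoeff, blockCoeffDeriv] using hasDerivAt_const h _
  · have h1 : HasDerivAt (fun t : ℝ => ((t + Real.cos φ : ℝ) : ℂ)) ((1 : ℝ) : ℂ) h :=
      ((hasDerivAt_id h).add_const (Real.cos φ)).ofReal_comp
    have h2 := hasDerivAt_groundEnergy (hasDerivAt_energySq γ K φ h) h0
    have := (h1.add h2).neg
    refine this.congr_deriv ?_
    have := groundEnergy_ne_zero h0
    simp [blockCoeffDeriv]
    field_simp

theorem blockH_mulVec_blockCoeff (γ K φ h : ℝ) :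
    (blockH γ K φ h).mulVec (blockCoeff γ K φ h) =
      groundEnergy (energySq γ K h φ) • blockCoeff γ K φ h := by
  have hsq := groundEnergy_sq (energySq γ K h φ)
  set e := groundEnergy (energySq γ K h φ)
  have hE : ((energySq γ K h φ : ℝ) : ℂ) = ((h : ℂ) + Real.cos φ) ^ 2 +
      ((K : ℂ) ^ 2 - γ ^ 2) * (Real.sin φ : ℂ) ^ 2 := by
    simp only [energySq]; push_cast; ring
  rw [hE] at hsq
  ext i
  fin_cases i
  · simp [blockH, blockCoeff, Matrix.mulVec, dotProduct, Fin.sum_univ_two]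
    ring
  · simp [blockH, blockCoeff, Matrix.mulVec, dotProduct, Fin.sum_univ_two]
    push_cast at hsq
    linear_combination hsq

/-- The square of a block is the scalar `ε²`. -/
theorem blockH_mul_self (γ K φ h : ℝ) :
    blockH γ K φ h * blockH γ K φ h = ((energySq γ K h φ : ℝ) : ℂ) • 1 := by
  ext i j
  fin_cases i <;> fin_cases j <;>
    simp [blockH, energySq, Matrix.mul_apply, Fin.sum_univ_two] <;> ring

/-- Every eigenvector of a block for the ground energy is a multiple of `blockCoeff`. -/
theorem eq_smul_blockCoeff {γ K φ h : ℝ} (ha : (γ + K) * Real.sin φ ≠ 0) {u : Fin 2 → ℂ}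
    (hu : (blockH γ K φ h).mulVec u = groundEnergy (energySq γ K h φ) • u) :
    u = (u 0 / (((γ + K) * Real.sin φ : ℝ) : ℂ)) • blockCoeff γ K φ h := by
  have ha' : (((γ + K) * Real.sin φ : ℝ) : ℂ) ≠ 0 := by exact_mod_cast ha
  have h1 := congrFun hu 0
  simp only [blockH, Matrix.mulVec, dotProduct, Fin.sum_univ_two, Pi.smul_apply, smul_eq_mul,
    Matrix.of_apply, Matrix.cons_val_zero, Matrix.cons_val_one] at h1
  ext i
  fin_cases i
  · simp only [blockCoeff]
    simp only [Fin.zero_eta, Pi.smul_apply, Matrix.cons_val_zero, smul_eq_mul]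
    field_simp
  · simp only [blockCoeff]
    simp only [Fin.mk_one, Pi.smul_apply, Matrix.cons_val_one, Matrix.cons_val_zero, smul_eq_mul]
    field_simp
    rw [Complex.ofReal_neg, Complex.ofReal_neg] at h1
    linear_combination -h1

theorem sq_eq_cases {E : ℂ} {q : ℝ} (h : E ^ 2 = q) : E = groundEnergy q ∨ E = -groundEnergy q := by
  rw [← groundEnergy_sq q] at h
  exact sq_eq_sq_iff_eq_or_eq_neg.1 h

theorem isGroundLine_blockH {γ K φ h : ℝ} (ha : (γ + K) * Real.sin φ ≠ 0)
    (h0 : energySq γ K h φ ≠ 0) :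
    IsGroundLine (blockH γ K φ h) ⊤ (WithLp.toLp 2 (blockCoeff γ K φ h)) := by
  refine ⟨groundEnergy (energySq γ K h φ), isEigenpairOn_iff.2 ⟨trivial, ?_, ?_⟩, ?_, ?_⟩
  · rw [Matrix.toLpLin_apply, blockH_mulVec_blockCoeff]; rfl
  · intro hz
    have : blockCoeff γ K φ h 0 = 0 := congrFun (congrArg WithLp.ofLp hz) 0
    exact ha (Complex.ofReal_eq_zero.1 this)
  · intro E' u hu
    obtain ⟨-, hu, hne⟩ := isEigenpairOn_iff.1 hu
    have hpos := energyRank_groundEnergy_pos h0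
    have h2 : E' ^ 2 = (energySq γ K h φ : ℝ) := by
      have : Matrix.toEuclideanLin (blockH γ K φ h) (Matrix.toEuclideanLin (blockH γ K φ h) u) =
          E' ^ 2 • u := by rw [hu, map_smul, hu, smul_smul, sq]
      rw [Matrix.toLpLin_apply, Matrix.toLpLin_apply, Matrix.mulVec_mulVec, blockH_mul_self,
        Matrix.smul_mulVec, Matrix.one_mulVec] at this
      by_contra hcon
      have h3 : (((energySq γ K h φ : ℝ) : ℂ) - E' ^ 2) • u = 0 := by
        rw [sub_smul, ← this]; exact sub_self _
      rcases smul_eq_zero.1 h3 with h4 | h4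
      · exact hcon (sub_eq_zero.1 h4).symm
      · exact hne h4
    rcases sq_eq_cases h2 with h | h
    · rw [h]
    · rw [h, map_neg]
      exact (neg_nonpos.2 hpos.le).trans hpos.le
  · intro u hu
    obtain ⟨-, hu, -⟩ := isEigenpairOn_iff.1 hu
    rw [Matrix.toLpLin_apply] at hu
    have := eq_smul_blockCoeff ha (u := u.ofLp) (congrArg WithLp.ofLp hu)
    exact ⟨_, congrArg (WithLp.toLp 2) this⟩

/-- The quantum Fisher information of the ground state of the block at momentum `φ`. For
`ε² > 0` it is bounded by `1 / ε²`, with equality where `γ ε + K g = 0`. -/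
def blockQFI (γ K h φ : ℝ) : ℝ :=
  if 0 < energySq γ K h φ then
    (γ ^ 2 - K ^ 2) ^ 2 * Real.sin φ ^ 2 /
      (energySq γ K h φ * ((γ * √(energySq γ K h φ) + K * (h + Real.cos φ)) ^ 2 +
        (γ ^ 2 - K ^ 2) ^ 2 * Real.sin φ ^ 2))
  else (γ ^ 2 - K ^ 2) / (γ ^ 2 * -energySq γ K h φ)

theorem gram_two (x y : Fin 2 → ℂ) :
    gram (WithLp.toLp 2 x : EuclideanSpace ℂ (Fin 2)) (WithLp.toLp 2 y) =
      ‖x 0 * y 1 - x 1 * y 0‖ ^ 2 := by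
  have key : (gram (WithLp.toLp 2 x : EuclideanSpace ℂ (Fin 2)) (WithLp.toLp 2 y) : ℂ) =
      ((‖x 0 * y 1 - x 1 * y 0‖ ^ 2 : ℝ) : ℂ) := by
    rw [coe_gram, Complex.ofReal_pow, ← Complex.mul_conj', PiLp.inner_apply, PiLp.inner_apply,
      PiLp.inner_apply, PiLp.inner_apply]
    simp only [Fin.sum_univ_two, RCLike.inner_apply, map_sub, map_mul]
    ring
  exact_mod_cast key

theorem gram_blockCoeff {γ K φ h : ℝ} (hγ : γ ≠ 0) (hγK : |K| ≠ |γ|) (hs : Real.sin φ ≠ 0)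
    (h0 : energySq γ K h φ ≠ 0) :
    4 * (gram (WithLp.toLp 2 (blockCoeffDeriv γ K φ h) : EuclideanSpace ℂ (Fin 2))
        (WithLp.toLp 2 (blockCoeff γ K φ h)) /
      ‖(WithLp.toLp 2 (blockCoeff γ K φ h) : EuclideanSpace ℂ (Fin 2))‖ ^ 4) =
      blockQFI γ K h φ := by
  have hD : γ ^ 2 - K ^ 2 ≠ 0 := fun h => hγK ((sq_eq_sq_iff_abs_eq_abs K γ).1 (by linarith))
  have hp : γ + K ≠ 0 := fun h => hD (by linear_combination (γ - K) * h)
  have hm : γ - K ≠ 0 := fun h => hD (by linear_combination (γ + K) * h)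
  rw [gram_two]
  have hn4 : ‖(WithLp.toLp 2 (blockCoeff γ K φ h) : EuclideanSpace ℂ (Fin 2))‖ ^ 4 =
      (((γ + K) * Real.sin φ) ^ 2 +
        ‖((h + Real.cos φ : ℝ) : ℂ) + groundEnergy (energySq γ K h φ)‖ ^ 2) ^ 2 := by
    rw [show 4 = 2 * 2 from rfl, pow_mul, EuclideanSpace.norm_sq_eq, Fin.sum_univ_two]
    simp only [blockCoeff, Matrix.cons_val_zero, Matrix.cons_val_one, norm_neg,
      Complex.norm_real, Real.norm_eq_abs, sq_abs]
  have hnum : ‖blockCoeffDeriv γ K φ h 0 * blockCoeff γ K φ h 1 -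
      blockCoeffDeriv γ K φ h 1 * blockCoeff γ K φ h 0‖ ^ 2 = ((γ + K) * Real.sin φ) ^ 2 *
        ‖1 + ((h + Real.cos φ : ℝ) : ℂ) / groundEnergy (energySq γ K h φ)‖ ^ 2 := by
    simp only [blockCoeff, blockCoeffDeriv, Matrix.cons_val_zero, Matrix.cons_val_one, zero_mul,
      zero_sub, norm_neg, norm_mul, mul_pow, Complex.norm_real, Real.norm_eq_abs, sq_abs]
    ring
  rw [hn4, hnum, blockQFI]
  have hq : energySq γ K h φ = (h + Real.cos φ) ^ 2 + (K ^ 2 - γ ^ 2) * Real.sin φ ^ 2 := rfl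
  set q := energySq γ K h φ
  set g := h + Real.cos φ
  set s := Real.sin φ
  split_ifs with hpos
  · obtain ⟨r, hr⟩ : ∃ r, √q = r := ⟨_, rfl⟩
    have hr0 : 0 < r := hr ▸ Real.sqrt_pos.2 hpos
    have hrq : q = r ^ 2 := by rw [← hr, Real.sq_sqrt hpos.le]
    rw [groundEnergy, if_pos hpos, hr]
    rw [← Complex.ofReal_add, ← Complex.ofReal_div, ← Complex.ofReal_one, ← Complex.ofReal_add,
      Complex.norm_real, Complex.norm_real, Real.norm_eq_abs, Real.norm_eq_abs, sq_abs, sq_abs,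
      hrq]
    rw [hrq] at hq
    have hd1 : 0 < ((γ + K) * s) ^ 2 + (g + -r) ^ 2 := by positivity
    have hd2 : 0 < (γ * r + K * g) ^ 2 + (γ ^ 2 - K ^ 2) ^ 2 * s ^ 2 := by positivity
    have e1 : 1 + g / -r = (r - g) / r := by field_simp; ring
    rw [e1]
    have hs2 : (γ ^ 2 - K ^ 2) * s ^ 2 = g ^ 2 - r ^ 2 := by linarith
    -- `X (γ - K) = -2 (r - g) W` and `Y = W²` for the two denominators `X` and `Y`
    set W := K * r + γ * g with hW
    have hY : (γ * r + K * g) ^ 2 + (γ ^ 2 - K ^ 2) ^ 2 * s ^ 2 = W ^ 2 := by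
      linear_combination (γ ^ 2 - K ^ 2) * hs2
    have hX : ((γ + K) * s) ^ 2 + (g + -r) ^ 2 = -2 * (r - g) * W / (γ - K) := by
      rw [eq_div_iff hm]
      linear_combination (γ + K) * hs2
    have hW0 : W ≠ 0 := by rintro h; rw [hY, h] at hd2; simp at hd2
    have hu0 : r - g ≠ 0 := by rintro h; rw [hX, h] at hd1; simp at hd1
    rw [hY, hX]
    field_simp
    ring
  · have hneg : 0 < -q := lt_of_le_of_ne (by linarith) (by intro h; exact h0 (by linarith))
    obtain ⟨r, hr⟩ : ∃ r, √(-q) = r := ⟨_, rfl⟩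
    have hr0 : 0 < r := hr ▸ Real.sqrt_pos.2 hneg
    have hrq : -q = r ^ 2 := by rw [← hr, Real.sq_sqrt hneg.le]
    rw [groundEnergy, if_neg hpos, hr, hrq]
    have n1 : ‖(g : ℂ) + Complex.I * r‖ ^ 2 = g ^ 2 + r ^ 2 := by
      rw [← Complex.normSq_eq_norm_sq, Complex.normSq_apply]
      simp; ring
    have n2 : ‖1 + (g : ℂ) / (Complex.I * r)‖ ^ 2 = (g ^ 2 + r ^ 2) / r ^ 2 := by
      have hI : Complex.I * (r : ℂ) ≠ 0 := by simp [hr0.ne']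
      rw [show 1 + (g : ℂ) / (Complex.I * r) = (g + Complex.I * r) / (Complex.I * r) by
        rw [add_div, div_self hI, add_comm]]
      rw [norm_div, div_pow, n1]
      simp
    have hs2 : g ^ 2 + r ^ 2 = (γ ^ 2 - K ^ 2) * s ^ 2 := by linarith
    rw [n1, n2, hs2]
    have e2 : ((γ + K) * s) ^ 2 + (γ ^ 2 - K ^ 2) * s ^ 2 = 2 * γ * (γ + K) * s ^ 2 := by ring
    rw [e2]
    field_simp
    ring

/-! ### The algebra of a single pair of modes -/

section PairAlgebra

variable {A : Type*} [Ring A] [StarRing A]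

/-- `D` is a nilpotent partial isometry, as is the operator creating a pair of fermions. -/
structure IsPairCreation (D : A) : Prop where
  mul_self : D * D = 0
  mul_star_mul : D * star D * D = D

namespace IsPairCreation

variable {D : A} (hD : IsPairCreation D)
include hD

theorem star_mul_star : star D * star D = 0 := by
  rw [← star_mul, hD.mul_self, star_zero]

theorem star_mul_mul_star : star D * D * star D = star D := by
  have := congrArg star hD.mul_star_mul
  rwa [star_mul, star_mul, star_star, ← mul_assoc] at this

end IsPairCreation

variable [Algebra ℂ A]

/-- The `2 × 2` matrix `M` acting on a pair with creation operator `D`, in the basis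
(empty pair, full pair). -/
def pairOp (D : A) (M : Matrix (Fin 2) (Fin 2) ℂ) : A :=
  M 0 0 • (star D * D) + M 0 1 • star D + M 1 0 • D + M 1 1 • (D * star D)

theorem pairOp_smul (D : A) (c : ℂ) (M : Matrix (Fin 2) (Fin 2) ℂ) :
    pairOp D (c • M) = c • pairOp D M := by
  simp only [pairOp, Matrix.smul_apply, smul_eq_mul]
  module

/-- `pairOp D` is multiplicative: it represents the algebra of `2 × 2` matrices. -/
theorem IsPairCreation.pairOp_mul {D : A} (hD : IsPairCreation D)
    (M M' : Matrix (Fin 2) (Fin 2) ℂ) :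
    pairOp D M * pairOp D M' = pairOp D (M * M') := by
  have h1 := hD.mul_self
  have h2 := hD.star_mul_star
  have h3 : D * (star D * D) = D := by rw [← mul_assoc, hD.mul_star_mul]
  have h4 : star D * (D * star D) = star D := by rw [← mul_assoc, hD.star_mul_mul_star]
  have h5 : ∀ y, D * (D * y) = 0 := fun y => by rw [← mul_assoc, h1, zero_mul]
  have h6 : ∀ y, star D * (star D * y) = 0 := fun y => by rw [← mul_assoc, h2, zero_mul]
  simp only [pairOp, Matrix.mul_apply, Fin.sum_univ_two, mul_add, add_mul, smul_mul_assoc,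
    mul_smul_comm, mul_assoc, h1, h2, h3, h4, h5, h6, mul_zero, smul_zero]
  module

theorem Commute.pairOp_right {X D : A} (h : Commute X D) (h' : Commute X (star D))
    (M : Matrix (Fin 2) (Fin 2) ℂ) : Commute X (pairOp D M) :=
  (((((h'.mul_right h).smul_right _).add_right (h'.smul_right _)).add_right
    (h.smul_right _)).add_right ((h.mul_right h').smul_right _))

end PairAlgebra

/-! ### Product states of commuting pairs -/

section Pairs

variable {V : Type*} [NormedAddCommGroup V] [InnerProductSpace ℂ V]

/-- The product state in which the pair `p < n` is in the state `r p`, in the basis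
(empty pair, full pair), and the remaining pairs are empty. -/
def productState (D : ℕ → V →L[ℂ] V) (vac : V) (r : ℕ → Fin 2 → ℂ) : ℕ → V
  | 0 => vac
  | n + 1 => r n 0 • productState D vac r n + r n 1 • D n (productState D vac r n)

theorem productState_congr {D : ℕ → V →L[ℂ] V} {vac : V} {r r' : ℕ → Fin 2 → ℂ} {n : ℕ}
    (h : ∀ p < n, r p = r' p) : productState D vac r n = productState D vac r' n := by
  induction n with
  | zero => rfl
  | succ n ih =>
    rw [productState, productState, ih fun p hp => h p (by omega), h n (by omega)]

theorem productState_update {D : ℕ → V →L[ℂ] V} {vac : V} {r : ℕ → Fin 2 → ℂ} {n q : ℕ}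
    (h : n ≤ q) (x : Fin 2 → ℂ) :
    productState D vac (Function.update r q x) n = productState D vac r n :=
  productState_congr fun p hp => Function.update_of_ne (by omega) _ _

theorem productState_mem {D : ℕ → V →L[ℂ] V} {vac : V} {r : ℕ → Fin 2 → ℂ} {n : ℕ}
    {S : Submodule ℂ V} (h0 : vac ∈ S) (hD : ∀ p < n, ∀ x ∈ S, D p x ∈ S) :
    productState D vac r n ∈ S := by
  induction n with
  | zero => exact h0
  | succ n ih =>
    have := ih fun p hp => hD p (by omega)
    exact S.add_mem (S.smul_mem _ this) (S.smul_mem _ (hD n (by omega) _ this))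

/-- The product rule for a family of product states. -/
theorem hasDerivAt_productState {D : ℕ → V →L[ℂ] V} {vac : V} {r : ℝ → ℕ → Fin 2 → ℂ}
    {r' : ℕ → Fin 2 → ℂ} {h : ℝ} {n : ℕ} (hr : ∀ p < n, HasDerivAt (fun t => r t p) (r' p) h) :
    HasDerivAt (fun t => productState D vac (r t) n)
      (∑ p ∈ Finset.range n, productState D vac (Function.update (r h) p (r' p)) n) h := by
  induction n with
  | zero => simpa [productState] using hasDerivAt_const h vac
  | succ n ih =>
    have h1 := ih fun p hp => hr p (by omega)
    have h2 := fun i => (hasDerivAt_pi.1 (hr n (by omega))) i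
    have h3 : HasDerivAt (fun t => D n (productState D vac (r t) n)) _ h :=
      ((D n).restrictScalars ℝ).hasFDerivAt.comp_hasDerivAt h h1
    have h4 := ((h2 0).smul h1).add ((h2 1).smul h3)
    refine h4.congr_deriv ?_
    rw [Finset.sum_range_succ]
    have e1 : productState D vac (Function.update (r h) n (r' n)) (n + 1) =
        r' n 0 • productState D vac (r h) n + r' n 1 • D n (productState D vac (r h) n) := by
      rw [productState, Function.update_self, productState_update le_rfl]
    have e2 : ∑ p ∈ Finset.range n, productState D vac (Function.update (r h) p (r' p)) (n + 1) =
        r h n 0 • ∑ p ∈ Finset.range n, productState D vac (Function.update (r h) p (r' p)) n +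
        r h n 1 • D n (∑ p ∈ Finset.range n,
          productState D vac (Function.update (r h) p (r' p)) n) := by
      rw [map_sum, Finset.smul_sum, Finset.smul_sum, ← Finset.sum_add_distrib]
      refine Finset.sum_congr rfl fun p hp => ?_
      rw [productState, Function.update_of_ne (Finset.mem_range.1 hp).ne']
    rw [e1, e2, ContinuousLinearMap.coe_restrictScalars']
    abel

variable [CompleteSpace V]

/-- Creation operators of `m` independent pairs, with `vac` as their unique common vacuum. -/
structure IsPairFamily (m : ℕ) (D : ℕ → V →L[ℂ] V) (vac : V) : Prop where
  isPairCreation : ∀ p < m, IsPairCreation (D p)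
  comm : ∀ p < m, ∀ q < m, p ≠ q → Commute (D p) (D q)
  comm_star : ∀ p < m, ∀ q < m, p ≠ q → Commute (D p) (star (D q))
  norm_vac : ‖vac‖ = 1
  vac_empty : ∀ p < m, star (D p) (D p vac) = vac
  vac_unique : ∀ χ, (∀ p < m, star (D p) (D p χ) = χ) → ∃ c : ℂ, χ = c • vac

namespace IsPairFamily

variable {m : ℕ} {D : ℕ → V →L[ℂ] V} {vac : V} (hF : IsPairFamily m D vac)
include hF

theorem star_comm_star {p q : ℕ} (hp : p < m) (hq : q < m) (hpq : p ≠ q) :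
    Commute (star (D p)) (star (D q)) := (hF.comm p hp q hq hpq).star_star

theorem star_comm {p q : ℕ} (hp : p < m) (hq : q < m) (hpq : p ≠ q) :
    Commute (star (D p)) (D q) := (hF.comm_star q hq p hp hpq.symm).symm

theorem comm_pairOp {p q : ℕ} (hp : p < m) (hq : q < m) (hpq : p ≠ q)
    (M M' : Matrix (Fin 2) (Fin 2) ℂ) : Commute (pairOp (D p) M) (pairOp (D q) M') :=
  Commute.pairOp_right
    (Commute.pairOp_right (hF.comm q hq p hp hpq.symm) (hF.comm_star q hq p hp hpq.symm) M).symm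
    (Commute.pairOp_right (hF.star_comm hq hp hpq.symm) (hF.star_comm_star hq hp hpq.symm) M).symm
    M'

/-- In a product state of the pairs below `n`, the pairs from `n` on are empty. -/
theorem productState_empty (r : ℕ → Fin 2 → ℂ) {n q : ℕ} (hn : n ≤ q) (hq : q < m) :
    star (D q) (D q (productState D vac r n)) = productState D vac r n := by
  induction n with
  | zero => exact hF.vac_empty q hq
  | succ n ih =>
    have ih := ih (by omega)
    have h1 : ∀ x, star (D q) (D q (D n x)) = D n (star (D q) (D q x)) := fun x =>
      congrArg (fun T : V →L[ℂ] V => T x) ((hF.star_comm hq (by omega) (by omega)).mul_left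
        (hF.comm q hq n (by omega) (by omega))).eq
    simp only [productState, map_add, map_smul, h1, ih]

theorem star_productState (r : ℕ → Fin 2 → ℂ) {n q : ℕ} (hn : n ≤ q) (hq : q < m) :
    star (D q) (productState D vac r n) = 0 := by
  rw [← hF.productState_empty r hn hq]
  exact congrArg (fun T : V →L[ℂ] V => T (D q (productState D vac r n)))
    (hF.isPairCreation q hq).star_mul_star

/-- Inner products of product states factorize over the pairs. -/
theorem inner_productState (r s : ℕ → Fin 2 → ℂ) {n : ℕ} (hn : n ≤ m) :
    inner ℂ (productState D vac r n) (productState D vac s n) =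
      ∏ p ∈ Finset.range n, (inner ℂ (WithLp.toLp 2 (r p) : EuclideanSpace ℂ (Fin 2))
        (WithLp.toLp 2 (s p)) : ℂ) := by
  induction n with
  | zero => simp [productState, inner_self_eq_norm_sq_to_K, hF.norm_vac]
  | succ n ih =>
    have ih := ih (by omega)
    have hadj : ∀ x y : V, inner ℂ (D n x) y = inner ℂ x (star (D n) y) := fun x y => by
      rw [ContinuousLinearMap.star_eq_adjoint, ContinuousLinearMap.adjoint_inner_right]
    have hadj' : ∀ x y : V, inner ℂ x (D n y) = inner ℂ (star (D n) x) y := fun x y => by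
      rw [ContinuousLinearMap.star_eq_adjoint, ContinuousLinearMap.adjoint_inner_left]
    rw [Finset.prod_range_succ, ← ih, productState, productState]
    simp only [inner_add_left, inner_add_right, inner_smul_left, inner_smul_right]
    rw [hadj _ (D n _), hF.productState_empty s le_rfl (by omega), hadj,
      hF.star_productState s le_rfl (by omega), hadj', hF.star_productState r le_rfl (by omega),
      PiLp.inner_apply, Fin.sum_univ_two]
    simp only [inner_zero_left, inner_zero_right, RCLike.inner_apply]
    ring

theorem norm_sq_productState (r : ℕ → Fin 2 → ℂ) {n : ℕ} (hn : n ≤ m) :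
    ‖productState D vac r n‖ ^ 2 = ∏ p ∈ Finset.range n,
      ‖(WithLp.toLp 2 (r p) : EuclideanSpace ℂ (Fin 2))‖ ^ 2 := by
  have := hF.inner_productState r r hn
  simp only [inner_self_eq_norm_sq_to_K] at this
  exact_mod_cast this

/-- A one-pair operator acts on a product state through the state of that pair. -/
theorem pairOp_productState (r : ℕ → Fin 2 → ℂ) (M : Matrix (Fin 2) (Fin 2) ℂ) {n q : ℕ}
    (hq : q < n) (hn : n ≤ m) :
    pairOp (D q) M (productState D vac r n) =
      productState D vac (Function.update r q (M.mulVec (r q))) n := by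
  induction n with
  | zero => omega
  | succ n ih =>
    rcases Nat.lt_succ_iff_lt_or_eq.1 hq with h | rfl
    · have ih := ih h (by omega)
      have hc : ∀ x, pairOp (D q) M (D n x) = D n (pairOp (D q) M x) := fun x =>
        congrArg (fun T : V →L[ℂ] V => T x)
          (Commute.pairOp_right (hF.comm n (by omega) q (by omega) (by omega))
            (hF.comm_star n (by omega) q (by omega) (by omega)) M).symm.eq
      simp only [productState, map_add, map_smul, hc, ih]
      rw [Function.update_of_ne h.ne']
    · have hq' : q < m := by omega
      have h1 := hF.productState_empty r le_rfl hq'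
      have h2 := hF.star_productState r le_rfl hq'
      have h3 : ∀ x, D q (D q x) = 0 := fun x =>
        congrArg (fun T : V →L[ℂ] V => T x) (hF.isPairCreation q hq').mul_self
      simp only [productState, Function.update_self, productState_update le_rfl, pairOp,
        add_apply, smul_apply, mul_apply_eq_comp, map_add, map_smul, h1, h2, h3, map_zero,
        smul_zero,
        Matrix.mulVec, dotProduct, Fin.sum_univ_two]
      module

/-- A joint eigenvector of one-pair operators with nonzero simple eigenvalues is the product of
the corresponding one-pair eigenvectors. -/
theorem exists_smul_productState {M : ℕ → Matrix (Fin 2) (Fin 2) ℂ} {e : ℕ → ℂ}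
    {u : ℕ → Fin 2 → ℂ} (he : ∀ p < m, e p ≠ 0) (hu0 : ∀ p < m, u p 0 ≠ 0)
    (hM : ∀ p < m, M p 0 1 ≠ 0) (hu : ∀ p < m, (M p).mulVec (u p) = e p • u p)
    {n : ℕ} (hn : n ≤ m) {χ : V} (hχ : ∀ p < n, pairOp (D p) (M p) χ = e p • χ)
    (hempty : ∀ q < m, n ≤ q → star (D q) (D q χ) = χ) :
    ∃ c : ℂ, χ = c • productState D vac u n := by
  induction n generalizing χ with
  | zero => exact hF.vac_unique χ fun p hp => hempty p hp (Nat.zero_le _)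
  | succ n ih =>
    have hnm : n < m := by omega
    have hP := hF.isPairCreation n hnm
    have key := hχ n (by omega)
    -- `χ` has no component in which the pair `n` is half filled
    have hfull : star (D n) (D n χ) + D n (star (D n) χ) = χ := by
      have h1 : pairOp (D n) 1 (pairOp (D n) (M n) χ) = pairOp (D n) (M n) χ := by
        have := congrArg (fun T : V →L[ℂ] V => T χ) (hP.pairOp_mul 1 (M n))
        rwa [one_mul] at this
      rw [key, map_smul] at h1
      have h2 := smul_right_injective V (he n hnm) h1
      simpa [pairOp] using h2
    -- the amplitude of the full pair is slaved to that of the empty pair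
    have hrow : star (D n) χ = ((e n - M n 0 0) / M n 0 1) • star (D n) (D n χ) := by
      have a1 : ∀ x, D n (D n x) = 0 := fun x =>
        congrArg (fun T : V →L[ℂ] V => T x) hP.mul_self
      have a3 : ∀ x, star (D n) (D n (star (D n) x)) = star (D n) x := fun x =>
        congrArg (fun T : V →L[ℂ] V => T x) hP.star_mul_mul_star
      have h1 := congrArg (fun x => star (D n) (D n x)) key
      simp only [pairOp, add_apply, smul_apply, mul_apply_eq_comp, map_add, map_smul, a1, a3,
        smul_zero,
        add_zero] at h1
      have h2 : M n 0 1 • star (D n) χ = (e n - M n 0 0) • star (D n) (D n χ) := by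
        rw [sub_smul, ← h1]; abel
      rw [div_eq_inv_mul, mul_smul, ← h2, smul_smul, inv_mul_cancel₀ (hM n hnm), one_smul]
    have hu1 : u n 1 = ((e n - M n 0 0) / M n 0 1) * u n 0 := by
      have := congrFun (hu n hnm) 0
      simp only [Matrix.mulVec, dotProduct, Fin.sum_univ_two, Pi.smul_apply, smul_eq_mul] at this
      have hM' := hM n hnm
      field_simp
      linear_combination this
    have hcomm : ∀ p < m, p ≠ n → ∀ T : V →L[ℂ] V, Commute T (star (D n)) → Commute T (D n) →
        T (star (D n) (D n χ)) = star (D n) (D n (T χ)) := fun p _ _ T h1 h2 =>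
      congrArg (fun T : V →L[ℂ] V => T χ) (h1.mul_right h2).eq
    obtain ⟨c, hc⟩ := ih (by omega) (χ := star (D n) (D n χ))
      (fun p hp => by
        rw [hcomm p (by omega) (by omega)
          _ (Commute.pairOp_right (hF.star_comm hnm (by omega) (by omega))
            (hF.star_comm_star hnm (by omega) (by omega)) _).symm
          (Commute.pairOp_right (hF.comm n hnm p (by omega) (by omega))
            (hF.comm_star n hnm p (by omega) (by omega)) _).symm, hχ p (by omega), map_smul,
          map_smul])
      (fun q hq hnq => by
        rcases hnq.eq_or_lt with rfl | h
        · exact congrArg (fun T : V →L[ℂ] V => star (D n) (T χ)) hP.mul_star_mul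
        · have := hcomm q hq h.ne' (star (D q) * D q)
            ((hF.star_comm_star hq hnm h.ne').mul_left (hF.comm_star q hq n hnm h.ne'))
            ((hF.star_comm hq hnm h.ne').mul_left (hF.comm q hq n hnm h.ne'))
          simp only [mul_apply_eq_comp] at this
          rw [this, hempty q hq (by omega)])
    refine ⟨(u n 0)⁻¹ * c, ?_⟩
    have := hu0 n hnm
    rw [← hfull, hrow, hc, productState, hu1]
    simp only [map_smul, smul_add, smul_smul]
    congr 2 <;> field_simp

end IsPairFamily

end Pairs

/-! ### Spectrum of a sum of commuting one-pair operators -/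

section JointSpectrum

variable {V : Type*} [AddCommGroup V] [Module ℂ V]

/-- Commuting operators annihilated by `X(X - e)(X + e)` have a joint eigenvector in every nonzero
subspace that they all preserve. -/
theorem exists_joint_eigenvector {T : ℕ → Module.End ℂ V} {e : ℕ → ℂ} {W : Submodule ℂ V} {n : ℕ}
    (hcomm : ∀ p < n, ∀ q < n, Commute (T p) (T q)) (hW : ∀ p < n, ∀ x ∈ W, T p x ∈ W)
    (hcube : ∀ p < n, ∀ x, T p (T p (T p x)) = e p ^ 2 • T p x) {φ : V} (hφ : φ ∈ W)
    (h0 : φ ≠ 0) :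
    ∃ χ ∈ W, χ ≠ 0 ∧ ∃ s : ℕ → ℂ, ∀ p < n, T p χ = s p • χ ∧
      (s p = 0 ∨ s p = e p ∨ s p = -e p) := by
  induction n with
  | zero => exact ⟨φ, hφ, h0, 0, by simp⟩
  | succ n ih =>
    obtain ⟨χ, hχ, hχ0, s, hs⟩ := ih (fun p hp q hq => hcomm p (by omega) q (by omega))
      (fun p hp => hW p (by omega)) (fun p hp => hcube p (by omega))
    have hTs : ∀ x, (∀ p < n, T p x = s p • x) → ∀ p < n, T p (T n x) = s p • T n x := by
      intro x hx p hp
      have := congrArg (fun A : Module.End ℂ V => A x) (hcomm p (by omega) n (by omega)).eq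
      simp only [Module.End.mul_apply] at this
      rw [this, hx p hp, map_smul]
    have hnW : ∀ x ∈ W, T n x ∈ W := hW n (by omega)
    -- it suffices to find a joint eigenvector of the first `n` operators that `T n` rescales
    have fin : ∀ x ∈ W, x ≠ 0 → (∀ p < n, T p x = s p • x) → ∀ z, T n x = z • x →
        (z = 0 ∨ z = e n ∨ z = -e n) → ∃ χ ∈ W, χ ≠ 0 ∧ ∃ s : ℕ → ℂ, ∀ p < n + 1,
          T p χ = s p • χ ∧ (s p = 0 ∨ s p = e p ∨ s p = -e p) := by
      intro x hx hx0 hxs z hz hz'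
      refine ⟨x, hx, hx0, Function.update s n z, fun p hp => ?_⟩
      rcases Nat.lt_succ_iff_lt_or_eq.1 hp with h | rfl
      · rw [Function.update_of_ne h.ne]
        exact ⟨hxs p h, (hs p h).2⟩
      · rw [Function.update_self]
        exact ⟨hz, hz'⟩
    have hs' : ∀ p < n, T p χ = s p • χ := fun p hp => (hs p hp).1
    by_cases h1 : T n χ = 0
    · exact fin χ hχ hχ0 hs' 0 (by rw [h1, zero_smul]) (Or.inl rfl)
    by_cases h2 : T n (T n χ) = e n • T n χ
    · exact fin _ (hnW _ hχ) h1 (hTs _ hs') _ h2 (Or.inr (Or.inl rfl))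
    · refine fin (T n (T n χ) - e n • T n χ)
        (W.sub_mem (hnW _ (hnW _ hχ)) (W.smul_mem _ (hnW _ hχ))) (sub_ne_zero.2 h2)
        (fun p hp => ?_) (-e n) ?_ (Or.inr (Or.inr rfl))
      · rw [map_sub, map_smul, hTs _ (hTs _ hs') p hp, hTs _ hs' p hp]
        module
      · rw [map_sub, map_smul, hcube n (by omega)]
        module

variable {T : ℕ → Module.End ℂ V} {q : ℕ → ℝ} {m : ℕ}

theorem energyRank_le_of_cases {q : ℝ} (hq : q ≠ 0) {z : ℂ}
    (hz : z = 0 ∨ z = groundEnergy q ∨ z = -groundEnergy q) :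
    energyRank z ≤ energyRank (groundEnergy q) := by
  have := energyRank_groundEnergy_pos hq
  rcases hz with rfl | rfl | rfl
  · rw [map_zero]; exact this.le
  · exact le_rfl
  · rw [map_neg]; exact (neg_nonpos.2 this.le).trans this.le

/-- An eigenvalue of a sum of commuting operators with eigenvalues in `{0, e, -e}` has at most the
rank of the sum of the ground energies. -/
theorem energyRank_le_sum (hq : ∀ p < m, q p ≠ 0)
    (hcomm : ∀ p < m, ∀ p' < m, Commute (T p) (T p'))
    (hcube : ∀ p < m, ∀ x, T p (T p (T p x)) = groundEnergy (q p) ^ 2 • T p x)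
    {E : ℂ} {φ : V} (h0 : φ ≠ 0) (hφ : (∑ p ∈ Finset.range m, T p) φ = E • φ) :
    energyRank E ≤ energyRank (∑ p ∈ Finset.range m, groundEnergy (q p)) := by
  obtain ⟨χ, hχ, hχ0, s, hs⟩ := exists_joint_eigenvector hcomm
    (W := Module.End.eigenspace (∑ p ∈ Finset.range m, T p) E) (fun p hp x hx => by
      rw [Module.End.mem_eigenspace_iff] at hx ⊢
      have hc : Commute (∑ p ∈ Finset.range m, T p) (T p) :=
        Commute.sum_left _ _ _ fun p' hp' => hcomm p' (Finset.mem_range.1 hp') p hp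
      have := congrArg (fun A : Module.End ℂ V => A x) hc.eq
      simp only [Module.End.mul_apply] at this
      rw [this, hx, map_smul]) hcube (Module.End.mem_eigenspace_iff.2 hφ) h0
  rw [Module.End.mem_eigenspace_iff, LinearMap.sum_apply,
    Finset.sum_congr rfl fun p hp => (hs p (Finset.mem_range.1 hp)).1, ← Finset.sum_smul] at hχ
  rw [← smul_left_injective ℂ hχ0 hχ, map_sum, map_sum]
  exact Finset.sum_le_sum fun p hp =>
    energyRank_le_of_cases (hq p (Finset.mem_range.1 hp)) (hs p (Finset.mem_range.1 hp)).2

/-- An eigenvector for the sum of the ground energies is a joint eigenvector, with each of the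
operators in its ground state. -/
theorem apply_eq_of_sum_groundEnergy (hq : ∀ p < m, q p ≠ 0)
    (hcomm : ∀ p < m, ∀ p' < m, Commute (T p) (T p'))
    (hcube : ∀ p < m, ∀ x, T p (T p (T p x)) = groundEnergy (q p) ^ 2 • T p x)
    {φ : V} (hφ : (∑ p ∈ Finset.range m, T p) φ = (∑ p ∈ Finset.range m, groundEnergy (q p)) • φ)
    {p : ℕ} (hp : p < m) : T p φ = groundEnergy (q p) • φ := by
  by_contra hcon
  set e := groundEnergy (q p)
  set E := ∑ p ∈ Finset.range m, groundEnergy (q p)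
  have happ : ∀ p' < m, ∀ x, T p' (T p x) = T p (T p' x) := fun p' hp' x =>
    congrArg (fun A : Module.End ℂ V => A x) (hcomm p' hp' p hp).eq
  have hsum : ∀ p' < m, ∀ x,
      (∑ p ∈ Finset.range m, T p) (T p' x) = T p' ((∑ p ∈ Finset.range m, T p) x) := by
    intro p' hp' x
    have hc : Commute (∑ p ∈ Finset.range m, T p) (T p') :=
      Commute.sum_left _ _ _ fun p hp => hcomm p (Finset.mem_range.1 hp) p' hp'
    exact congrArg (fun A : Module.End ℂ V => A x) hc.eq
  -- the component of `φ` outside the ground space of `T p` has a joint eigenvector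
  -- on which `T p` does not take the value `e`
  obtain ⟨χ, hχ, hχ0, s, hs⟩ := exists_joint_eigenvector hcomm
    (W := Module.End.eigenspace (∑ p ∈ Finset.range m, T p) E ⊓
      LinearMap.ker (T p * T p + e • T p)) (φ := T p φ - e • φ) (fun p' hp' x hx => by
      rw [Submodule.mem_inf, Module.End.mem_eigenspace_iff, LinearMap.mem_ker] at hx ⊢
      refine ⟨by rw [hsum p' hp', hx.1, map_smul], ?_⟩
      have := hx.2
      simp only [LinearMap.add_apply, LinearMap.smul_apply, Module.End.mul_apply] at this ⊢
      rw [← happ p' hp', ← happ p' hp', ← map_smul, ← map_add, this, map_zero]) hcube (by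
      rw [Submodule.mem_inf, Module.End.mem_eigenspace_iff, LinearMap.mem_ker]
      refine ⟨by rw [map_sub, map_smul, hsum p hp, hφ, map_smul]; module, ?_⟩
      simp only [LinearMap.add_apply, LinearMap.smul_apply, Module.End.mul_apply, map_sub,
        map_smul, hcube p hp]
      module) (sub_ne_zero.2 hcon)
  rw [Submodule.mem_inf, Module.End.mem_eigenspace_iff, LinearMap.mem_ker, LinearMap.sum_apply,
    Finset.sum_congr rfl fun p hp => (hs p (Finset.mem_range.1 hp)).1, ← Finset.sum_smul] at hχ
  obtain ⟨h1, h2⟩ := hχ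
  have hne : s p ≠ e := by
    intro h
    have he := groundEnergy_ne_zero (hq p hp)
    simp only [LinearMap.add_apply, LinearMap.smul_apply, Module.End.mul_apply, (hs p hp).1, h,
      map_smul] at h2
    rw [smul_smul, ← add_smul, smul_eq_zero] at h2
    rcases h2 with h2 | h2
    · have : 2 * (e * e) = 0 := by linear_combination h2
      simp [he, e] at this
    · exact hχ0 h2
  have hE := congrArg energyRank (smul_left_injective ℂ hχ0 h1)
  refine hE.not_lt ?_
  simp only [E, map_sum]
  refine Finset.sum_lt_sum (fun p hp =>
    energyRank_le_of_cases (hq p (Finset.mem_range.1 hp)) (hs p (Finset.mem_range.1 hp)).2)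
    ⟨p, Finset.mem_range.2 hp, ?_⟩
  exact lt_of_le_of_ne (energyRank_le_of_cases (hq p hp) (hs p hp).2)
    fun h => hne (energyRank_injective h)

end JointSpectrum

/-! ### Ground states of a system of independent pairs -/

section PairSystem

theorem productState_update_smul_add {V : Type*} [NormedAddCommGroup V] [InnerProductSpace ℂ V]
    {D : ℕ → V →L[ℂ] V} {vac : V} (r : ℕ → Fin 2 → ℂ) (c : ℂ) (w : Fin 2 → ℂ) {n p : ℕ}
    (hp : p < n) :
    productState D vac (Function.update r p (c • r p + w)) n =
      c • productState D vac r n + productState D vac (Function.update r p w) n := by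
  induction n with
  | zero => omega
  | succ n ih =>
    rcases Nat.lt_succ_iff_lt_or_eq.1 hp with h | rfl
    · simp only [productState, ih h, Function.update_of_ne h.ne', map_add, map_smul]
      module
    · simp only [productState, productState_update le_rfl, Function.update_self, Pi.add_apply,
        Pi.smul_apply, smul_eq_mul]
      module

variable {V : Type*} [NormedAddCommGroup V] [InnerProductSpace ℂ V] [CompleteSpace V]
variable {m : ℕ} {D : ℕ → V →L[ℂ] V} {vac : V}

/-- Additivity of the normalized Gram determinant, hence of the quantum Fisher information, for
product states. Only the components of the derivatives orthogonal to the states matter, and these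
give mutually orthogonal product states. -/
theorem IsPairFamily.gram_productState (hF : IsPairFamily m D vac) {r r' : ℕ → Fin 2 → ℂ}
    (hr : ∀ p < m, r p ≠ 0) :
    gram (∑ p ∈ Finset.range m, productState D vac (Function.update r p (r' p)) m)
        (productState D vac r m) / ‖productState D vac r m‖ ^ 4 =
      ∑ p ∈ Finset.range m, gram (WithLp.toLp 2 (r' p) : EuclideanSpace ℂ (Fin 2))
        (WithLp.toLp 2 (r p)) / ‖(WithLp.toLp 2 (r p) : EuclideanSpace ℂ (Fin 2))‖ ^ 4 := by
  let L : (Fin 2 → ℂ) → EuclideanSpace ℂ (Fin 2) := WithLp.toLp 2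
  have hL0 : ∀ p < m, L (r p) ≠ 0 := fun p hp h => hr p hp (congrArg WithLp.ofLp h)
  -- decompose `r' p` along `r p`
  set c : ℕ → ℂ := fun p => inner ℂ (L (r p)) (L (r' p)) / inner ℂ (L (r p)) (L (r p)) with hc
  set w : ℕ → Fin 2 → ℂ := fun p => r' p - c p • r p with hw
  have hr' : ∀ p, r' p = c p • r p + w p := fun p => by simp [hw]
  have hLr' : ∀ p, L (r' p) = L (w p) + c p • L (r p) := fun p => by
    conv_lhs => rw [hr' p, add_comm]
    rfl
  have horth' : ∀ p < m, (inner ℂ (L (r p)) (L (w p)) : ℂ) = 0 := fun p hp => by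
    have h1 : (inner ℂ (L (r p)) (L (r p)) : ℂ) ≠ 0 := by simpa using hL0 p hp
    have h2 : L (w p) = L (r' p) - c p • L (r p) := by rw [hLr' p]; abel
    rw [h2, inner_sub_right, inner_smul_right, hc]
    field_simp
    ring
  have horth : ∀ p < m, (inner ℂ (L (w p)) (L (r p)) : ℂ) = 0 := fun p hp => by
    rw [← inner_conj_symm, horth' p hp, map_zero]
  set P := productState D vac r m with hP
  set Q : ℕ → V := fun p => productState D vac (Function.update r p (w p)) m with hQ
  have hQP : ∀ p < m, (inner ℂ (Q p) P : ℂ) = 0 := fun p hp => by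
    rw [hQ, hP, hF.inner_productState _ _ le_rfl]
    refine Finset.prod_eq_zero (Finset.mem_range.2 hp) ?_
    rw [Function.update_self]
    exact horth p hp
  have hQQ : ∀ p < m, ∀ q < m, p ≠ q → (inner ℂ (Q p) (Q q) : ℂ) = 0 := fun p hp q hq hpq => by
    rw [hQ, hF.inner_productState _ _ le_rfl]
    refine Finset.prod_eq_zero (Finset.mem_range.2 hp) ?_
    rw [Function.update_self, Function.update_of_ne hpq]
    exact horth p hp
  have hQn : ∀ p < m, ‖Q p‖ ^ 2 * ‖L (r p)‖ ^ 2 = ‖L (w p)‖ ^ 2 * ‖P‖ ^ 2 := fun p hp => by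
    rw [hQ, hP, hF.norm_sq_productState _ le_rfl, hF.norm_sq_productState _ le_rfl,
      ← Finset.mul_prod_erase _ _ (Finset.mem_range.2 hp),
      ← Finset.mul_prod_erase _ (fun k => ‖(WithLp.toLp 2 (r k) : EuclideanSpace ℂ (Fin 2))‖ ^ 2)
        (Finset.mem_range.2 hp), Function.update_self]
    have : ∏ k ∈ (Finset.range m).erase p,
        ‖(WithLp.toLp 2 (Function.update r p (w p) k) : EuclideanSpace ℂ (Fin 2))‖ ^ 2 =
        ∏ k ∈ (Finset.range m).erase p, ‖(WithLp.toLp 2 (r k) : EuclideanSpace ℂ (Fin 2))‖ ^ 2 :=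
      Finset.prod_congr rfl fun k hk => by rw [Function.update_of_ne (Finset.ne_of_mem_erase hk)]
    rw [this]
    simp only [L]
    ring
  have hsum : ∑ p ∈ Finset.range m, productState D vac (Function.update r p (r' p)) m =
      (1 : ℂ) • ∑ p ∈ Finset.range m, Q p + (∑ p ∈ Finset.range m, c p) • P := by
    rw [one_smul, Finset.sum_smul, ← Finset.sum_add_distrib]
    refine Finset.sum_congr rfl fun p hp => ?_
    rw [hr' p, productState_update_smul_add _ _ _ (Finset.mem_range.1 hp), add_comm]
  have hP0 : ‖P‖ ≠ 0 := by
    have : ‖P‖ ^ 2 ≠ 0 := by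
      rw [hP, hF.norm_sq_productState _ le_rfl, Finset.prod_ne_zero_iff]
      intro p hp
      simpa [L] using hL0 p (Finset.mem_range.1 hp)
    exact fun h => this (by rw [h]; simp)
  have hgram : gram ((1 : ℂ) • ∑ p ∈ Finset.range m, Q p + (∑ p ∈ Finset.range m, c p) • P) P =
      (∑ p ∈ Finset.range m, ‖Q p‖ ^ 2) * ‖P‖ ^ 2 := by
    have h1 := gram_smul_add_smul (∑ p ∈ Finset.range m, Q p) P (∑ p ∈ Finset.range m, c p) 1 1
    rw [one_smul ℂ P] at h1
    rw [h1]
    have h2 : (inner ℂ (∑ p ∈ Finset.range m, Q p) P : ℂ) = 0 := by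
      rw [sum_inner]
      exact Finset.sum_eq_zero fun p hp => hQP p (Finset.mem_range.1 hp)
    have h3 : ‖∑ p ∈ Finset.range m, Q p‖ ^ 2 = ∑ p ∈ Finset.range m, ‖Q p‖ ^ 2 := by
      have : (inner ℂ (∑ p ∈ Finset.range m, Q p) (∑ p ∈ Finset.range m, Q p) : ℂ) =
          ∑ p ∈ Finset.range m, inner ℂ (Q p) (Q p) := by
        rw [sum_inner]
        refine Finset.sum_congr rfl fun p hp => ?_
        rw [inner_sum]
        exact Finset.sum_eq_single_of_mem p hp fun q hq hqp =>
          hQQ p (Finset.mem_range.1 hp) q (Finset.mem_range.1 hq) hqp.symm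
      simp only [inner_self_eq_norm_sq_to_K] at this
      exact_mod_cast this
    simp [gram, h2, h3]
  rw [hsum, hgram, Finset.sum_mul, Finset.sum_div]
  refine Finset.sum_congr rfl fun p hp => ?_
  have hp := Finset.mem_range.1 hp
  have hg : gram (L (r' p)) (L (r p)) = ‖L (w p)‖ ^ 2 * ‖L (r p)‖ ^ 2 := by
    have h1 := gram_smul_add_smul (L (w p)) (L (r p)) (c p) 1 1
    rw [one_smul, one_smul, ← hLr' p] at h1
    rw [h1]
    simp [gram, horth p hp]
  have hn : ‖L (r p)‖ ≠ 0 := by simpa using hL0 p hp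
  have hQ' : ‖Q p‖ ^ 2 = ‖L (w p)‖ ^ 2 * ‖P‖ ^ 2 / ‖L (r p)‖ ^ 2 := by
    rw [eq_div_iff (pow_ne_zero 2 hn), hQn p hp]
  change _ = gram (L (r' p)) (L (r p)) / ‖L (r p)‖ ^ 4
  rw [hg, hQ']
  field_simp

end PairSystem

section Chain

variable {ι : Type*} [Fintype ι] [DecidableEq ι] {m : ℕ}
  {D : ℕ → EuclideanSpace ℂ ι →L[ℂ] EuclideanSpace ℂ ι} {vac : EuclideanSpace ℂ ι}
  {S : Submodule ℂ (EuclideanSpace ℂ ι)} {γ K : ℝ} {φ : ℕ → ℝ}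

/-- If `H` acts in the sector `S` as a sum of momentum blocks, one for each pair, its ground
states there are spanned by the product of the ground states of the blocks. -/
theorem IsPairFamily.isGroundLine (hF : IsPairFamily m D vac) (hvac : vac ∈ S)
    (hDS : ∀ p < m, ∀ x ∈ S, D p x ∈ S) {H : Matrix ι ι ℂ} {h : ℝ}
    (hH : ∀ x ∈ S, Matrix.toEuclideanLin H x =
      ∑ p ∈ Finset.range m, pairOp (D p) (blockH γ K (φ p) h) x)
    (ha : ∀ p < m, (γ + K) * Real.sin (φ p) ≠ 0) (h0 : ∀ p < m, energySq γ K h (φ p) ≠ 0) :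
    IsGroundLine H S (productState D vac (fun p => blockCoeff γ K (φ p) h) m) := by
  set r : ℕ → Fin 2 → ℂ := fun p => blockCoeff γ K (φ p) h with hr
  set q : ℕ → ℝ := fun p => energySq γ K h (φ p) with hq
  set T : ℕ → Module.End ℂ (EuclideanSpace ℂ ι) :=
    fun p => (pairOp (D p) (blockH γ K (φ p) h)).toLinearMap with hT
  have hHT : ∀ x ∈ S, Matrix.toEuclideanLin H x = (∑ p ∈ Finset.range m, T p) x := fun x hx => by
    rw [hH x hx, LinearMap.sum_apply]; rfl
  have hr0 : ∀ p < m, r p 0 ≠ 0 := fun p hp => by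
    exact Complex.ofReal_ne_zero.2 (ha p hp)
  have hcomm : ∀ p < m, ∀ p' < m, Commute (T p) (T p') := by
    intro p hp p' hp'
    by_cases hpp : p = p'
    · rw [hpp]
    · exact congrArg ContinuousLinearMap.toLinearMap (hF.comm_pairOp hp hp' hpp _ _).eq
  have hcube : ∀ p < m, ∀ x, T p (T p (T p x)) = groundEnergy (q p) ^ 2 • T p x := by
    intro p hp x
    have hP := hF.isPairCreation p hp
    have : pairOp (D p) (blockH γ K (φ p) h) * (pairOp (D p) (blockH γ K (φ p) h) *
        pairOp (D p) (blockH γ K (φ p) h)) =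
        ((q p : ℝ) : ℂ) • pairOp (D p) (blockH γ K (φ p) h) := by
      rw [hP.pairOp_mul, hP.pairOp_mul, blockH_mul_self, mul_smul_comm, mul_one, pairOp_smul]
    rw [groundEnergy_sq]
    exact congrArg (fun A : EuclideanSpace ℂ ι →L[ℂ] EuclideanSpace ℂ ι => A x) this
  have hgs : ∀ p < m, T p (productState D vac r m) =
      groundEnergy (q p) • productState D vac r m := by
    intro p hp
    have h1 : T p (productState D vac r m) = _ :=
      hF.pairOp_productState r (blockH γ K (φ p) h) hp le_rfl
    have h2 := productState_update_smul_add (D := D) (vac := vac) r (groundEnergy (q p)) 0 hp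
    have h3 := productState_update_smul_add (D := D) (vac := vac) r 0 0 hp
    rw [h1, hr, blockH_mulVec_blockCoeff]
    rw [zero_smul, zero_smul, zero_add, zero_add] at h3
    rw [add_zero] at h2
    refine h2.trans ?_
    -- the product state with one factor zero vanishes
    have h4 : productState D vac (Function.update r p 0) m = 0 := by
      have h5 := hF.norm_sq_productState (Function.update r p 0) le_rfl
      rw [Finset.prod_eq_zero (Finset.mem_range.2 hp) (by simp)] at h5
      simpa using h5
    rw [h4, add_zero]
  have hmem : productState D vac r m ∈ S := productState_mem hvac hDS
  have hne : productState D vac r m ≠ 0 := by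
    intro hz
    have h5 := hF.norm_sq_productState r le_rfl
    rw [hz, norm_zero, zero_pow two_ne_zero, eq_comm, Finset.prod_eq_zero_iff] at h5
    obtain ⟨p, hp, h6⟩ := h5
    have h7 : (WithLp.toLp 2 (r p) : EuclideanSpace ℂ (Fin 2)) = 0 := by simpa using h6
    exact hr0 p (Finset.mem_range.1 hp) (congrFun (congrArg WithLp.ofLp h7) 0)
  refine ⟨∑ p ∈ Finset.range m, groundEnergy (q p), isEigenpairOn_iff.2 ⟨hmem, ?_, hne⟩, ?_, ?_⟩
  · rw [hHT _ hmem, LinearMap.sum_apply, Finset.sum_smul]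
    exact Finset.sum_congr rfl fun p hp => hgs p (Finset.mem_range.1 hp)
  · intro E' x hx
    obtain ⟨hxS, hxE, hx0⟩ := isEigenpairOn_iff.1 hx
    exact energyRank_le_sum h0 hcomm hcube hx0 ((hHT x hxS).symm.trans hxE)
  · intro x hx
    obtain ⟨hxS, hxE, hx0⟩ := isEigenpairOn_iff.1 hx
    exact hF.exists_smul_productState (fun p hp => groundEnergy_ne_zero (h0 p hp)) hr0
      (fun p hp => Complex.ofReal_ne_zero.2 (neg_ne_zero.2 (ha p hp)))
      (fun p hp => blockH_mulVec_blockCoeff γ K (φ p) h) le_rfl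
      (fun p hp => apply_eq_of_sum_groundEnergy h0 hcomm hcube ((hHT x hxS).symm.trans hxE) hp)
      (fun p hp hmp => absurd hp (not_lt.2 hmp))

theorem continuous_energySq (γ K φ : ℝ) : Continuous fun h => energySq γ K h φ := by
  unfold energySq
  fun_prop

theorem IsPairFamily.hasGroundQFI (hF : IsPairFamily m D vac) (hvac : vac ∈ S)
    (hDS : ∀ p < m, ∀ x ∈ S, D p x ∈ S) {H : ℝ → Matrix ι ι ℂ} (h : ℝ)
    (hH : ∀ t, ∀ x ∈ S, Matrix.toEuclideanLin (H t) x =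
      ∑ p ∈ Finset.range m, pairOp (D p) (blockH γ K (φ p) t) x)
    (hγ : γ ≠ 0) (hγK : |K| ≠ |γ|) (hs : ∀ p < m, Real.sin (φ p) ≠ 0)
    (h0 : ∀ p < m, energySq γ K h (φ p) ≠ 0) :
    HasGroundQFI H S h (∑ p ∈ Finset.range m, blockQFI γ K h (φ p)) := by
  have hp : γ + K ≠ 0 := fun h => hγK (by rw [eq_neg_of_add_eq_zero_left h, abs_neg])
  have ha : ∀ p < m, (γ + K) * Real.sin (φ p) ≠ 0 := fun p h => mul_ne_zero hp (hs p h)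
  have hev : ∀ᶠ t in 𝓝 h, ∀ p ∈ Finset.range m, energySq γ K t (φ p) ≠ 0 := by
    rw [Filter.eventually_all_finset]
    exact fun p hp =>
      (continuous_energySq γ K (φ p)).continuousAt.eventually_ne (h0 p (Finset.mem_range.1 hp))
  have key := hasGroundQFI_of_isGroundLine (H := H) (S := S)
    (hasDerivAt_productState (D := D) (vac := vac) (n := m)
      (r := fun t p => blockCoeff γ K (φ p) t) fun p hp => hasDerivAt_blockCoeff (h0 p hp)) (by
      filter_upwards [hev] with t ht
      exact hF.isGroundLine hvac hDS (hH t) ha fun p hp => ht p (Finset.mem_range.2 hp))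
  rw [hF.gram_productState, Finset.mul_sum] at key
  · rwa [Finset.sum_congr rfl fun p hp => gram_blockCoeff hγ hγK (hs p (Finset.mem_range.1 hp))
      (h0 p (Finset.mem_range.1 hp))] at key
  · intro p hp hz
    have h1 : blockCoeff γ K (φ p) h 0 = 0 := congrFun hz 0
    exact ha p hp (Complex.ofReal_eq_zero.1 h1)

end Chain

theorem hasGroundQFI_blockH {γ K φ h : ℝ} (hγ : γ ≠ 0) (hγK : |K| ≠ |γ|) (hs : Real.sin φ ≠ 0)
    (h0 : energySq γ K h φ ≠ 0) : HasGroundQFI (blockH γ K φ) ⊤ h (blockQFI γ K h φ) := by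
  have hp : γ + K ≠ 0 := fun h => hγK (by rw [eq_neg_of_add_eq_zero_left h, abs_neg])
  rw [← gram_blockCoeff hγ hγK hs h0]
  refine hasGroundQFI_of_isGroundLine (v := fun t => WithLp.toLp 2 (blockCoeff γ K φ t)) ?_ ?_
  · exact (PiLp.continuousLinearEquiv 2 ℝ fun _ : Fin 2 => ℂ).symm.toContinuousLinearMap.hasFDerivAt
      |>.comp_hasDerivAt h (hasDerivAt_blockCoeff h0)
  · filter_upwards [(continuous_energySq γ K φ).continuousAt.eventually_ne h0] with t ht
      using isGroundLine_blockH (mul_ne_zero hp hs) ht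

/-! ### Canonical anticommutation relations -/

section CAR

variable {A : Type*} [Ring A] [StarRing A] {κ : Type*} [DecidableEq κ]

/-- The operators `c i` annihilate independent fermionic modes. -/
structure IsCAR (c : κ → A) : Prop where
  mul_add_mul : ∀ i j, c i * c j + c j * c i = 0
  mul_star_add : ∀ i j, c i * star (c j) + star (c j) * c i = if i = j then 1 else 0

namespace IsCAR

variable {c : κ → A} (hc : IsCAR c)
include hc

theorem mul_eq_neg (i j : κ) : c i * c j = -(c j * c i) := eq_neg_of_add_eq_zero_left
  (hc.mul_add_mul i j)

theorem star_mul_star_eq_neg (i j : κ) : star (c i) * star (c j) = -(star (c j) * star (c i)) := by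
  have := congrArg star (hc.mul_eq_neg j i)
  simpa using this

theorem mul_star_eq_neg {i j : κ} (h : i ≠ j) : c i * star (c j) = -(star (c j) * c i) :=
  eq_neg_of_add_eq_zero_left (by rw [hc.mul_star_add, if_neg h])

theorem star_mul_eq_neg {i j : κ} (h : i ≠ j) : star (c i) * c j = -(c j * star (c i)) := by
  rw [hc.mul_star_eq_neg h.symm, neg_neg]

theorem mul_star_self (i : κ) : c i * star (c i) = 1 - star (c i) * c i :=
  eq_sub_of_add_eq (by rw [hc.mul_star_add, if_pos rfl])

end IsCAR

/-- The creation operator of the pair of modes `i`, `j`. -/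
def pairCreation (c : κ → A) (i j : κ) : A := star (c j) * star (c i)

omit [DecidableEq κ] in
theorem star_pairCreation (c : κ → A) (i j : κ) : star (pairCreation c i j) = c i * c j := by
  simp [pairCreation]

omit [StarRing A] in
theorem commute_mul_of_anticommute {a b d : A} (hb : a * b = -(b * a)) (hd : a * d = -(d * a)) :
    Commute a (b * d) := by
  rw [commute_iff_eq, ← mul_assoc, hb, neg_mul, mul_assoc, hd, mul_neg, neg_neg, mul_assoc]

namespace IsCAR

variable [Algebra ℂ A] {c : κ → A} (hc : IsCAR c)
include hc

omit [Algebra ℂ A] in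
theorem commute_pairCreation {i j k l : κ} :
    Commute (pairCreation c i j) (pairCreation c k l) := by
  have h : ∀ a, Commute (star (c a)) (pairCreation c k l) := fun a =>
    commute_mul_of_anticommute (hc.star_mul_star_eq_neg _ _) (hc.star_mul_star_eq_neg _ _)
  exact (h j).mul_left (h i)

omit [Algebra ℂ A] in
theorem commute_pairCreation_star {i j k l : κ} (hik : i ≠ k) (hil : i ≠ l) (hjk : j ≠ k)
    (hjl : j ≠ l) : Commute (pairCreation c i j) (star (pairCreation c k l)) := by
  rw [star_pairCreation]
  exact (commute_mul_of_anticommute (hc.star_mul_eq_neg hjk) (hc.star_mul_eq_neg hjl)).mul_left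
    (commute_mul_of_anticommute (hc.star_mul_eq_neg hik) (hc.star_mul_eq_neg hil))

theorem mul_self_eq_zero (i : κ) : c i * c i = 0 := by
  have h := hc.mul_add_mul i i
  rw [← two_smul ℂ, smul_eq_zero_iff_right two_ne_zero] at h
  exact h

theorem star_mul_star_self_eq_zero (i : κ) : star (c i) * star (c i) = 0 := by
  rw [← star_mul, hc.mul_self_eq_zero, star_zero]

theorem isPairCreation {i j : κ} (hij : i ≠ j) : IsPairCreation (pairCreation c i j) := by
  have hD : pairCreation c i j * pairCreation c i j = 0 := by
    rw [pairCreation, mul_assoc, ← mul_assoc (star (c i)), hc.star_mul_star_eq_neg i j]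
    rw [neg_mul, mul_neg, mul_assoc, hc.star_mul_star_self_eq_zero, mul_zero, mul_zero, neg_zero]
  refine ⟨hD, ?_⟩
  have hj : star (c j) * c j * star (c j) = star (c j) := by
    rw [mul_assoc, hc.mul_star_self, mul_sub, mul_one, ← mul_assoc, hc.star_mul_star_self_eq_zero,
      zero_mul, sub_zero]
  have hi : star (c i) * c i * star (c i) = star (c i) := by
    rw [mul_assoc, hc.mul_star_self, mul_sub, mul_one, ← mul_assoc, hc.star_mul_star_self_eq_zero,
      zero_mul, sub_zero]
  have h1 : Commute (star (c i) * c i) (star (c j)) :=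
    (commute_mul_of_anticommute (hc.star_mul_star_eq_neg j i) (hc.star_mul_eq_neg hij.symm)).symm
  have h2 : Commute (star (c i) * c i) (c j) :=
    (commute_mul_of_anticommute (hc.mul_star_eq_neg hij.symm) (hc.mul_eq_neg j i)).symm
  rw [star_pairCreation, pairCreation]
  calc star (c j) * star (c i) * (c i * c j) * (star (c j) * star (c i))
      = star (c j) * ((star (c i) * c i) * (c j * star (c j))) * star (c i) := by
        simp only [mul_assoc]
    _ = (star (c j) * c j * star (c j)) * (star (c i) * c i * star (c i)) := by
        rw [(h2.mul_right h1).eq]; simp only [mul_assoc]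
    _ = star (c j) * star (c i) := by rw [hj, hi]

omit [Algebra ℂ A] in
theorem pairCreation_mul_star_sub {i j : κ} (hij : i ≠ j) :
    pairCreation c i j * star (pairCreation c i j) -
        star (pairCreation c i j) * pairCreation c i j =
      star (c i) * c i + star (c j) * c j - 1 := by
  have h1 : Commute (star (c i) * c i) (star (c j)) :=
    (commute_mul_of_anticommute (hc.star_mul_star_eq_neg j i) (hc.star_mul_eq_neg hij.symm)).symm
  have e1 : pairCreation c i j * star (pairCreation c i j) =
      (star (c i) * c i) * (star (c j) * c j) := by
    rw [star_pairCreation, pairCreation]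
    calc star (c j) * star (c i) * (c i * c j) = star (c j) * (star (c i) * c i) * c j := by
          simp only [mul_assoc]
      _ = _ := by rw [← h1.eq, mul_assoc]
  have h3 : Commute (c i * star (c i)) (c j) :=
    (commute_mul_of_anticommute (hc.mul_eq_neg j i) (hc.mul_star_eq_neg hij.symm)).symm
  have h4 : Commute (c i) (c j * star (c j)) :=
    commute_mul_of_anticommute (hc.mul_eq_neg i j) (hc.mul_star_eq_neg hij)
  have e2 : star (pairCreation c i j) * pairCreation c i j =
      (c j * star (c j)) * (c i * star (c i)) := by
    rw [star_pairCreation, pairCreation, mul_assoc, ← mul_assoc (c j), ← mul_assoc, h4.eq,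
      mul_assoc]
  have h5 : Commute (star (c i) * c i) (star (c j) * c j) := h1.mul_right
    (commute_mul_of_anticommute (hc.mul_star_eq_neg hij.symm) (hc.mul_eq_neg j i)).symm
  rw [e1, e2, hc.mul_star_self, hc.mul_star_self, sub_mul, mul_sub, h5.eq]
  noncomm_ring

/-- The Bogoliubov form of the Hamiltonian of two modes is a one-pair operator. -/
theorem pairOp_blockH {i j : κ} (hij : i ≠ j) (γ K φ h : ℝ) :
    pairOp (pairCreation c i j) (blockH γ K φ h) =
      ((h + Real.cos φ : ℝ) : ℂ) • (star (c i) * c i + star (c j) * c j - 1)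
        - (((γ + K) * Real.sin φ : ℝ) : ℂ) • (c i * c j)
        + (((γ - K) * Real.sin φ : ℝ) : ℂ) • (star (c j) * star (c i)) := by
  rw [← hc.pairCreation_mul_star_sub hij]
  have h1 : star (pairCreation c i j) = c i * c j := star_pairCreation c i j
  simp only [pairOp, blockH, Matrix.of_apply, Matrix.cons_val_zero, Matrix.cons_val_one]
  rw [h1, pairCreation, Complex.ofReal_neg, Complex.ofReal_neg]
  module

/-- A unitary change of modes preserves the anticommutation relations. -/
theorem unitary [StarModule ℂ A] [Fintype κ] {κ' : Type*} [DecidableEq κ'] {U : Matrix κ' κ ℂ}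
    (hU : U * U.conjTranspose = 1) : IsCAR fun p => ∑ j, U p j • c j := by
  constructor
  · intro p q
    simp only [Finset.sum_mul_sum, smul_mul_smul_comm]
    rw [Finset.sum_comm (γ := κ) (s := Finset.univ) (f := fun i j => (U q i * U p j) • (c i * c j)),
      ← Finset.sum_add_distrib]
    refine Finset.sum_eq_zero fun i _ => ?_
    rw [← Finset.sum_add_distrib]
    refine Finset.sum_eq_zero fun j _ => ?_
    rw [mul_comm (U q j), ← smul_add, hc.mul_add_mul, smul_zero]
  · intro p q
    simp only [star_sum, star_smul, Finset.sum_mul_sum, smul_mul_smul_comm]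
    rw [Finset.sum_comm (γ := κ) (s := Finset.univ)
      (f := fun i j => (star (U q i) * U p j) • (star (c i) * c j)), ← Finset.sum_add_distrib]
    have : ∀ i, ∑ j, (U p i * star (U q j)) • (c i * star (c j)) +
        ∑ j, (star (U q j) * U p i) • (star (c j) * c i) = (U p i * star (U q i)) • (1 : A) := by
      intro i
      rw [← Finset.sum_add_distrib, Finset.sum_eq_single i]
      · rw [mul_comm (star _), ← smul_add, hc.mul_star_add, if_pos rfl]
      · intro j _ hj
        rw [mul_comm (star _), ← smul_add, hc.mul_star_add, if_neg hj.symm, smul_zero]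
      · simp
    rw [Finset.sum_congr rfl fun i _ => this i, ← Finset.sum_smul]
    have h1 := congrFun (congrFun hU p) q
    simp only [Matrix.mul_apply, Matrix.conjTranspose_apply, Matrix.one_apply] at h1
    rw [h1]
    split_ifs <;> simp

end IsCAR

end CAR

/-! ### Antiperiodic momentum modes -/

section Fourier

/-- The phase `exp(iφ)` of the antiperiodic momentum `φ = (2p + 1)π/N`. -/
def phase (N p : ℕ) : ℂ := Complex.exp (Complex.I * ((2 * p + 1) * Real.pi / N : ℝ))

theorem momentum_succ (N p : ℕ) : momentum N (p + 1) = (2 * p + 1) * Real.pi / N := by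
  rw [momentum]; push_cast; ring

theorem phase_eq (N p : ℕ) :
    phase N p = Real.cos (momentum N (p + 1)) + Real.sin (momentum N (p + 1)) * Complex.I := by
  rw [phase, ← momentum_succ, mul_comm, Complex.exp_mul_I]
  push_cast
  rfl

theorem conj_phase_mul (N p : ℕ) : star (phase N p) * phase N p = 1 := by
  rw [phase, Complex.star_def, ← Complex.exp_conj, ← Complex.exp_add, map_mul, Complex.conj_I,
    Complex.conj_ofReal, neg_mul, neg_add_cancel, Complex.exp_zero]

theorem phase_mul_conj (N p : ℕ) : phase N p * star (phase N p) = 1 := by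
  rw [mul_comm, conj_phase_mul]

theorem phase_pow {N : ℕ} (hN : N ≠ 0) (p : ℕ) : phase N p ^ N = -1 := by
  rw [phase, ← Complex.exp_nat_mul]
  have : (N : ℂ) * (Complex.I * ((2 * p + 1) * Real.pi / N : ℝ)) =
      p * (2 * Real.pi * Complex.I) + Real.pi * Complex.I := by
    have : (N : ℂ) ≠ 0 := by exact_mod_cast hN
    push_cast
    field_simp
  rw [this, Complex.exp_add, Complex.exp_nat_mul_two_pi_mul_I, Complex.exp_pi_mul_I, one_mul]

theorem phase_inj {N p q : ℕ} (hp : p < N) (hq : q < N) (h : phase N p = phase N q) : p = q := by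
  have hN : (N : ℂ) ≠ 0 := by
    have : N ≠ 0 := by omega
    exact_mod_cast this
  have hpow : ∀ p : ℕ, phase N p =
      Complex.exp (2 * Real.pi * Complex.I / (2 * N : ℕ)) ^ (2 * p + 1) := by
    intro p
    rw [phase, ← Complex.exp_nat_mul]
    congr 1
    push_cast
    field_simp
  rw [hpow, hpow] at h
  have := (Complex.isPrimitiveRoot_exp (2 * N) (by omega)).pow_inj (by omega) (by omega) h
  omega

theorem phase_rev {N p : ℕ} (hp : p < N) : phase N (N - 1 - p) = star (phase N p) := by
  have hN : (N : ℂ) ≠ 0 := by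
    have : N ≠ 0 := by omega
    exact_mod_cast this
  rw [phase, phase, Complex.star_def, ← Complex.exp_conj]
  have : Complex.I * ((2 * (N - 1 - p : ℕ) + 1) * Real.pi / N : ℝ) =
      (starRingEnd ℂ) (Complex.I * ((2 * p + 1) * Real.pi / N : ℝ)) + 2 * Real.pi * Complex.I := by
    have h1 : ((N - 1 - p : ℕ) : ℂ) = N - 1 - p := by
      rw [Nat.cast_sub (by omega), Nat.cast_sub (by omega)]; simp
    rw [map_mul, Complex.conj_I, Complex.conj_ofReal]
    push_cast
    rw [h1]
    field_simp
    ring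
  rw [this, Complex.exp_add, Complex.exp_two_pi_mul_I, mul_one]

/-- The unitary discrete Fourier transform with antiperiodic momenta. -/
def antiDFT (N : ℕ) : Matrix (Fin N) (Fin N) ℂ :=
  Matrix.of fun p j => ((√N : ℝ) : ℂ)⁻¹ * star (phase N p) ^ (j : ℕ)

theorem star_antiDFT (N : ℕ) (p j : Fin N) :
    star (antiDFT N p j) = ((√N : ℝ) : ℂ)⁻¹ * phase N p ^ (j : ℕ) := by
  simp [antiDFT]

theorem star_antiDFT_rev (N : ℕ) (p j : Fin N) :
    star (antiDFT N p.rev j) = antiDFT N p j := by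
  rw [star_antiDFT, antiDFT, Matrix.of_apply, Fin.val_rev,
    show N - (p + 1) = N - 1 - p by omega, phase_rev p.2]

theorem antiDFT_mul_conjTranspose (N : ℕ) : antiDFT N * (antiDFT N).conjTranspose = 1 := by
  ext p q
  have hN : N ≠ 0 := by have := p.2; omega
  have hN' : (N : ℂ) ≠ 0 := by exact_mod_cast hN
  have hs : ((√N : ℝ) : ℂ)⁻¹ * ((√N : ℝ) : ℂ)⁻¹ = (N : ℂ)⁻¹ := by
    rw [← mul_inv, ← Complex.ofReal_mul, Real.mul_self_sqrt (Nat.cast_nonneg N)]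
    simp
  rw [Matrix.mul_apply]
  have h1 : ∀ j : Fin N, antiDFT N p j * (antiDFT N).conjTranspose j q =
      (N : ℂ)⁻¹ * (star (phase N p) * phase N q) ^ (j : ℕ) := by
    intro j
    rw [Matrix.conjTranspose_apply, star_antiDFT, antiDFT, Matrix.of_apply, mul_pow, ← hs]
    ring
  rw [Finset.sum_congr rfl fun j _ => h1 j, ← Finset.mul_sum,
    Fin.sum_univ_eq_sum_range (fun j => (star (phase N p) * phase N q) ^ j) N]
  by_cases hpq : p = q
  · subst hpq
    simp only [conj_phase_mul, one_pow, Finset.sum_const, Finset.card_range, nsmul_eq_mul, mul_one,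
      Matrix.one_apply_eq]
    exact inv_mul_cancel₀ hN'
  · rw [Matrix.one_apply_ne hpq]
    have hz : star (phase N p) * phase N q ≠ 1 := by
      intro h
      apply hpq
      apply Fin.ext
      apply phase_inj p.2 q.2
      have := congrArg (fun z => phase N p * z) h
      simp only [← mul_assoc, phase_mul_conj, one_mul, mul_one] at this
      exact this.symm
    have hg := mul_neg_geom_sum (star (phase N p) * phase N q) N
    rw [mul_pow, ← star_pow, phase_pow hN, phase_pow hN] at hg
    simp only [star_neg, star_one, mul_neg, mul_one, neg_neg, sub_self] at hg
    rcases mul_eq_zero.1 hg with h | h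
    · exact absurd (sub_eq_zero.1 h).symm hz
    · rw [h, mul_zero]

theorem conjTranspose_mul_antiDFT (N : ℕ) : (antiDFT N).conjTranspose * antiDFT N = 1 :=
  mul_eq_one_comm.1 (antiDFT_mul_conjTranspose N)

variable {A : Type*} [Ring A] [StarRing A] [Algebra ℂ A] [StarModule ℂ A] {N : ℕ}

/-- The annihilation operators of the momentum modes. -/
def momentumMode (c : Fin N → A) (p : Fin N) : A := ∑ j, antiDFT N p j • c j

omit [StarRing A] [StarModule ℂ A] in
theorem sum_star_antiDFT_momentumMode (c : Fin N → A) (j : Fin N) :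
    ∑ p, star (antiDFT N p j) • momentumMode c p = c j := by
  simp only [momentumMode, Finset.smul_sum, smul_smul]
  rw [Finset.sum_comm]
  have h1 : ∀ l, ∑ p, (star (antiDFT N p j) * antiDFT N p l) • c l =
      (if j = l then (1 : ℂ) else 0) • c l := by
    intro l
    rw [← Finset.sum_smul]
    have := congrFun (congrFun (conjTranspose_mul_antiDFT N) j) l
    simp only [Matrix.mul_apply, Matrix.conjTranspose_apply, Matrix.one_apply] at this
    rw [this]
  rw [Finset.sum_congr rfl fun l _ => h1 l]
  simp

theorem val_finRotate {N : ℕ} (j : Fin N) :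
    (finRotate N j : ℕ) = if (j : ℕ) + 1 < N then (j : ℕ) + 1 else 0 := by
  cases N with
  | zero => exact j.elim0
  | succ n =>
    rw [finRotate_apply, Fin.val_add_one]
    have := j.2
    split_ifs with h1 h2 h2
    · rw [h1] at h2; simp at h2
    · rfl
    · rfl
    · exact absurd (Fin.ext (by rw [Fin.val_last]; omega)) h1

/-- The neighbour of site `j` on the right, with antiperiodic boundary conditions. -/
def nextMode (c : Fin N → A) (j : Fin N) : A :=
  if (j : ℕ) + 1 < N then c (finRotate N j) else -c (finRotate N j)

omit [StarRing A] [StarModule ℂ A] in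
theorem sum_star_antiDFT_nextMode (c : Fin N → A) (j : Fin N) :
    ∑ p : Fin N, (phase N p * star (antiDFT N p j)) • momentumMode c p = nextMode c j := by
  have hN : N ≠ 0 := by have := j.2; omega
  rw [nextMode]
  split_ifs with h
  · rw [← sum_star_antiDFT_momentumMode c (finRotate N j)]
    refine Finset.sum_congr rfl fun p _ => ?_
    rw [star_antiDFT, star_antiDFT, val_finRotate, if_pos h, pow_succ]
    congr 1; ring
  · rw [← sum_star_antiDFT_momentumMode c (finRotate N j), ← Finset.sum_neg_distrib]
    refine Finset.sum_congr rfl fun p _ => ?_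
    rw [star_antiDFT, star_antiDFT, val_finRotate, if_neg h, ← neg_smul]
    have h2 : (j : ℕ) + 1 = N := by have := j.2; omega
    have h3 : phase N p ^ ((j : ℕ) + 1) = -1 := by rw [h2, phase_pow hN]
    rw [pow_succ] at h3
    congr 1
    linear_combination ((√N : ℝ) : ℂ)⁻¹ * h3

omit [StarRing A] [StarModule ℂ A] in
/-- A sum of products collapses if the expansion coefficients are biorthogonal. -/
theorem sum_mul_of_biorthogonal {f g X Y : Fin N → A} {w : Fin N → ℂ} {a b : Fin N → Fin N → ℂ}
    (hX : ∀ j, X j = ∑ p, a p j • f p) (hY : ∀ j, Y j = ∑ q, b q j • g q)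
    (hab : ∀ p q, ∑ j, a p j * b q j = if p = q then w p else 0) :
    ∑ j, X j * Y j = ∑ p, w p • (f p * g p) := by
  simp only [hX, hY, Finset.sum_mul_sum, smul_mul_smul_comm]
  rw [Finset.sum_comm]
  refine Finset.sum_congr rfl fun p _ => ?_
  rw [Finset.sum_comm, Finset.sum_eq_single p]
  · rw [← Finset.sum_smul, hab, if_pos rfl]
  · intro q _ hq
    rw [← Finset.sum_smul, hab, if_neg hq.symm, zero_smul]
  · simp

theorem antiDFT_orthogonal (p q : Fin N) :
    ∑ j, antiDFT N p j * star (antiDFT N q j) = if p = q then 1 else 0 := by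
  have := congrFun (congrFun (antiDFT_mul_conjTranspose N) p) q
  simpa only [Matrix.mul_apply, Matrix.conjTranspose_apply, Matrix.one_apply] using this

theorem star_eq_sum_star_momentumMode (c : Fin N → A) (j : Fin N) :
    star (c j) = ∑ p, antiDFT N p j • star (momentumMode c p) := by
  conv_lhs => rw [← sum_star_antiDFT_momentumMode c j]
  simp [star_sum, star_smul]

theorem sum_star_mul_nextMode (c : Fin N → A) :
    ∑ j, star (c j) * nextMode c j =
      ∑ p : Fin N, phase N p • (star (momentumMode c p) * momentumMode c p) := by
  refine sum_mul_of_biorthogonal (star_eq_sum_star_momentumMode c)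
    (fun j => (sum_star_antiDFT_nextMode c j).symm) fun p q => ?_
  simp only [mul_left_comm _ (phase N q), ← Finset.mul_sum, antiDFT_orthogonal]
  split_ifs with h <;> simp [h]

theorem sum_star_mul_self (c : Fin N → A) :
    ∑ j, star (c j) * c j = ∑ p : Fin N, star (momentumMode c p) * momentumMode c p := by
  have := sum_mul_of_biorthogonal (w := 1) (star_eq_sum_star_momentumMode c)
    (fun j => (sum_star_antiDFT_momentumMode c j).symm) antiDFT_orthogonal
  simpa using this

omit [StarRing A] [StarModule ℂ A] in
/-- The pairing term couples opposite momenta. -/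
theorem sum_nextMode_mul (c : Fin N → A) :
    ∑ j, nextMode c j * c j =
      ∑ p : Fin N, phase N p • (momentumMode c p * momentumMode c p.rev) := by
  have h1 : ∀ j, c j = ∑ p : Fin N, antiDFT N p j • momentumMode c p.rev := fun j => by
    conv_lhs => rw [← sum_star_antiDFT_momentumMode c j]
    rw [← Equiv.sum_comp Fin.revPerm]
    simp only [Fin.revPerm_apply, star_antiDFT_rev]
  refine sum_mul_of_biorthogonal (fun j => (sum_star_antiDFT_nextMode c j).symm) h1 fun p q => ?_
  simp only [mul_assoc, ← Finset.mul_sum]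
  simp only [mul_comm (star _), antiDFT_orthogonal]
  split_ifs with h1 h2 h2
  · simp
  · exact absurd h1.symm h2
  · exact absurd h2.symm h1
  · simp

end Fourier

/-! ### The quadratic fermion Hamiltonian in momentum space -/

section Quadratic

theorem sum_fin_eq_sum_rev {M : Type*} [AddCommMonoid M] {N m : ℕ} (hN : N = 2 * m)
    (G : Fin N → M) :
    ∑ p, G p = ∑ p : Fin m, (G ⟨p, by omega⟩ + G (Fin.rev ⟨p, by omega⟩)) := by
  subst hN
  let g : ℕ → M := fun k => if h : k < 2 * m then G ⟨k, h⟩ else 0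
  have h1 : ∀ p : Fin (2 * m), G p = g p := fun p => by simp [g]
  have h2 : ∀ p : Fin m, G ⟨p, by omega⟩ + G (Fin.rev ⟨p, by omega⟩) =
      g p + g (m + (m - 1 - p)) := by
    intro p
    rw [h1, h1, Fin.val_rev]
    have := p.2
    congr 2
    simp only
    omega
  rw [Finset.sum_congr rfl fun p _ => h1 p, Finset.sum_congr rfl fun p _ => h2 p,
    Fin.sum_univ_eq_sum_range g, Fin.sum_univ_eq_sum_range fun p => g p + g (m + (m - 1 - p)),
    two_mul, Finset.sum_range_add, Finset.sum_add_distrib,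
    Finset.sum_range_reflect (fun k => g (m + k)) m]

variable {A : Type*} [Ring A] [StarRing A] [Algebra ℂ A] {N : ℕ}

/-- The Jordan-Wigner image of the Hamiltonian in the even sector, a quadratic form in the
annihilation operators `c j` with antiperiodic boundary conditions. -/
def fermionH (γ K h : ℝ) (c : Fin N → A) : A :=
  ∑ j, ((1 / 2 : ℂ) • (star (c j) * nextMode c j + star (nextMode c j) * c j)
    + (Complex.I * (γ - K) / 2) • (star (c j) * star (nextMode c j))
    + (Complex.I * (γ + K) / 2) • (nextMode c j * c j)
    + (h : ℂ) • (star (c j) * c j) - ((h : ℂ) / 2) • 1)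

/-- The creation operator of the pair of modes with momenta `±φ`, where `φ = (2p + 1)π/N`. -/
def momentumPair (c : Fin N → A) (p : ℕ) : A :=
  if hp : p < N then pairCreation (momentumMode c) ⟨p, hp⟩ (Fin.rev ⟨p, hp⟩) else 0

variable [StarModule ℂ A]

theorem fermionH_eq_sum_modes (γ K h : ℝ) (c : Fin N → A) :
    fermionH γ K h c = ∑ p : Fin N,
      (((Real.cos (momentum N (p + 1)) : ℂ) + h) • (star (momentumMode c p) * momentumMode c p)
      + (Complex.I * (γ - K) / 2 * star (phase N p)) •
          (star (momentumMode c p.rev) * star (momentumMode c p))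
      + (Complex.I * (γ + K) / 2 * phase N p) • (momentumMode c p * momentumMode c p.rev)
      - ((h : ℂ) / 2) • 1) := by
  have h1 := sum_star_mul_nextMode c
  have h2 := congrArg star h1
  have h3 := sum_nextMode_mul c
  have h4 := congrArg star h3
  have h5 := sum_star_mul_self c
  simp only [star_sum, star_mul, star_star, star_smul] at h2 h4
  simp only [fermionH, Finset.sum_add_distrib, Finset.sum_sub_distrib, ← Finset.smul_sum, h1, h2,
    h3, h4, h5]
  simp only [Finset.smul_sum, ← Finset.sum_add_distrib, ← Finset.sum_sub_distrib]
  refine Finset.sum_congr rfl fun p _ => ?_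
  have hc : (1 / 2 : ℂ) * (phase N p + star (phase N p)) = Real.cos (momentum N (p + 1)) := by
    rw [phase_eq]
    simp only [Complex.star_def, map_add, map_mul, Complex.conj_ofReal, Complex.conj_I]
    ring
  linear_combination (norm := module) hc • (star (momentumMode c p) * momentumMode c p)

/-- The trace of the hopping term vanishes, by the symmetry `φ ↦ π - φ` of the momenta. -/
theorem sum_cos_momentum {N m : ℕ} (hN : N = 2 * m) :
    ∑ p ∈ Finset.range m, Real.cos (momentum N (p + 1)) = 0 := by
  have h1 := Finset.sum_range_reflect (fun p => Real.cos (momentum N (p + 1))) m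
  have h2 : ∑ p ∈ Finset.range m, Real.cos (momentum N (m - 1 - p + 1)) =
      ∑ p ∈ Finset.range m, -Real.cos (momentum N (p + 1)) := by
    refine Finset.sum_congr rfl fun p hp => ?_
    have hp := Finset.mem_range.1 hp
    rw [← Real.cos_pi_sub]
    congr 1
    have hm : (m : ℝ) ≠ 0 := by
      have : m ≠ 0 := by omega
      exact_mod_cast this
    rw [momentum_succ, momentum_succ, Nat.cast_sub (by omega), Nat.cast_sub (by omega), hN]
    push_cast
    field_simp
    ring
  rw [h2, Finset.sum_neg_distrib] at h1
  linarith

/-- Opposite momenta combine into the `2 × 2` blocks. -/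
theorem fermionH_eq_sum_pairOp {m : ℕ} (hN : N = 2 * m) {c : Fin N → A} (hc : IsCAR c)
    (γ K h : ℝ) :
    fermionH γ K h c = ∑ p ∈ Finset.range m,
      pairOp (momentumPair c p) (blockH γ K (momentum N (p + 1)) h) := by
  have hb : IsCAR (momentumMode c) := hc.unitary (antiDFT_mul_conjTranspose N)
  have hcos0 : ∑ p : Fin m, ((Real.cos (momentum N (p + 1)) : ℝ) : ℂ) • (1 : A) = 0 := by
    rw [← Finset.sum_smul, ← Complex.ofReal_sum,
      Fin.sum_univ_eq_sum_range fun p => Real.cos (momentum N (p + 1)), sum_cos_momentum hN,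
      Complex.ofReal_zero, zero_smul]
  rw [fermionH_eq_sum_modes, sum_fin_eq_sum_rev hN, Finset.sum_range, ← add_zero (∑ p : Fin m,
    pairOp _ _), ← hcos0, ← Finset.sum_add_distrib]
  refine Finset.sum_congr rfl fun p _ => ?_
  have hpN : (p : ℕ) < N := by have := p.2; omega
  rw [momentumPair, dif_pos hpN]
  set P : Fin N := ⟨p, hpN⟩ with hP
  have hne : P ≠ P.rev := by
    intro h
    have := congrArg Fin.val h
    simp only [Fin.val_rev, hP] at this
    omega
  rw [hb.pairOp_blockH hne, Fin.rev_rev, hb.mul_eq_neg P.rev P, hb.star_mul_star_eq_neg P P.rev]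
  have hph : phase N P.rev = star (phase N P) := by
    rw [Fin.val_rev, show N - ((P : ℕ) + 1) = N - 1 - P by omega, phase_rev P.2]
  have hcos : (Real.cos (momentum N ((P.rev : ℕ) + 1)) : ℂ) =
      Real.cos (momentum N ((P : ℕ) + 1)) := by
    have h1 := congrArg Complex.re hph
    rw [phase_eq, phase_eq] at h1
    simp only [Complex.star_def, map_add, map_mul, Complex.conj_ofReal, Complex.conj_I,
      Complex.add_re, Complex.ofReal_re, Complex.mul_re, Complex.I_re, Complex.neg_re, mul_zero,
      Complex.ofReal_im, Complex.I_im, zero_mul, sub_self, add_zero, neg_zero] at h1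
    exact_mod_cast h1
  rw [hph, hcos, star_star, phase_eq]
  simp only [Complex.star_def, map_add, map_mul, Complex.conj_ofReal, Complex.conj_I, hP]
  push_cast
  linear_combination (norm := module)
    (Complex.I_sq * ((γ + K) * Complex.sin (momentum N (p + 1)))) •
      (momentumMode c P * momentumMode c P.rev) -
    (Complex.I_sq * ((γ - K) * Complex.sin (momentum N (p + 1)))) •
      (star (momentumMode c P.rev) * star (momentumMode c P))

end Quadratic

/-! ### One-site operators and the Jordan-Wigner transformation -/

section Site

variable {N : ℕ}

theorem siteOp_apply (A : Matrix (Fin 2) (Fin 2) ℂ) (j : Fin N) (s t : Fin N → Fin 2) :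
    siteOp A j s t = if ∀ k, k ≠ j → s k = t k then A (s j) (t j) else 0 := rfl

theorem sum_siteOp_mul (A : Matrix (Fin 2) (Fin 2) ℂ) (j : Fin N) (s : Fin N → Fin 2)
    (f : (Fin N → Fin 2) → ℂ) :
    ∑ u, siteOp A j s u * f u = ∑ a, A (s j) a * f (Function.update s j a) := by
  simp only [siteOp_apply, ite_mul, zero_mul]
  rw [← Finset.sum_filter]
  refine Finset.sum_nbij' (fun u => u j) (fun a => Function.update s j a) ?_ ?_ ?_ ?_ ?_
  · simp
  · intro a _
    simp only [Finset.mem_filter, Finset.mem_univ, true_and]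
    intro k hk
    rw [Function.update_of_ne hk]
  · intro u hu
    simp only [Finset.mem_filter, Finset.mem_univ, true_and] at hu
    ext1 k
    by_cases hk : k = j
    · subst hk; simp
    · rw [Function.update_of_ne hk, hu k hk]
  · simp
  · intro u hu
    simp only [Finset.mem_filter, Finset.mem_univ, true_and] at hu
    congr 2
    ext1 k
    by_cases hk : k = j
    · subst hk; simp
    · rw [Function.update_of_ne hk, hu k hk]

theorem siteOp_mul_apply (A : Matrix (Fin 2) (Fin 2) ℂ) (j : Fin N)
    (M : Matrix (Fin N → Fin 2) (Fin N → Fin 2) ℂ) (s t : Fin N → Fin 2) :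
    (siteOp A j * M) s t = ∑ a, A (s j) a * M (Function.update s j a) t := by
  rw [Matrix.mul_apply, sum_siteOp_mul]

theorem siteOp_mul (A B : Matrix (Fin 2) (Fin 2) ℂ) (j : Fin N) :
    siteOp A j * siteOp B j = siteOp (A * B) j := by
  ext s t
  rw [siteOp_mul_apply, siteOp_apply, Matrix.mul_apply]
  have : ∀ a, (∀ k, k ≠ j → Function.update s j a k = t k) ↔ ∀ k, k ≠ j → s k = t k := fun a =>
    forall₂_congr fun k hk => by rw [Function.update_of_ne hk]
  simp only [siteOp_apply, this, Function.update_self]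
  split_ifs <;> simp

theorem siteOp_mul_siteOp_apply (A B : Matrix (Fin 2) (Fin 2) ℂ) {j k : Fin N} (hjk : j ≠ k)
    (s t : Fin N → Fin 2) : (siteOp A j * siteOp B k) s t =
      if ∀ l, l ≠ j → l ≠ k → s l = t l then A (s j) (t j) * B (s k) (t k) else 0 := by
  rw [siteOp_mul_apply, Finset.sum_eq_single (t j)]
  · rw [siteOp_apply, Function.update_of_ne hjk.symm, mul_ite, mul_zero]
    refine if_congr ⟨fun h l hl hl' => ?_, fun h l hl => ?_⟩ rfl rfl
    · have := h l hl'
      rwa [Function.update_of_ne hl] at this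
    · by_cases hlj : l = j
      · subst hlj; simp
      · rw [Function.update_of_ne hlj, h l hlj hl]
  · intro a _ ha
    rw [siteOp_apply, if_neg, mul_zero]
    intro h
    have := h j hjk
    rw [Function.update_self] at this
    exact ha this
  · simp

theorem siteOp_commute (A B : Matrix (Fin 2) (Fin 2) ℂ) {j k : Fin N} (hjk : j ≠ k) :
    Commute (siteOp A j) (siteOp B k) := by
  ext s t
  rw [siteOp_mul_siteOp_apply A B hjk, siteOp_mul_siteOp_apply B A hjk.symm, mul_comm]
  exact if_congr ⟨fun h l h1 h2 => h l h2 h1, fun h l h1 h2 => h l h2 h1⟩ rfl rfl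

theorem siteOp_one (j : Fin N) : siteOp (1 : Matrix (Fin 2) (Fin 2) ℂ) j = 1 := by
  ext s t
  rw [siteOp_apply, Matrix.one_apply, Matrix.one_apply, ← ite_and]
  refine if_congr ⟨fun h => ?_, fun h => by simp [h]⟩ rfl rfl
  ext1 k
  by_cases hk : k = j
  · rw [hk]; exact h.2
  · exact h.1 k hk

theorem siteOp_add (A B : Matrix (Fin 2) (Fin 2) ℂ) (j : Fin N) :
    siteOp (A + B) j = siteOp A j + siteOp B j := by
  ext s t
  simp only [Matrix.add_apply, siteOp_apply]
  split_ifs <;> simp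

theorem siteOp_smul (z : ℂ) (A : Matrix (Fin 2) (Fin 2) ℂ) (j : Fin N) :
    siteOp (z • A) j = z • siteOp A j := by
  ext s t
  simp only [Matrix.smul_apply, siteOp_apply]
  split_ifs <;> simp

theorem siteOp_zero (j : Fin N) : siteOp (0 : Matrix (Fin 2) (Fin 2) ℂ) j = 0 := by
  simpa using siteOp_smul 0 0 j

theorem star_siteOp (A : Matrix (Fin 2) (Fin 2) ℂ) (j : Fin N) :
    star (siteOp A j) = siteOp (star A) j := by
  ext s t
  simp only [Matrix.star_apply, siteOp_apply]
  have : (∀ k, k ≠ j → t k = s k) ↔ ∀ k, k ≠ j → s k = t k := by simp only [eq_comm]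
  simp only [this]
  split_ifs <;> simp

/-- The operator `σ⁻`, which empties a site; the index `0` (spin up) stands for an occupied site. -/
def lower : Matrix (Fin 2) (Fin 2) ℂ := !![0, 0; 1, 0]

/-- The operator `σ⁺`, which fills a site. -/
def raise : Matrix (Fin 2) (Fin 2) ℂ := !![0, 1; 0, 0]

theorem star_lower : star lower = raise := by
  ext i j; fin_cases i <;> fin_cases j <;> simp [lower, raise]

/-- A matrix with vanishing diagonal, as are `σ⁺` and `σ⁻`: it anticommutes with `σᶻ`. -/
def IsOffDiag (A : Matrix (Fin 2) (Fin 2) ℂ) : Prop := ∀ a, A a a = 0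

theorem isOffDiag_lower : IsOffDiag lower := by intro a; fin_cases a <;> simp [lower]

theorem isOffDiag_raise : IsOffDiag raise := by intro a; fin_cases a <;> simp [raise]

/-- The sign `-1` of an occupied site and `1` of an empty one. -/
def occSign (a : Fin 2) : ℂ := if a = 0 then -1 else 1

theorem occSign_mul_self (a : Fin 2) : occSign a * occSign a = 1 := by
  unfold occSign; split_ifs <;> norm_num

theorem occSign_of_ne {a b : Fin 2} (h : a ≠ b) : occSign a = -occSign b := by
  fin_cases a <;> fin_cases b <;> simp_all [occSign]

/-- The fermion parity of the sites in `I`, the product of `-σᶻ` over `I`. -/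
def signOp (I : Finset (Fin N)) : Matrix (Fin N → Fin 2) (Fin N → Fin 2) ℂ :=
  Matrix.diagonal fun s => ∏ i ∈ I, occSign (s i)

theorem signOp_mul_self (I : Finset (Fin N)) : signOp I * signOp I = 1 := by
  simp only [signOp, Matrix.diagonal_mul_diagonal, ← Finset.prod_mul_distrib, occSign_mul_self,
    Finset.prod_const_one, Matrix.diagonal_one]

theorem signOp_mul_self_mul (I : Finset (Fin N)) (X : Matrix (Fin N → Fin 2) (Fin N → Fin 2) ℂ) :
    signOp I * (signOp I * X) = X := by
  rw [← mul_assoc, signOp_mul_self, one_mul]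

theorem signOp_commute (I J : Finset (Fin N)) : Commute (signOp I) (signOp J) := by
  rw [commute_iff_eq, signOp, signOp, Matrix.diagonal_mul_diagonal, Matrix.diagonal_mul_diagonal]
  simp only [mul_comm]

theorem star_signOp (I : Finset (Fin N)) : star (signOp I) = signOp I := by
  rw [signOp, Matrix.star_eq_conjTranspose, Matrix.diagonal_conjTranspose]
  congr 1
  ext s
  simp only [Pi.star_apply, star_prod]
  refine Finset.prod_congr rfl fun i _ => ?_
  unfold occSign; split_ifs <;> simp

theorem signOp_siteOp_of_notMem {I : Finset (Fin N)} {j : Fin N} (hj : j ∉ I)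
    (A : Matrix (Fin 2) (Fin 2) ℂ) : signOp I * siteOp A j = siteOp A j * signOp I := by
  ext s t
  rw [signOp, Matrix.diagonal_mul, Matrix.mul_diagonal, siteOp_apply]
  split_ifs with h
  · rw [mul_comm]
    congr 1
    exact Finset.prod_congr rfl fun i hi => by rw [h i fun hij => hj (hij ▸ hi)]
  · simp

theorem signOp_siteOp_of_mem {I : Finset (Fin N)} {j : Fin N} (hj : j ∈ I)
    {A : Matrix (Fin 2) (Fin 2) ℂ} (hA : IsOffDiag A) :
    signOp I * siteOp A j = -(siteOp A j * signOp I) := by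
  ext s t
  rw [Matrix.neg_apply, signOp, Matrix.diagonal_mul, Matrix.mul_diagonal, siteOp_apply]
  split_ifs with h
  · by_cases hst : s j = t j
    · rw [hst, hA]; simp
    · rw [← Finset.mul_prod_erase _ _ hj, ← Finset.mul_prod_erase _ (fun i => occSign (t i)) hj,
        occSign_of_ne hst,
        Finset.prod_congr rfl fun i hi => by rw [h i (Finset.ne_of_mem_erase hi)]]
      ring
  · simp

theorem signOp_insert {I : Finset (Fin N)} {j : Fin N} (hj : j ∉ I) :
    signOp (insert j I) = signOp I * signOp {j} := by
  rw [signOp, signOp, signOp, Matrix.diagonal_mul_diagonal]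
  congr 1
  ext s
  rw [Finset.prod_insert hj, Finset.prod_singleton, mul_comm]

theorem signOp_singleton (j : Fin N) : signOp {j} = siteOp (-pauliZ) j := by
  ext s t
  rw [signOp, siteOp_apply, Matrix.diagonal_apply]
  by_cases h : s = t
  · subst h
    rw [if_pos rfl, if_pos fun _ _ => rfl, Finset.prod_singleton]
    generalize s j = a
    fin_cases a <;> simp [occSign, pauliZ]
  · rw [if_neg h]
    split_ifs with h'
    · have hne : s j ≠ t j := fun hj => h (funext fun k => by
        by_cases hk : k = j
        · rw [hk, hj]
        · exact h' k hk)
      generalize s j = a at *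
      generalize t j = b at *
      fin_cases a <;> fin_cases b <;> simp_all [pauliZ]
    · rfl

/-- For an even number of sites the fermion parity agrees with the spin parity. -/
theorem signOp_univ (hN : Even N) : signOp (Finset.univ : Finset (Fin N)) = parity N := by
  ext s t
  rw [signOp, parity, Matrix.diagonal_apply, Matrix.of_apply]
  split_ifs with h
  · subst h
    have : ∀ a : Fin 2, occSign a = -1 * pauliZ a a := by
      intro a; fin_cases a <;> simp [occSign, pauliZ]
    simp only [this, Finset.prod_mul_distrib, Finset.prod_const, Finset.card_univ, Fintype.card_fin,
      hN.neg_one_pow, one_mul]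
  · obtain ⟨j, hj⟩ := Function.ne_iff.1 h
    rw [eq_comm]
    refine Finset.prod_eq_zero (Finset.mem_univ j) ?_
    generalize s j = a at *
    generalize t j = b at *
    fin_cases a <;> fin_cases b <;> simp_all [pauliZ]

/-- The Jordan-Wigner annihilation operator of site `j`. -/
def jwMode (j : Fin N) : Matrix (Fin N → Fin 2) (Fin N → Fin 2) ℂ :=
  signOp (Finset.Iio j) * siteOp lower j

theorem star_jwMode (j : Fin N) : star (jwMode j) = signOp (Finset.Iio j) * siteOp raise j := by
  rw [jwMode, star_mul, star_signOp, star_siteOp, star_lower,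
    signOp_siteOp_of_notMem (by simp)]

/-- The strings make operators on different sites anticommute. -/
theorem string_anticommute {A B : Matrix (Fin 2) (Fin 2) ℂ} (hA : IsOffDiag A) (hB : IsOffDiag B)
    {i j : Fin N} (hij : i ≠ j) :
    (signOp (Finset.Iio i) * siteOp A i) * (signOp (Finset.Iio j) * siteOp B j) =
      -((signOp (Finset.Iio j) * siteOp B j) * (signOp (Finset.Iio i) * siteOp A i)) := by
  wlog h : i < j generalizing i j A B
  · rw [this hB hA hij.symm (lt_of_le_of_ne (not_lt.1 h) hij.symm), neg_neg]
  have h1 : siteOp A i * signOp (Finset.Iio j) = -(signOp (Finset.Iio j) * siteOp A i) := by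
    rw [signOp_siteOp_of_mem (by simpa using h) hA, neg_neg]
  have h2 : siteOp B j * signOp (Finset.Iio i) = signOp (Finset.Iio i) * siteOp B j := by
    rw [signOp_siteOp_of_notMem (by simpa using h.le)]
  calc (signOp (Finset.Iio i) * siteOp A i) * (signOp (Finset.Iio j) * siteOp B j)
      = signOp (Finset.Iio i) * (siteOp A i * signOp (Finset.Iio j)) * siteOp B j := by
        simp only [mul_assoc]
    _ = -((signOp (Finset.Iio i) * signOp (Finset.Iio j)) * (siteOp A i * siteOp B j)) := by
        rw [h1]; simp only [mul_assoc, mul_neg, neg_mul]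
    _ = -((signOp (Finset.Iio j) * signOp (Finset.Iio i)) * (siteOp B j * siteOp A i)) := by
        rw [(signOp_commute _ _).eq, (siteOp_commute A B hij).eq]
    _ = -(signOp (Finset.Iio j) * (signOp (Finset.Iio i) * siteOp B j) * siteOp A i) := by
        simp only [mul_assoc]
    _ = _ := by rw [← h2]; simp only [mul_assoc]

theorem string_mul_self (A B : Matrix (Fin 2) (Fin 2) ℂ) (i : Fin N) :
    (signOp (Finset.Iio i) * siteOp A i) * (signOp (Finset.Iio i) * siteOp B i) =
      siteOp (A * B) i := by
  rw [signOp_siteOp_of_notMem (by simp) A, mul_assoc, signOp_mul_self_mul, siteOp_mul]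

theorem isCAR_jwMode : IsCAR (jwMode : Fin N → Matrix (Fin N → Fin 2) (Fin N → Fin 2) ℂ) := by
  constructor
  · intro i j
    by_cases hij : i = j
    · subst hij
      rw [jwMode, string_mul_self, show lower * lower = 0 by
        ext a b; fin_cases a <;> fin_cases b <;> simp [lower], siteOp_zero, add_zero]
    · rw [jwMode, jwMode, string_anticommute isOffDiag_lower isOffDiag_lower hij, neg_add_cancel]
  · intro i j
    rw [star_jwMode, jwMode]
    split_ifs with hij
    · subst hij
      rw [string_mul_self, string_mul_self, ← siteOp_add, show lower * raise + raise * lower = 1 by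
        ext a b; fin_cases a <;> fin_cases b <;> simp [lower, raise], siteOp_one]
    · rw [string_anticommute isOffDiag_lower isOffDiag_raise hij, neg_add_cancel]

end Site

/-! ### The spin chain as free fermions -/

section Bonds

variable {N : ℕ}

/-- The total parity if the bond from `j` to its neighbour closes the ring, and `1` otherwise. -/
def wrapOp (j : Fin N) : Matrix (Fin N → Fin 2) (Fin N → Fin 2) ℂ :=
  if (j : ℕ) + 1 < N then 1 else signOp Finset.univ

/-- The antiperiodic neighbour of `j`, written with the string of `j`. -/
theorem next_string {B : Matrix (Fin 2) (Fin 2) ℂ} (hB : IsOffDiag B) (j : Fin N) :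
    (if (j : ℕ) + 1 < N then signOp (Finset.Iio (finRotate N j)) * siteOp B (finRotate N j)
      else -(signOp (Finset.Iio (finRotate N j)) * siteOp B (finRotate N j))) =
      signOp (Finset.Iio j) * (signOp {j} * (siteOp B (finRotate N j) * wrapOp j)) := by
  have hr := val_finRotate j
  rw [← mul_assoc, ← signOp_insert (by simp), wrapOp]
  split_ifs at hr ⊢ with h
  · have : Finset.Iio (finRotate N j) = insert j (Finset.Iio j) := by
      ext k
      simp only [Finset.mem_Iio, Finset.mem_insert, Fin.lt_def, Fin.ext_iff, hr]
      omega
    rw [this, mul_one]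
  · have h1 : Finset.Iio (finRotate N j) = ∅ := by
      ext k
      simp only [Finset.mem_Iio, Fin.lt_def, hr]
      simp
    have h2 : insert j (Finset.Iio j) = Finset.univ := by
      ext k
      simp only [Finset.mem_Iio, Finset.mem_insert, Fin.lt_def, Fin.ext_iff, Finset.mem_univ,
        iff_true]
      omega
    have h3 : signOp (∅ : Finset (Fin N)) = 1 := by simp [signOp]
    rw [h1, h2, h3, one_mul, ← mul_assoc, signOp_siteOp_of_mem (Finset.mem_univ _) hB, neg_mul,
      mul_assoc, signOp_mul_self, mul_one]

theorem nextMode_jwMode (j : Fin N) :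
    nextMode jwMode j =
      signOp (Finset.Iio j) * (signOp {j} * (siteOp lower (finRotate N j) * wrapOp j)) := by
  rw [← next_string isOffDiag_lower]; rfl

theorem star_nextMode_jwMode (j : Fin N) :
    star (nextMode jwMode j) =
      signOp (Finset.Iio j) * (signOp {j} * (siteOp raise (finRotate N j) * wrapOp j)) := by
  rw [← next_string isOffDiag_raise, nextMode]
  split_ifs
  · rw [star_jwMode]
  · rw [star_neg, star_jwMode]

theorem wrapOp_mul {X : Matrix (Fin N → Fin 2) (Fin N → Fin 2) ℂ}
    (hX : signOp Finset.univ * X = X) (j : Fin N) : wrapOp j * X = X := by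
  rw [wrapOp]; split_ifs
  · exact one_mul X
  · exact hX

/-- On states of even parity the strings cancel from the product of neighbouring modes. -/
theorem bond_mul {X : Matrix (Fin N → Fin 2) (Fin N → Fin 2) ℂ}
    (hX : signOp Finset.univ * X = X) (A B : Matrix (Fin 2) (Fin 2) ℂ) (j : Fin N) :
    (signOp (Finset.Iio j) * siteOp A j) *
        (signOp (Finset.Iio j) * (signOp {j} * (siteOp B (finRotate N j) * wrapOp j))) * X =
      siteOp (A * -pauliZ) j * siteOp B (finRotate N j) * X := by
  rw [signOp_siteOp_of_notMem (by simp) A, mul_assoc (siteOp A j), signOp_mul_self_mul,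
    signOp_singleton, ← mul_assoc (siteOp A j), siteOp_mul]
  simp only [mul_assoc, wrapOp_mul hX]

theorem finRotate_ne (hN : 2 ≤ N) (j : Fin N) : j ≠ finRotate N j := by
  intro h
  have h1 := congrArg Fin.val h
  rw [val_finRotate] at h1
  split_ifs at h1 <;> omega

theorem mul_nextMode_eq_neg (j : Fin N) :
    nextMode jwMode j * jwMode j = -(jwMode j * nextMode jwMode j) := by
  have h := (isCAR_jwMode (N := N)).mul_eq_neg (finRotate N j) j
  rw [nextMode]
  split_ifs
  · exact h
  · rw [neg_mul, h, mul_neg]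

theorem star_nextMode_mul_eq_neg (hN : 2 ≤ N) (j : Fin N) :
    star (nextMode jwMode j) * jwMode j = -(jwMode j * star (nextMode jwMode j)) := by
  have h := (isCAR_jwMode (N := N)).star_mul_eq_neg (finRotate_ne hN j).symm
  rw [nextMode]
  split_ifs
  · exact h
  · rw [star_neg, neg_mul, h, mul_neg]

/-- The Jordan-Wigner transformation of the chain in the even sector. -/
theorem chainH_mul (hN : 2 ≤ N) (γ K h : ℝ) {X : Matrix (Fin N → Fin 2) (Fin N → Fin 2) ℂ}
    (hX : signOp Finset.univ * X = X) :
    chainH N γ K h * X = fermionH γ K h (jwMode (N := N)) * X := by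
  rw [chainH, fermionH, Finset.sum_mul, Finset.sum_mul]
  refine Finset.sum_congr rfl fun j _ => ?_
  have hr : raise * -pauliZ = raise := by
    ext a b; fin_cases a <;> fin_cases b <;> simp [raise, pauliZ]
  have hl : lower * -pauliZ = (-1 : ℂ) • lower := by
    ext a b; fin_cases a <;> fin_cases b <;> simp [lower, pauliZ]
  have b1 : star (jwMode j) * nextMode jwMode j * X =
      siteOp raise j * siteOp lower (finRotate N j) * X := by
    rw [star_jwMode, nextMode_jwMode, bond_mul hX, hr]
  have b2 : star (jwMode j) * star (nextMode jwMode j) * X =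
      siteOp raise j * siteOp raise (finRotate N j) * X := by
    rw [star_jwMode, star_nextMode_jwMode, bond_mul hX, hr]
  have b3 : star (nextMode jwMode j) * jwMode j * X =
      siteOp lower j * siteOp raise (finRotate N j) * X := by
    rw [star_nextMode_mul_eq_neg hN, star_nextMode_jwMode, neg_mul, jwMode, bond_mul hX, hl,
      siteOp_smul, smul_mul_assoc, smul_mul_assoc, neg_one_smul, neg_neg]
  have b4 : nextMode jwMode j * jwMode j * X =
      siteOp lower j * siteOp lower (finRotate N j) * X := by
    rw [mul_nextMode_eq_neg, nextMode_jwMode, neg_mul, jwMode, bond_mul hX, hl,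
      siteOp_smul, smul_mul_assoc, smul_mul_assoc, neg_one_smul, neg_neg]
  have b5 : star (jwMode j) * jwMode j = siteOp (raise * lower) j := by
    rw [star_jwMode, jwMode, string_mul_self]
  have hx : pauliX = raise + lower := by
    ext a b; fin_cases a <;> fin_cases b <;> simp [raise, lower, pauliX]
  have hy : pauliY = (-Complex.I) • raise + Complex.I • lower := by
    ext a b; fin_cases a <;> fin_cases b <;> simp [raise, lower, pauliY]
  have hz : pauliZ = (2 : ℂ) • (raise * lower) + (-1 : ℂ) • 1 := by
    ext a b; fin_cases a <;> fin_cases b <;> norm_num [raise, lower, pauliZ]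
  simp only [add_mul, sub_mul, smul_mul_assoc, b1, b2, b3, b4, b5, smul_add]
  rw [hx, hy, hz]
  simp only [siteOp_add, siteOp_smul, siteOp_one, add_mul, mul_add, smul_mul_assoc,
    mul_smul_comm, smul_add]
  have hI : Complex.I * Complex.I = -1 := Complex.I_mul_I
  linear_combination (norm := module)
    ((1 - Complex.I * γ) / 4 * hI) •
      (siteOp raise j * siteOp raise (finRotate N j) * X) +
    ((1 - Complex.I * γ) / 4 * hI) •
      (siteOp lower j * siteOp lower (finRotate N j) * X) -
    ((1 - Complex.I * γ) / 4 * hI) •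
      (siteOp raise j * siteOp lower (finRotate N j) * X) -
    ((1 - Complex.I * γ) / 4 * hI) •
      (siteOp lower j * siteOp raise (finRotate N j) * X)

end Bonds

/-! ### The fermionic vacuum and the even sector -/

section Vacuum

variable {N : ℕ}

/-- The state with all sites empty. -/
def jwVacuum (N : ℕ) : EuclideanSpace ℂ (Fin N → Fin 2) :=
  EuclideanSpace.single (fun _ => 1) 1

theorem siteOp_mulVec (A : Matrix (Fin 2) (Fin 2) ℂ) (j : Fin N) (v : (Fin N → Fin 2) → ℂ)
    (s : Fin N → Fin 2) :
    (siteOp A j).mulVec v s = ∑ a, A (s j) a * v (Function.update s j a) := by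
  rw [Matrix.mulVec, dotProduct, sum_siteOp_mul]

theorem jwMode_jwVacuum (j : Fin N) :
    Matrix.toEuclideanCLM (𝕜 := ℂ) (jwMode j) (jwVacuum N) = 0 := by
  have h : (siteOp lower j).mulVec (jwVacuum N).ofLp = 0 := by
    ext s
    rw [siteOp_mulVec, Fin.sum_univ_two]
    have : (jwVacuum N) (Function.update s j 0) = 0 := by
      rw [jwVacuum, PiLp.single_apply, if_neg]
      intro h
      have := congrFun h j
      simp at this
    generalize s j = a at *
    fin_cases a <;> simp [lower, this]
  apply (WithLp.ofLp_injective 2)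
  rw [Matrix.ofLp_toEuclideanCLM, jwMode, ← Matrix.mulVec_mulVec, h, Matrix.mulVec_zero]
  rfl

/-- The empty state is the only state annihilated by all modes. -/
theorem eq_smul_jwVacuum {χ : EuclideanSpace ℂ (Fin N → Fin 2)}
    (h : ∀ j : Fin N, Matrix.toEuclideanCLM (𝕜 := ℂ) (jwMode j) χ = 0) :
    χ = χ (fun _ => 1) • jwVacuum N := by
  have h1 : ∀ j : Fin N, (siteOp lower j).mulVec χ.ofLp = 0 := by
    intro j
    have h2 := congrArg WithLp.ofLp (h j)
    rw [Matrix.ofLp_toEuclideanCLM, jwMode, ← Matrix.mulVec_mulVec] at h2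
    have h3 := congrArg (fun v => (signOp (Finset.Iio j)).mulVec v) h2
    simp only [Matrix.mulVec_mulVec] at h3
    rw [← mul_assoc, signOp_mul_self, one_mul] at h3
    rw [h3]
    exact Matrix.mulVec_zero _
  ext s
  by_cases hs : s = fun _ => 1
  · subst hs; simp [jwVacuum]
  · obtain ⟨j, hj⟩ := Function.ne_iff.1 hs
    have hj0 : s j = 0 := by
      generalize s j = a at *
      fin_cases a <;> simp_all
    have h2 := congrFun (h1 j) (Function.update s j 1)
    rw [siteOp_mulVec, Fin.sum_univ_two] at h2
    simp only [Function.update_self, Function.update_idem] at h2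
    rw [show Function.update s j 0 = s by rw [← hj0, Function.update_eq_self]] at h2
    simp only [lower, Matrix.of_apply, Matrix.cons_val_zero, Matrix.cons_val_one, one_mul,
      zero_mul, add_zero, Pi.zero_apply] at h2
    have h3 : jwVacuum N s = 0 := by
      rw [jwVacuum, PiLp.single_apply, if_neg hs]
    simp [h2, h3]

theorem mem_evenSector_iff (hN : Even N) {x : EuclideanSpace ℂ (Fin N → Fin 2)} :
    x ∈ evenSector N ↔ Matrix.toEuclideanCLM (𝕜 := ℂ) (signOp Finset.univ) x = x := by
  rw [evenSector, Module.End.mem_eigenspace_iff, one_smul, signOp_univ hN]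
  rfl

theorem jwVacuum_mem_evenSector (hN : Even N) : jwVacuum N ∈ evenSector N := by
  rw [mem_evenSector_iff hN]
  apply (WithLp.ofLp_injective 2)
  rw [Matrix.ofLp_toEuclideanCLM]
  ext s
  rw [signOp, Matrix.mulVec_diagonal]
  by_cases hs : s = fun _ => 1
  · subst hs; simp [jwVacuum, occSign]
  · rw [show (jwVacuum N).ofLp s = 0 by rw [jwVacuum, PiLp.single_apply, if_neg hs],
      mul_zero]

theorem signOp_univ_jwMode (j : Fin N) :
    signOp Finset.univ * jwMode j = -(jwMode j * signOp Finset.univ) := by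
  rw [jwMode, ← mul_assoc, (signOp_commute _ _).eq, mul_assoc,
    signOp_siteOp_of_mem (Finset.mem_univ j) isOffDiag_lower, mul_neg, mul_assoc]

theorem signOp_univ_momentumMode (p : Fin N) :
    signOp Finset.univ * momentumMode jwMode p = -(momentumMode jwMode p * signOp Finset.univ) := by
  simp only [momentumMode, Finset.mul_sum, Finset.sum_mul, mul_smul_comm, signOp_univ_jwMode,
    smul_neg, Finset.sum_neg_distrib, smul_mul_assoc]

theorem signOp_univ_commute_momentumPair (p : ℕ) :
    Commute (signOp Finset.univ) (momentumPair (jwMode (N := N)) p) := by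
  rw [momentumPair]
  split_ifs with hp
  · have h : ∀ q : Fin N, signOp Finset.univ * star (momentumMode jwMode q) =
        -(star (momentumMode jwMode q) * signOp Finset.univ) := fun q => by
      have := congrArg star (signOp_univ_momentumMode q)
      rw [star_mul, star_neg, star_mul, star_signOp] at this
      rw [this, neg_neg]
    exact commute_mul_of_anticommute (h _) (h _)
  · exact Commute.zero_right _

/-- The momentum pairs over the Jordan-Wigner vacuum. -/
theorem isPairFamily_momentumPair {m : ℕ} (hN : N = 2 * m) :
    IsPairFamily m (fun p => Matrix.toEuclideanCLM (𝕜 := ℂ) (momentumPair (jwMode (N := N)) p))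
      (jwVacuum N) := by
  have hb : IsCAR (momentumMode (jwMode (N := N))) :=
    isCAR_jwMode.unitary (antiDFT_mul_conjTranspose N)
  have hne : ∀ P : Fin N, P ≠ P.rev := by
    intro P h
    have := congrArg Fin.val h
    simp only [Fin.val_rev] at this
    omega
  have hpair : ∀ p (hp : p < m), momentumPair (jwMode (N := N)) p =
      pairCreation (momentumMode jwMode) ⟨p, by omega⟩ (Fin.rev ⟨p, by omega⟩) := fun p hp => by
    rw [momentumPair, dif_pos]
  have hmul : ∀ X Y : Matrix (Fin N → Fin 2) (Fin N → Fin 2) ℂ, ∀ v,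
      Matrix.toEuclideanCLM (𝕜 := ℂ) X (Matrix.toEuclideanCLM (𝕜 := ℂ) Y v) =
        Matrix.toEuclideanCLM (𝕜 := ℂ) (X * Y) v := fun X Y v => by
    rw [map_mul]; rfl
  refine ⟨?_, ?_, ?_, ?_, ?_, ?_⟩
  · intro p hp
    rw [hpair p hp]
    obtain ⟨h1, h2⟩ := hb.isPairCreation (hne ⟨p, by omega⟩)
    exact ⟨by rw [← map_mul, h1, map_zero], by rw [← map_star, ← map_mul, ← map_mul, h2]⟩
  · intro p hp q hq _
    simp only [hpair p hp, hpair q hq]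
    exact hb.commute_pairCreation.map (Matrix.toEuclideanCLM (𝕜 := ℂ) (n := Fin N → Fin 2))
  · intro p hp q hq hpq
    simp only [hpair p hp, hpair q hq]
    rw [← map_star]
    refine Commute.map (hb.commute_pairCreation_star ?_ ?_ ?_ ?_)
      (Matrix.toEuclideanCLM (𝕜 := ℂ) (n := Fin N → Fin 2)) <;>
    · intro h
      have := congrArg Fin.val h
      simp only [Fin.val_rev] at this
      omega
  · simp [jwVacuum]
  · intro p hp
    have hv : ∀ q : Fin N,
        Matrix.toEuclideanCLM (𝕜 := ℂ) (momentumMode jwMode q) (jwVacuum N) = 0 := by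
      intro q
      rw [momentumMode, map_sum, sum_apply]
      refine Finset.sum_eq_zero fun j _ => ?_
      rw [map_smul, smul_apply, jwMode_jwVacuum, smul_zero]
    simp only [hpair p hp]
    set P : Fin N := ⟨p, by omega⟩
    rw [← map_star, hmul, star_pairCreation, pairCreation]
    have e1 : momentumMode jwMode P * momentumMode jwMode P.rev *
        (star (momentumMode jwMode P.rev) * star (momentumMode jwMode P)) =
        1 + momentumMode jwMode P * star (momentumMode jwMode P.rev) *
          star (momentumMode jwMode P) * momentumMode jwMode P.rev -
          star (momentumMode jwMode P) * momentumMode jwMode P := by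
      have h1 := hb.mul_star_eq_neg (hne P).symm
      rw [mul_assoc, ← mul_assoc (momentumMode jwMode P.rev), hb.mul_star_self, sub_mul, one_mul,
        mul_assoc (star _), h1, mul_neg, sub_neg_eq_add, mul_add, hb.mul_star_self]
      simp only [mul_assoc]
      abel
    rw [e1, map_sub, map_add, sub_apply, add_apply, ← hmul _ (momentumMode jwMode P.rev),
      ← hmul _ (momentumMode jwMode P), hv, hv, map_zero, map_zero, map_one, add_zero, sub_zero]
    rfl
  · intro χ hχ
    refine ⟨_, eq_smul_jwVacuum fun j => ?_⟩
    have hb0 : ∀ p (hp : p < m),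
        Matrix.toEuclideanCLM (𝕜 := ℂ) (momentumMode jwMode (⟨p, by omega⟩ : Fin N)) χ = 0 ∧
        Matrix.toEuclideanCLM (𝕜 := ℂ) (momentumMode jwMode (Fin.rev ⟨p, by omega⟩ : Fin N)) χ
          = 0 := by
      intro p hp
      have h := hχ p hp
      simp only [hpair p hp] at h
      rw [← map_star, hmul, star_pairCreation] at h
      set P : Fin N := ⟨p, by omega⟩
      constructor
      · rw [← h, hmul, ← mul_assoc, ← mul_assoc, hb.mul_self_eq_zero, zero_mul, zero_mul, map_zero]
        rfl
      · rw [← h, hmul, ← mul_assoc, ← mul_assoc, hb.mul_eq_neg P.rev P, neg_mul,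
          mul_assoc (momentumMode jwMode P),
          hb.mul_self_eq_zero, mul_zero, neg_zero, zero_mul, map_zero]
        rfl
    have hb1 : ∀ P : Fin N, Matrix.toEuclideanCLM (𝕜 := ℂ) (momentumMode jwMode P) χ = 0 := by
      intro P
      by_cases hP : (P : ℕ) < m
      · exact (hb0 P hP).1
      · have h2 : (P.rev : ℕ) < m := by rw [Fin.val_rev]; omega
        have := (hb0 P.rev h2).2
        rwa [show (⟨(P.rev : ℕ), by omega⟩ : Fin N) = P.rev from rfl, Fin.rev_rev] at this
    rw [← sum_star_antiDFT_momentumMode jwMode j, map_sum, sum_apply]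
    refine Finset.sum_eq_zero fun p _ => ?_
    rw [map_smul, smul_apply, hb1, smul_zero]

/-- The quantum Fisher information of the chain is the sum over the momentum blocks. -/
theorem hasGroundQFI_chainH {m : ℕ} (hN : N = 2 * m) (hm : 0 < m) {γ K h : ℝ} (hγ : γ ≠ 0)
    (hγK : |K| ≠ |γ|) (hs : ∀ p < m, Real.sin (momentum N (p + 1)) ≠ 0)
    (h0 : ∀ p < m, energySq γ K h (momentum N (p + 1)) ≠ 0) :
    HasGroundQFI (chainH N γ K) (evenSector N) h
      (∑ p ∈ Finset.range m, blockQFI γ K h (momentum N (p + 1))) := by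
  have hE : Even N := ⟨m, by omega⟩
  refine (isPairFamily_momentumPair hN).hasGroundQFI (φ := fun p => momentum N (p + 1))
    (jwVacuum_mem_evenSector hE) ?_ h ?_ hγ hγK hs h0
  · intro p hp x hx
    rw [mem_evenSector_iff hE] at hx ⊢
    have h1 := congrArg (fun Y => Matrix.toEuclideanCLM (𝕜 := ℂ) Y x)
      (signOp_univ_commute_momentumPair (N := N) p).eq
    simp only [map_mul, mul_apply_eq_comp] at h1
    rw [h1, hx]
  · intro t x hx
    rw [mem_evenSector_iff hE] at hx
    -- `X` projects onto the even sector
    set X : Matrix (Fin N → Fin 2) (Fin N → Fin 2) ℂ := (1 / 2 : ℂ) • (1 + signOp Finset.univ)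
      with hXdef
    have hX : signOp Finset.univ * X = X := by
      rw [hXdef, mul_smul_comm, mul_add, mul_one, signOp_mul_self, add_comm]
    have hXx : Matrix.toEuclideanCLM (𝕜 := ℂ) X x = x := by
      rw [hXdef, map_smul, map_add, map_one, smul_apply, add_apply, hx, one_apply_eq_self]
      module
    have h1 := congrArg (fun Y => Matrix.toEuclideanCLM (𝕜 := ℂ) Y x)
      (chainH_mul (by omega) γ K t hX)
    simp only [map_mul, mul_apply_eq_comp, hXx] at h1
    refine Eq.trans h1 ?_
    rw [fermionH_eq_sum_pairOp hN isCAR_jwMode, map_sum, sum_apply]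
    refine Finset.sum_congr rfl fun p _ => ?_
    congr 1
    simp only [pairOp, map_add, map_smul, map_mul, map_star]

end Vacuum

/-! ### Bounds on the quantum Fisher information of a block -/

section BlockBounds

variable {γ K h φ : ℝ}

theorem blockQFI_nonneg (hs : Real.sin φ ≠ 0) : 0 ≤ blockQFI γ K h φ := by
  unfold blockQFI
  split_ifs with hq
  · positivity
  · have h1 : 0 ≤ (γ ^ 2 - K ^ 2) * Real.sin φ ^ 2 := by
      have : energySq γ K h φ = (h + Real.cos φ) ^ 2 + (K ^ 2 - γ ^ 2) * Real.sin φ ^ 2 := rfl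
      nlinarith [sq_nonneg (h + Real.cos φ)]
    have h2 : 0 ≤ γ ^ 2 - K ^ 2 := nonneg_of_mul_nonneg_left h1 (by positivity)
    exact div_nonneg h2 (mul_nonneg (sq_nonneg γ) (by linarith))

theorem blockQFI_le (hγ : γ ≠ 0) (hγK : |K| ≠ |γ|) (hs : Real.sin φ ≠ 0) :
    blockQFI γ K h φ ≤ 1 / |energySq γ K h φ| := by
  have hD : γ ^ 2 - K ^ 2 ≠ 0 := fun h => hγK ((sq_eq_sq_iff_abs_eq_abs K γ).1 (by linarith))
  unfold blockQFI
  split_ifs with hq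
  · rw [abs_of_pos hq]
    have hDs : 0 < (γ ^ 2 - K ^ 2) ^ 2 * Real.sin φ ^ 2 := by positivity
    set Y := (γ * √(energySq γ K h φ) + K * (h + Real.cos φ)) ^ 2 with hY
    have hY0 : 0 ≤ Y := sq_nonneg _
    rw [div_le_div_iff₀ (by positivity) hq]
    nlinarith [mul_nonneg hq.le hY0]
  · rw [abs_of_nonpos (not_lt.1 hq)]
    rcases eq_or_lt_of_le (not_lt.1 hq) with h0 | h0
    · rw [h0]; simp
    · have hq' : 0 < -energySq γ K h φ := by linarith
      rw [div_le_div_iff₀ (by positivity) hq']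
      nlinarith [mul_nonneg (sq_nonneg K) hq'.le]

end BlockBounds

/-! ### Momenta and sums over them -/

section Momenta

theorem pos_of_mem_Icc_half {N p : ℕ} (hp : p ∈ Finset.Icc 1 (N / 2)) : 0 < N := by
  rw [Finset.mem_Icc] at hp
  omega

theorem momentum_pos {N p : ℕ} (hp : p ∈ Finset.Icc 1 (N / 2)) : 0 < momentum N p := by
  have hN : (0 : ℝ) < N := by exact_mod_cast pos_of_mem_Icc_half hp
  have h1 : (1 : ℝ) ≤ p := by exact_mod_cast (Finset.mem_Icc.1 hp).1
  have := Real.pi_pos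
  unfold momentum
  have : 0 < 2 * (p : ℝ) - 1 := by linarith
  positivity

theorem momentum_lt_pi {N p : ℕ} (hp : p ∈ Finset.Icc 1 (N / 2)) : momentum N p < Real.pi := by
  have hN : (0 : ℝ) < N := by exact_mod_cast pos_of_mem_Icc_half hp
  have h1 : (2 : ℝ) * p ≤ N := by
    have : 2 * p ≤ N := by have := (Finset.mem_Icc.1 hp).2; omega
    exact_mod_cast this
  rw [momentum, div_lt_iff₀ hN]
  nlinarith [Real.pi_pos]

theorem sin_momentum_pos {N p : ℕ} (hp : p ∈ Finset.Icc 1 (N / 2)) :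
    0 < Real.sin (momentum N p) :=
  Real.sin_pos_of_pos_of_lt_pi (momentum_pos hp) (momentum_lt_pi hp)

/-- The momenta counted from the edge `π`. -/
theorem pi_sub_momentum {m p : ℕ} (hm : 0 < m) :
    Real.pi - momentum (2 * m) p = (2 * ((m : ℝ) - p) + 1) * (Real.pi / (2 * m : ℕ)) := by
  have : (m : ℝ) ≠ 0 := by exact_mod_cast hm.ne'
  rw [momentum]
  push_cast
  field_simp
  ring

theorem momentum_sub {N p : ℕ} (hN : 0 < N) (ω : ℝ) :
    momentum N p - ω = (2 * (p : ℝ) - 1 - ω / Real.pi * N) * (Real.pi / N) := by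
  have : (N : ℝ) ≠ 0 := by exact_mod_cast hN.ne'
  have := Real.pi_pos.ne'
  rw [momentum]
  field_simp

/-- The constant `∑ 1 / (1 + |k|)²` over the integers. -/
def latticeSum : ℝ := ∑' k : ℤ, 1 / (1 + |(k : ℝ)|) ^ 2

theorem summable_lattice : Summable fun k : ℤ => 1 / (1 + |(k : ℝ)|) ^ 2 := by
  have h1 : Summable fun n : ℕ => 1 / (1 + (n : ℝ)) ^ 2 := by
    have := (summable_nat_add_iff 1).2 (Real.summable_one_div_nat_pow.2 one_lt_two)
    refine this.congr fun n => ?_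
    push_cast
    rw [add_comm]
  refine Summable.of_nat_of_neg ?_ ?_
  · refine h1.congr fun n => ?_
    simp
  · refine h1.congr fun n => ?_
    simp

theorem sum_le_latticeSum (s : Finset ℕ) (r : ℤ) :
    ∑ p ∈ s, 1 / (1 + |((p : ℝ) - r)|) ^ 2 ≤ latticeSum := by
  have hinj : Function.Injective fun p : ℕ => (p : ℤ) - r := fun a b hab => by
    simpa using hab
  have h1 : ∑ p ∈ s, 1 / (1 + |((p : ℝ) - r)|) ^ 2 =
      ∑ k ∈ s.map ⟨_, hinj⟩, 1 / (1 + |(k : ℝ)|) ^ 2 := by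
    rw [Finset.sum_map]
    refine Finset.sum_congr rfl fun p _ => ?_
    simp
  rw [h1]
  exact summable_lattice.sum_le_tsum _ fun k _ => by positivity

/-- The sum of inverse squared distances of the momenta from the edge `π` is of order `N²`. -/
theorem sum_inv_sq_edge_le (m : ℕ) :
    ∑ p ∈ Finset.Icc 1 m, 1 / (Real.pi - momentum (2 * m) p) ^ 2 ≤
      latticeSum / Real.pi ^ 2 * ((2 * m : ℕ) : ℝ) ^ 2 := by
  have hpi := Real.pi_pos
  rcases Nat.eq_zero_or_pos m with rfl | hm
  · simp
  have hm' : (0 : ℝ) < ((2 * m : ℕ) : ℝ) := by positivity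
  calc ∑ p ∈ Finset.Icc 1 m, 1 / (Real.pi - momentum (2 * m) p) ^ 2
      ≤ ∑ p ∈ Finset.Icc 1 m, 1 / (1 + |((p : ℝ) - (m : ℤ))|) ^ 2 *
          (((2 * m : ℕ) : ℝ) ^ 2 / Real.pi ^ 2) := by
        refine Finset.sum_le_sum fun p hp => ?_
        have hpm : (p : ℝ) ≤ m := by exact_mod_cast (Finset.mem_Icc.1 hp).2
        rw [pi_sub_momentum hm, mul_pow, div_pow, one_div, mul_inv, inv_div, ← one_div]
        refine mul_le_mul_of_nonneg_right ?_ (by positivity)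
        rw [Int.cast_natCast, abs_of_nonpos (by linarith)]
        refine one_div_le_one_div_of_le (pow_pos (by linarith) 2) ?_
        exact pow_le_pow_left₀ (by linarith) (by linarith) 2
    _ ≤ latticeSum / Real.pi ^ 2 * ((2 * m : ℕ) : ℝ) ^ 2 := by
        rw [← Finset.sum_mul]
        have := mul_le_mul_of_nonneg_right (sum_le_latticeSum (Finset.Icc 1 m) m)
          (show 0 ≤ ((2 * m : ℕ) : ℝ) ^ 2 / Real.pi ^ 2 by positivity)
        refine this.trans (le_of_eq ?_)
        ring

/-- Off resonance, the sum of inverse squared distances of the momenta from an interior point is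
of order `N²`. -/
theorem sum_inv_sq_le_of_offResonant {η ω : ℝ} (hη : 0 < η) {N : ℕ} (hN : 0 < N)
    (hoff : OffResonant η ω N) :
    ∑ p ∈ Finset.Icc 1 (N / 2), 1 / (momentum N p - ω) ^ 2 ≤
      latticeSum / (min η (1 / 2) * Real.pi) ^ 2 * (N : ℝ) ^ 2 := by
  have hpi := Real.pi_pos
  have hN' : (0 : ℝ) < N := by exact_mod_cast hN
  set c := min η (1 / 2) with hc
  have hc0 : 0 < c := lt_min hη (by norm_num)
  set z := ω / Real.pi * N with hz
  -- `r` is the index of the momentum closest to `ω`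
  set r := round ((z + 1) / 2) with hr
  have key : ∀ p ∈ Finset.Icc 1 (N / 2), c * (1 + |(p : ℝ) - r|) ≤ |2 * (p : ℝ) - 1 - z| := by
    intro p hp
    have h1 : η ≤ |2 * (p : ℝ) - 1 - z| := by
      have := hoff p hp
      rw [momentum_sub hN, abs_mul, abs_of_pos (show 0 < Real.pi / (N : ℝ) by positivity)] at this
      exact le_of_mul_le_mul_right this (by positivity)
    have h2 : 2 * |(p : ℝ) - r| - 1 ≤ |2 * (p : ℝ) - 1 - z| := by
      have h3 : |(z + 1) / 2 - r| ≤ 1 / 2 := abs_sub_round _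
      have h4 : (p : ℝ) - r = (2 * (p : ℝ) - 1 - z) / 2 + ((z + 1) / 2 - r) := by ring
      have h5 : |(p : ℝ) - r| ≤ |(2 * (p : ℝ) - 1 - z) / 2| + |(z + 1) / 2 - r| :=
        h4 ▸ abs_add_le _ _
      rw [abs_div, abs_two] at h5
      linarith
    rcases eq_or_ne (p : ℤ) r with h | h
    · have : (p : ℝ) - r = 0 := by rw [← h]; simp
      rw [this, abs_zero, add_zero, mul_one]
      exact (min_le_left _ _).trans h1
    · have h6 : (1 : ℝ) ≤ |(p : ℝ) - r| := by
        have : (1 : ℤ) ≤ |(p : ℤ) - r| := Int.one_le_abs (sub_ne_zero.2 h)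
        exact_mod_cast this
      have h7 : c ≤ 1 / 2 := min_le_right _ _
      nlinarith
  calc ∑ p ∈ Finset.Icc 1 (N / 2), 1 / (momentum N p - ω) ^ 2
      ≤ ∑ p ∈ Finset.Icc 1 (N / 2), 1 / (1 + |(p : ℝ) - r|) ^ 2 *
          ((N : ℝ) ^ 2 / (c * Real.pi) ^ 2) := by
        refine Finset.sum_le_sum fun p hp => ?_
        have h1 := pow_le_pow_left₀ (by positivity) (key p hp) 2
        rw [sq_abs, mul_pow] at h1
        rw [momentum_sub hN, mul_pow]
        have h2 : 0 < c ^ 2 * (1 + |(p : ℝ) - r|) ^ 2 := by positivity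
        refine (one_div_le_one_div_of_le (by positivity)
          (mul_le_mul_of_nonneg_right h1 (by positivity))).trans (le_of_eq ?_)
        field_simp
    _ ≤ _ := by
        rw [← Finset.sum_mul]
        have := mul_le_mul_of_nonneg_right (sum_le_latticeSum (Finset.Icc 1 (N / 2)) r)
          (show 0 ≤ (N : ℝ) ^ 2 / (c * Real.pi) ^ 2 by positivity)
        refine this.trans (le_of_eq ?_)
        ring

theorem exists_momentum_near {ω : ℝ} (h0 : 0 < ω) (h1 : ω < Real.pi) {N : ℕ} (hN : 0 < N)
    (hE : Even N) : ∃ p ∈ Finset.Icc 1 (N / 2), |momentum N p - ω| ≤ Real.pi / N := by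
  have hpi := Real.pi_pos
  have hN' : (0 : ℝ) < N := by exact_mod_cast hN
  obtain ⟨m, hm⟩ := hE
  have hm2 : N / 2 = m := by omega
  set z := ω / Real.pi * N with hz
  have hz0 : 0 < z := by positivity
  have hzN : z < N := by
    have : ω / Real.pi < 1 := (div_lt_one hpi).2 h1
    nlinarith
  refine ⟨⌈z / 2⌉₊, ?_, ?_⟩
  · rw [Finset.mem_Icc, hm2]
    refine ⟨Nat.one_le_ceil_iff.2 (by positivity), Nat.ceil_le.2 ?_⟩
    have : (N : ℝ) = m + m := by exact_mod_cast hm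
    linarith
  · have h2 := Nat.le_ceil (z / 2)
    have h3 := Nat.ceil_lt_add_one (show 0 ≤ z / 2 by positivity)
    rw [momentum_sub hN, abs_mul, abs_of_pos (show 0 < Real.pi / (N : ℝ) by positivity)]
    refine mul_le_of_le_one_left (by positivity) (abs_le.2 ⟨by linarith, by linarith⟩)

/-- Increasing `N` by two shifts `ω` by the non-even amount `2ω/π` on the scale of the momenta,
so `N` and `N + 2` cannot both be resonant. -/
theorem exists_offResonant {ω : ℝ} (h0 : 0 < ω) (h1 : ω < Real.pi) :
    ∃ η : ℝ, 0 < η ∧ ∀ N : ℕ, Even N → OffResonant η ω N ∨ OffResonant η ω (N + 2) := by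
  have hpi := Real.pi_pos
  set t := ω / Real.pi with ht
  have ht0 : 0 < t := by positivity
  have ht1 : t < 1 := (div_lt_one hpi).2 h1
  refine ⟨min t (1 - t), lt_min ht0 (by linarith), fun N _ => ?_⟩
  by_contra hcon
  rw [not_or] at hcon
  simp only [OffResonant, not_forall, not_le] at hcon
  obtain ⟨⟨p, hp, hpN⟩, ⟨q, hq, hqN⟩⟩ := hcon
  have hN := pos_of_mem_Icc_half hp
  have hN' : (0 : ℝ) < N := by exact_mod_cast hN
  have hN2 : (0 : ℝ) < ((N + 2 : ℕ) : ℝ) := by positivity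
  rw [momentum_sub hN, abs_mul, abs_of_pos (show 0 < Real.pi / (N : ℝ) by positivity)] at hpN
  rw [momentum_sub (by omega), abs_mul,
    abs_of_pos (show 0 < Real.pi / ((N + 2 : ℕ) : ℝ) by positivity)] at hqN
  have e1 := abs_lt.1 (lt_of_mul_lt_mul_right hpN (by positivity))
  have e2 := abs_lt.1 (lt_of_mul_lt_mul_right hqN (by positivity))
  push_cast at e1 e2
  rw [← ht] at e1 e2
  have m1 := min_le_left t (1 - t)
  have m2 := min_le_right t (1 - t)
  rcases le_or_gt q p with h | h
  · have : (q : ℝ) ≤ p := by exact_mod_cast h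
    nlinarith [e1.1, e1.2, e2.1, e2.2]
  · have : (p : ℝ) + 1 ≤ q := by exact_mod_cast h
    nlinarith [e1.1, e1.2, e2.1, e2.2]

theorem eventually_even_of_eventually {P : ℕ → Prop} (h : ∀ᶠ m : ℕ in atTop, P (2 * m)) :
    ∀ᶠ N : ℕ in atTop, Even N → P N := by
  obtain ⟨M, hM⟩ := eventually_atTop.1 h
  refine eventually_atTop.2 ⟨2 * M, fun N hN hE => ?_⟩
  obtain ⟨m, rfl⟩ := hE
  rw [← two_mul]
  exact hM m (by omega)

theorem abs_cos_sub_cos_le (x y : ℝ) : |Real.cos x - Real.cos y| ≤ |x - y| := by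
  rw [Real.cos_sub_cos, abs_mul, abs_mul, abs_neg, abs_two]
  have h1 := Real.abs_sin_le_one ((x + y) / 2)
  have h2 := Real.abs_sin_le_abs (x := (x - y) / 2)
  rw [abs_div, abs_two] at h2
  nlinarith [abs_nonneg (Real.sin ((x + y) / 2)), abs_nonneg (Real.sin ((x - y) / 2))]

/-- The cosine separates an interior point of `(0, π)` from the other points linearly. -/
theorem exists_mul_abs_sub_le_abs_cos_sub {ω : ℝ} (h0 : 0 < ω) (h1 : ω < Real.pi) :
    ∃ c : ℝ, 0 < c ∧ ∀ φ, 0 < φ → φ < Real.pi → c * |φ - ω| ≤ |Real.cos φ - Real.cos ω| := by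
  have hpi := Real.pi_pos
  set d := 2 / Real.pi * min (ω / 2) ((Real.pi - ω) / 2) with hd
  have hd0 : 0 < d := mul_pos (by positivity) (lt_min (by linarith) (by linarith))
  refine ⟨2 * d * (2 / Real.pi * (1 / 2)), by positivity, fun φ hφ0 hφ1 => ?_⟩
  rw [Real.cos_sub_cos, abs_mul, abs_mul, abs_neg, abs_two]
  have hsin : d ≤ |Real.sin ((φ + ω) / 2)| := by
    refine le_trans ?_ (le_abs_self _)
    rcases le_total ((φ + ω) / 2) (Real.pi / 2) with h | h
    · refine le_trans ?_ (Real.mul_le_sin (by linarith) h)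
      exact mul_le_mul_of_nonneg_left ((min_le_left _ _).trans (by linarith)) (by positivity)
    · rw [← Real.sin_pi_sub]
      refine le_trans ?_ (Real.mul_le_sin (by linarith) (by linarith))
      exact mul_le_mul_of_nonneg_left ((min_le_right _ _).trans (by linarith)) (by positivity)
  have hsin2 : 2 / Real.pi * |(φ - ω) / 2| ≤ |Real.sin ((φ - ω) / 2)| :=
    Real.mul_abs_le_abs_sin (by rw [abs_le]; constructor <;> linarith)
  rw [abs_div, abs_two] at hsin2
  calc 2 * d * (2 / Real.pi * (1 / 2)) * |φ - ω| = 2 * d * (2 / Real.pi * (|φ - ω| / 2)) := by ring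
    _ ≤ 2 * |Real.sin ((φ + ω) / 2)| * |Real.sin ((φ - ω) / 2)| := by gcongr

end Momenta

/-! ### The critical point -/

section Critical

variable {γ K : ℝ}

/-- The quantum Fisher information of the chain of size `N`, given as the sum over the blocks. -/
def chainQFI (γ K h : ℝ) (N : ℕ) : ℝ :=
  ∑ p ∈ Finset.Icc 1 (N / 2), blockQFI γ K h (momentum N p)

theorem blockQFI_le_chainQFI (γ K h : ℝ) {N p : ℕ} (hp : p ∈ Finset.Icc 1 (N / 2)) :
    blockQFI γ K h (momentum N p) ≤ chainQFI γ K h N :=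
  Finset.single_le_sum (f := fun p => blockQFI γ K h (momentum N p))
    (fun _ hq => blockQFI_nonneg (sin_momentum_pos hq).ne') hp

theorem energySq_one_pi_sub (γ K x : ℝ) : energySq γ K 1 (Real.pi - x) =
    (1 - Real.cos x) ^ 2 + (K ^ 2 - γ ^ 2) * Real.sin x ^ 2 := by
  rw [energySq, Real.cos_pi_sub, Real.sin_pi_sub]; ring

theorem one_sub_cos_ge {x : ℝ} (h0 : 0 < x) (h1 : x < Real.pi) :
    2 / Real.pi ^ 2 * x ^ 2 ≤ 1 - Real.cos x := by
  have := Real.cos_le_one_sub_mul_cos_sq (x := x) (by rw [abs_of_pos h0]; exact h1.le)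
  linarith

theorem tendsto_sin_div : Tendsto (fun x : ℝ => Real.sin x / x) (𝓝[>] 0) (𝓝 1) := by
  have h := (hasDerivAt_iff_tendsto_slope.1 (Real.hasDerivAt_sin 0))
  rw [Real.cos_zero] at h
  refine (h.mono_left (nhdsWithin_mono _ fun x hx => ne_of_gt hx)).congr fun x => ?_
  simp [slope_def_field]

theorem tendsto_one_sub_cos_div :
    Tendsto (fun x : ℝ => (1 - Real.cos x) / x) (𝓝[>] 0) (𝓝 0) := by
  have h := (hasDerivAt_iff_tendsto_slope.1 (Real.hasDerivAt_cos 0)).neg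
  rw [Real.sin_zero, neg_zero, neg_zero] at h
  refine (h.mono_left (nhdsWithin_mono _ fun x hx => ne_of_gt hx)).congr fun x => ?_
  simp [slope_def_field]
  ring

theorem tendsto_energySq_div (γ K : ℝ) :
    Tendsto (fun x : ℝ => energySq γ K 1 (Real.pi - x) / x ^ 2) (𝓝[>] 0)
      (𝓝 (K ^ 2 - γ ^ 2)) := by
  have h := (tendsto_one_sub_cos_div.pow 2).add ((tendsto_sin_div.pow 2).const_mul (K ^ 2 - γ ^ 2))
  have e : (0 : ℝ) ^ 2 + (K ^ 2 - γ ^ 2) * 1 ^ 2 = K ^ 2 - γ ^ 2 := by ring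
  rw [e] at h
  refine h.congr fun x => ?_
  rw [energySq_one_pi_sub]
  ring

/-- The soft mode at `φ = π` for `|K| > |γ|`. -/
theorem tendsto_blockQFI_of_lt (h : |γ| < |K|) :
    Tendsto (fun x : ℝ => x ^ 2 * blockQFI γ K 1 (Real.pi - x)) (𝓝[>] 0) (𝓝 (1 / K ^ 2)) := by
  have hsq : γ ^ 2 < K ^ 2 := sq_lt_sq.2 h
  have hκ : 0 < K ^ 2 - γ ^ 2 := by linarith
  have hK : 0 < K ^ 2 := by nlinarith [sq_nonneg γ]
  have hq := tendsto_energySq_div γ K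
  have hlim := ((tendsto_sin_div.pow 2).const_mul ((γ ^ 2 - K ^ 2) ^ 2)).div
    (hq.mul ((((hq.sqrt).const_mul γ).add (tendsto_one_sub_cos_div.const_mul K)).pow 2 |>.add
      ((tendsto_sin_div.pow 2).const_mul ((γ ^ 2 - K ^ 2) ^ 2)))) (by
        have : 0 < (γ ^ 2 - K ^ 2) ^ 2 := by nlinarith [sq_pos_of_pos hκ]
        positivity)
  have e : (γ ^ 2 - K ^ 2) ^ 2 * 1 ^ 2 / ((K ^ 2 - γ ^ 2) *
      ((γ * √(K ^ 2 - γ ^ 2) + K * 0) ^ 2 + (γ ^ 2 - K ^ 2) ^ 2 * 1 ^ 2)) = 1 / K ^ 2 := by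
    rw [mul_zero, add_zero, mul_pow, Real.sq_sqrt hκ.le,
      show γ ^ 2 * (K ^ 2 - γ ^ 2) + (γ ^ 2 - K ^ 2) ^ 2 * 1 ^ 2 = K ^ 2 * (K ^ 2 - γ ^ 2) by ring]
    rw [div_eq_div_iff (by positivity) (by positivity)]
    ring
  rw [e] at hlim
  refine hlim.congr' ?_
  filter_upwards [hq.eventually (lt_mem_nhds hκ), self_mem_nhdsWithin] with x hx hx0
  have hx0 : 0 < x := hx0
  have hpos : 0 < energySq γ K 1 (Real.pi - x) := by
    rw [lt_div_iff₀ (by positivity)] at hx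
    linarith
  have hs : √(energySq γ K 1 (Real.pi - x) / x ^ 2) = √(energySq γ K 1 (Real.pi - x)) / x := by
    rw [Real.sqrt_div hpos.le, Real.sqrt_sq hx0.le]
  simp only [Pi.div_apply]
  rw [blockQFI, if_pos hpos, hs, Real.sin_pi_sub, Real.cos_pi_sub]
  have e1 : γ * (√(energySq γ K 1 (Real.pi - x)) / x) + K * ((1 - Real.cos x) / x) =
      (γ * √(energySq γ K 1 (Real.pi - x)) + K * (1 + -Real.cos x)) / x := by
    ring
  rw [e1, div_pow, div_pow, ← mul_div_assoc, ← add_div]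
  field_simp

/-- The soft mode at `φ = π` for `|K| < |γ|`. -/
theorem tendsto_blockQFI_of_gt (h : |K| < |γ|) :
    Tendsto (fun x : ℝ => x ^ 2 * blockQFI γ K 1 (Real.pi - x)) (𝓝[>] 0) (𝓝 (1 / γ ^ 2)) := by
  have hsq : K ^ 2 < γ ^ 2 := sq_lt_sq.2 h
  have hκ : K ^ 2 - γ ^ 2 < 0 := by linarith
  have hγ : 0 < γ ^ 2 := by nlinarith [sq_nonneg K]
  have hq := tendsto_energySq_div γ K
  have hlim := (tendsto_const_nhds (x := γ ^ 2 - K ^ 2)).div (hq.neg.const_mul (γ ^ 2))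
    (by
      have : 0 < -(K ^ 2 - γ ^ 2) := by linarith
      positivity)
  have e : (γ ^ 2 - K ^ 2) / (γ ^ 2 * -(K ^ 2 - γ ^ 2)) = 1 / γ ^ 2 := by
    have : γ ^ 2 - K ^ 2 ≠ 0 := by linarith
    rw [neg_sub]
    field_simp
  rw [e] at hlim
  refine hlim.congr' ?_
  filter_upwards [hq.eventually (gt_mem_nhds hκ), self_mem_nhdsWithin] with x hx hx0
  have hx0 : 0 < x := hx0
  have hneg : energySq γ K 1 (Real.pi - x) < 0 := by
    rw [div_lt_iff₀ (by positivity)] at hx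
    linarith
  simp only [Pi.div_apply]
  rw [blockQFI, if_neg (not_lt.2 hneg.le), ← neg_div, ← mul_div_assoc, div_div_eq_mul_div]
  ring

theorem tendsto_pi_div_two_mul :
    Tendsto (fun m : ℕ => Real.pi / ((2 * m : ℕ) : ℝ)) atTop (𝓝[>] 0) := by
  refine tendsto_nhdsWithin_iff.2 ⟨?_, ?_⟩
  · refine Tendsto.const_div_atTop ?_ _
    exact tendsto_natCast_atTop_atTop.comp (tendsto_id.const_mul_atTop' two_pos)
  · filter_upwards [eventually_gt_atTop 0] with m hm
    have := Real.pi_pos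
    exact Set.mem_Ioi.2 (by positivity)

theorem pi_sub_edge {m : ℕ} (hm : 0 < m) :
    Real.pi - Real.pi / ((2 * m : ℕ) : ℝ) = momentum (2 * m) m := by
  have := pi_sub_momentum (p := m) hm
  rw [sub_self, mul_zero, zero_add, one_mul] at this
  linarith

/-- The block at the edge of the Brillouin zone, from the limit at `φ = π`. -/
theorem tendsto_edge_block {L : ℝ}
    (h : Tendsto (fun x : ℝ => x ^ 2 * blockQFI γ K 1 (Real.pi - x)) (𝓝[>] 0) (𝓝 L)) :
    Tendsto (fun m : ℕ => blockQFI γ K 1 (momentum (2 * m) m) / (((2 * m : ℕ) : ℝ) / Real.pi) ^ 2)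
      atTop (𝓝 L) := by
  refine (h.comp tendsto_pi_div_two_mul).congr' ?_
  filter_upwards [eventually_gt_atTop 0] with m hm
  simp only [Function.comp_apply]
  rw [pi_sub_edge hm, div_pow, div_pow, div_div_eq_mul_div]
  ring

theorem mem_Icc_edge {m : ℕ} (hm : 0 < m) : m ∈ Finset.Icc 1 (2 * m / 2) := by
  rw [Finset.mem_Icc]; omega

/-- The edge block alone makes the quantum Fisher information grow quadratically. -/
theorem exists_le_chainQFI_of_tendsto {L : ℝ} (hL : 0 < L)
    (h : Tendsto (fun x : ℝ => x ^ 2 * blockQFI γ K 1 (Real.pi - x)) (𝓝[>] 0) (𝓝 L)) :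
    ∃ c : ℝ, 0 < c ∧ ∀ᶠ N : ℕ in atTop, Even N → c * (N : ℝ) ^ 2 ≤ chainQFI γ K 1 N := by
  have hpi := Real.pi_pos
  refine ⟨L / 2 / Real.pi ^ 2, by positivity, eventually_even_of_eventually ?_⟩
  filter_upwards [(tendsto_edge_block h).eventually (lt_mem_nhds (half_lt_self hL)),
    eventually_gt_atTop 0] with m hm hm0
  refine le_trans ?_ (blockQFI_le_chainQFI γ K 1 (mem_Icc_edge hm0))
  rw [lt_div_iff₀ (by positivity)] at hm
  refine le_trans (le_of_eq ?_) hm.le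
  ring

/-- For `|K| > |γ|` the gap at `h = 1` closes only at `φ = π`, and there linearly. -/
theorem exists_mul_sq_le_energySq (h : |γ| < |K|) :
    ∃ c : ℝ, 0 < c ∧ ∀ x, 0 < x → x < Real.pi → c * x ^ 2 ≤ energySq γ K 1 (Real.pi - x) := by
  have hpi := Real.pi_pos
  have hsq : γ ^ 2 < K ^ 2 := sq_lt_sq.2 h
  set κ := min 1 (K ^ 2 - γ ^ 2) with hκ
  have hκ0 : 0 < κ := lt_min one_pos (by linarith)
  refine ⟨κ * 2 * (2 / Real.pi ^ 2), by positivity, fun x hx0 hx1 => ?_⟩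
  rw [energySq_one_pi_sub]
  have h1 := one_sub_cos_ge hx0 hx1
  have h2 : κ ≤ 1 := min_le_left _ _
  have h3 : κ ≤ K ^ 2 - γ ^ 2 := min_le_right _ _
  have h4 := Real.sin_sq_add_cos_sq x
  calc κ * 2 * (2 / Real.pi ^ 2) * x ^ 2 = κ * 2 * (2 / Real.pi ^ 2 * x ^ 2) := by ring
    _ ≤ κ * 2 * (1 - Real.cos x) := by gcongr
    _ = κ * (1 - Real.cos x) ^ 2 + κ * Real.sin x ^ 2 := by linear_combination (-κ) * h4
    _ ≤ 1 * (1 - Real.cos x) ^ 2 + (K ^ 2 - γ ^ 2) * Real.sin x ^ 2 := by gcongr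
    _ = _ := by ring

theorem exists_blockQFI_le_div_sq (h : |γ| < |K|) (hγ : γ ≠ 0) :
    ∃ B : ℝ, 0 < B ∧ ∀ φ, 0 < φ → φ < Real.pi → blockQFI γ K 1 φ ≤ B / (Real.pi - φ) ^ 2 := by
  obtain ⟨c, hc, hq⟩ := exists_mul_sq_le_energySq h
  refine ⟨1 / c, by positivity, fun φ h0 h1 => ?_⟩
  have hx : 0 < Real.pi - φ := by linarith
  have h2 := hq (Real.pi - φ) hx (by linarith)
  rw [sub_sub_cancel] at h2
  refine (blockQFI_le hγ h.ne' (Real.sin_pos_of_pos_of_lt_pi h0 h1).ne').trans ?_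
  rw [div_div]
  exact one_div_le_one_div_of_le (by positivity) (h2.trans (le_abs_self _))

theorem nonDefective_one (h : |γ| < |K|) (N : ℕ) : NonDefective γ K 1 N := by
  obtain ⟨c, hc, hq⟩ := exists_mul_sq_le_energySq h
  intro p hp
  have h1 := momentum_pos hp
  have h2 := momentum_lt_pi hp
  have h3 := hq (Real.pi - momentum N p) (by linarith) (by linarith)
  rw [sub_sub_cancel] at h3
  have : 0 < Real.pi - momentum N p := by linarith
  exact (lt_of_lt_of_le (by positivity) h3).ne'

theorem exists_chainQFI_one_le (h : |γ| < |K|) (hγ : γ ≠ 0) :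
    ∃ C : ℝ, ∀ N : ℕ, Even N → chainQFI γ K 1 N ≤ C * (N : ℝ) ^ 2 := by
  obtain ⟨B, hB, hf⟩ := exists_blockQFI_le_div_sq h hγ
  refine ⟨B * (latticeSum / Real.pi ^ 2), fun N hE => ?_⟩
  obtain ⟨m, rfl⟩ := hE
  rw [← two_mul, chainQFI]
  calc ∑ p ∈ Finset.Icc 1 (2 * m / 2), blockQFI γ K 1 (momentum (2 * m) p)
      ≤ ∑ p ∈ Finset.Icc 1 (2 * m / 2), B * (1 / (Real.pi - momentum (2 * m) p) ^ 2) := by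
        refine Finset.sum_le_sum fun p hp => ?_
        rw [mul_one_div]
        exact hf _ (momentum_pos hp) (momentum_lt_pi hp)
    _ ≤ B * (latticeSum / Real.pi ^ 2) * ((2 * m : ℕ) : ℝ) ^ 2 := by
        rw [← Finset.mul_sum, show 2 * m / 2 = m by omega, mul_assoc]
        exact mul_le_mul_of_nonneg_left (sum_inv_sq_edge_le m) hB.le

/-- The edge block dominates: the other momenta are at least three times as far from `π`, so near
`π` their contribution is smaller by a factor close to `1 / 9`, and away from `π` it is bounded. -/
theorem eventually_blockQFI_le_edge (h : |γ| < |K|) (hγ : γ ≠ 0) :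
    ∀ᶠ m : ℕ in atTop, ∀ p ∈ Finset.Icc 1 m,
      blockQFI γ K 1 (momentum (2 * m) p) ≤ blockQFI γ K 1 (momentum (2 * m) m) := by
  obtain ⟨B, hB, hf⟩ := exists_blockQFI_le_div_sq h hγ
  have hsq : γ ^ 2 < K ^ 2 := sq_lt_sq.2 h
  have hK : 0 < K ^ 2 := by nlinarith [sq_nonneg γ]
  set L := 1 / K ^ 2 with hL
  have hL0 : 0 < L := by positivity
  have hlim := tendsto_blockQFI_of_lt h
  have hev : ∀ᶠ x in 𝓝[>] (0 : ℝ), x ^ 2 * blockQFI γ K 1 (Real.pi - x) ∈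
      Set.Ioo (L / 2) (2 * L) := hlim.eventually (Ioo_mem_nhds (by linarith) (by linarith))
  rw [eventually_nhdsWithin_iff, Metric.eventually_nhds_iff] at hev
  obtain ⟨δ, hδ, hev⟩ := hev
  have hev' : ∀ x, 0 < x → x < δ → L / 2 < x ^ 2 * blockQFI γ K 1 (Real.pi - x) ∧
      x ^ 2 * blockQFI γ K 1 (Real.pi - x) < 2 * L := fun x h0 h1 =>
    hev (by rw [Real.dist_eq, sub_zero, abs_of_pos h0]; exact h1) h0
  have hsmall : 0 < min δ (√(L / 2 * δ ^ 2 / B)) := lt_min hδ (Real.sqrt_pos.2 (by positivity))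
  have hm := tendsto_pi_div_two_mul.eventually
    (eventually_nhdsWithin_of_eventually_nhds (gt_mem_nhds hsmall))
  filter_upwards [hm, eventually_gt_atTop 0] with m hm hm0 p hp
  have hp' : p ∈ Finset.Icc 1 (2 * m / 2) := by rwa [show 2 * m / 2 = m by omega]
  set y := Real.pi / ((2 * m : ℕ) : ℝ) with hy
  have hpi := Real.pi_pos
  have hy0 : 0 < y := by positivity
  have hyδ : y < δ := hm.trans_le (min_le_left _ _)
  have hyB : B / δ ^ 2 ≤ L / 2 / y ^ 2 := by
    have h1 := (Real.lt_sqrt hy0.le).1 (hm.trans_le (min_le_right _ _))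
    rw [lt_div_iff₀ hB] at h1
    rw [div_le_div_iff₀ (by positivity) (by positivity)]
    linarith
  have hedge : L / 2 / y ^ 2 ≤ blockQFI γ K 1 (momentum (2 * m) m) := by
    have h1 := (hev' y hy0 hyδ).1
    rw [hy, pi_sub_edge hm0, ← hy] at h1
    rw [div_le_iff₀ (by positivity)]
    linarith
  rcases eq_or_ne p m with rfl | hpm
  · exact le_rfl
  have hx3 : 3 * y ≤ Real.pi - momentum (2 * m) p := by
    rw [pi_sub_momentum hm0, ← hy]
    have : (p : ℝ) + 1 ≤ m := by
      have h1 := (Finset.mem_Icc.1 hp).2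
      have : p + 1 ≤ m := by omega
      exact_mod_cast this
    exact mul_le_mul_of_nonneg_right (by linarith) hy0.le
  set x := Real.pi - momentum (2 * m) p with hx
  have hx0 : 0 < x := by linarith
  refine le_trans ?_ hedge
  rcases lt_or_ge x δ with hxδ | hxδ
  · have h1 := (hev' x hx0 hxδ).2
    rw [hx, sub_sub_cancel, ← hx] at h1
    have h2 : (3 * y) ^ 2 ≤ x ^ 2 := pow_le_pow_left₀ (by positivity) hx3 2
    have h3 : 0 ≤ blockQFI γ K 1 (momentum (2 * m) p) := blockQFI_nonneg (sin_momentum_pos hp').ne'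
    rw [le_div_iff₀ (by positivity)]
    nlinarith [mul_le_mul_of_nonneg_right h2 h3]
  · refine le_trans ?_ hyB
    refine (hf _ (momentum_pos hp') (momentum_lt_pi hp')).trans ?_
    exact div_le_div_of_nonneg_left hB.le (by positivity) (pow_le_pow_left₀ hδ.le hxδ 2)

theorem cos_omegaCrit (h : |K| < |γ|) :
    Real.cos (omegaCrit γ K) = (γ ^ 2 - K ^ 2 - 1) / (γ ^ 2 - K ^ 2 + 1) := by
  have hsq : K ^ 2 < γ ^ 2 := sq_lt_sq.2 h
  have h1 : 0 < γ ^ 2 - K ^ 2 + 1 := by linarith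
  rw [omegaCrit, Real.cos_arccos]
  · rw [le_div_iff₀ h1]; linarith
  · rw [div_le_one h1]; linarith

theorem omegaCrit_pos (h : |K| < |γ|) : 0 < omegaCrit γ K := by
  have hsq : K ^ 2 < γ ^ 2 := sq_lt_sq.2 h
  rw [omegaCrit, Real.arccos_pos, div_lt_one (by linarith)]
  linarith

theorem omegaCrit_lt_pi (h : |K| < |γ|) : omegaCrit γ K < Real.pi := by
  refine lt_of_le_of_ne (Real.arccos_le_pi _) fun h1 => ?_
  have hsq : K ^ 2 < γ ^ 2 := sq_lt_sq.2 h
  have h2 := cos_omegaCrit h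
  have h3 : γ ^ 2 - K ^ 2 + 1 ≠ 0 := by linarith
  rw [show omegaCrit γ K = Real.pi from h1, Real.cos_pi, eq_div_iff h3] at h2
  linarith

/-- The zeros of `ε²` at `h = 1` are `φ = π`, a double one in terms of `φ`, and `ω`. -/
theorem energySq_one_eq (h : |K| < |γ|) (φ : ℝ) : energySq γ K 1 φ =
    (γ ^ 2 - K ^ 2 + 1) * ((1 + Real.cos φ) * (Real.cos φ - Real.cos (omegaCrit γ K))) := by
  have hsq : K ^ 2 < γ ^ 2 := sq_lt_sq.2 h
  have h3 : γ ^ 2 - K ^ 2 + 1 ≠ 0 := by linarith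
  rw [cos_omegaCrit h, energySq]
  field_simp
  linear_combination (K ^ 2 - γ ^ 2) * Real.sin_sq_add_cos_sq φ

theorem exists_mul_le_abs_energySq_one (h : |K| < |γ|) :
    ∃ c : ℝ, 0 < c ∧ ∀ φ, 0 < φ → φ < Real.pi →
      c * ((Real.pi - φ) ^ 2 * |φ - omegaCrit γ K|) ≤ |energySq γ K 1 φ| := by
  have hpi := Real.pi_pos
  have hsq : K ^ 2 < γ ^ 2 := sq_lt_sq.2 h
  have h3 : 0 < γ ^ 2 - K ^ 2 + 1 := by linarith
  obtain ⟨c, hc, hcos⟩ := exists_mul_abs_sub_le_abs_cos_sub (omegaCrit_pos h) (omegaCrit_lt_pi h)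
  refine ⟨(γ ^ 2 - K ^ 2 + 1) * (2 / Real.pi ^ 2) * c, by positivity, fun φ h0 h1 => ?_⟩
  have h4 := one_sub_cos_ge (x := Real.pi - φ) (by linarith) (by linarith)
  rw [Real.cos_pi_sub, sub_neg_eq_add] at h4
  have h5 : 0 ≤ 1 + Real.cos φ := by linarith [Real.neg_one_le_cos φ]
  rw [energySq_one_eq h, abs_mul, abs_mul, abs_of_pos h3, abs_of_nonneg h5]
  calc _ = (γ ^ 2 - K ^ 2 + 1) * ((2 / Real.pi ^ 2 * (Real.pi - φ) ^ 2) *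
        (c * |φ - omegaCrit γ K|)) := by ring
    _ ≤ _ := by
      have := hcos φ h0 h1
      gcongr

/-- Off resonance the two singularities of `1 / ε²` at `h = 1` separate: the one at `φ = π` is
square summable, and at `ω` each of the `N/2` terms is at most of order `N`. -/
theorem exists_chainQFI_one_le_of_offResonant (h : |K| < |γ|) (hγ : γ ≠ 0) {η : ℝ} (hη : 0 < η) :
    ∃ C : ℝ, ∀ N : ℕ, Even N → OffResonant η (omegaCrit γ K) N →
      NonDefective γ K 1 N ∧ chainQFI γ K 1 N ≤ C * (N : ℝ) ^ 2 := by
  have hpi := Real.pi_pos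
  obtain ⟨c, hc, hq⟩ := exists_mul_le_abs_energySq_one h
  have hω1 := omegaCrit_lt_pi h
  set ω := omegaCrit γ K with hω
  set d := (Real.pi - ω) / 2 with hd
  have hd0 : 0 < d := by rw [hd]; linarith
  refine ⟨1 / (c * d) * (latticeSum / Real.pi ^ 2) + 1 / (c * d ^ 2) * (1 / (2 * (η * Real.pi))),
    fun N hE hoff => ?_⟩
  have hdist : ∀ p ∈ Finset.Icc 1 (N / 2), 0 < η * (Real.pi / N) ∧
      η * (Real.pi / N) ≤ |momentum N p - ω| := fun p hp => by
    have : (0 : ℝ) < N := by exact_mod_cast pos_of_mem_Icc_half hp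
    exact ⟨by positivity, hoff p hp⟩
  have hlow : ∀ p ∈ Finset.Icc 1 (N / 2),
      0 < c * ((Real.pi - momentum N p) ^ 2 * |momentum N p - ω|) := fun p hp => by
    have h1 : 0 < Real.pi - momentum N p := by linarith [momentum_lt_pi hp]
    have h2 : 0 < |momentum N p - ω| := (hdist p hp).1.trans_le (hdist p hp).2
    positivity
  refine ⟨fun p hp h0 => ?_, ?_⟩
  · have h1 := hq _ (momentum_pos hp) (momentum_lt_pi hp)
    rw [h0, abs_zero] at h1
    exact absurd h1 (not_le.2 (hlow p hp))
  · have hterm : ∀ p ∈ Finset.Icc 1 (N / 2), blockQFI γ K 1 (momentum N p) ≤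
        1 / (c * d) * (1 / (Real.pi - momentum N p) ^ 2) +
          1 / (c * d ^ 2) * (N / (η * Real.pi)) := by
      intro p hp
      have hN : (0 : ℝ) < N := by exact_mod_cast pos_of_mem_Icc_half hp
      have h0 := momentum_pos hp
      have h1 := momentum_lt_pi hp
      refine (blockQFI_le hγ h.ne (sin_momentum_pos hp).ne').trans ?_
      refine (one_div_le_one_div_of_le (hlow p hp) (hq _ h0 h1)).trans ?_
      set φ := momentum N p with hφ
      have hx : 0 < Real.pi - φ := by linarith
      have ha : 0 < |φ - ω| := (hdist p hp).1.trans_le (hdist p hp).2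
      have t1 : 0 ≤ 1 / (c * d) * (1 / (Real.pi - φ) ^ 2) := by positivity
      have t2 : 0 ≤ 1 / (c * d ^ 2) * (N / (η * Real.pi)) := by positivity
      rcases le_total d (Real.pi - φ) with hcase | hcase
      · refine le_trans ?_ (le_add_of_nonneg_left t1)
        rw [show 1 / (c * d ^ 2) * (N / (η * Real.pi)) =
          1 / (c * (d ^ 2 * (η * (Real.pi / N)))) by field_simp]
        have := (hdist p hp).1
        refine one_div_le_one_div_of_le (by positivity) ?_
        have h5 := (hdist p hp).2
        gcongr
      · refine le_trans ?_ (le_add_of_nonneg_right t2)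
        rw [show 1 / (c * d) * (1 / (Real.pi - φ) ^ 2) = 1 / (c * ((Real.pi - φ) ^ 2 * d)) by
          field_simp]
        refine one_div_le_one_div_of_le (by positivity) ?_
        have h5 : d ≤ |φ - ω| := le_trans (by rw [hd] at hcase ⊢; linarith) (le_abs_self _)
        gcongr
    obtain ⟨m, hm⟩ := hE
    have hm2 : N = 2 * m := by omega
    have hsum := sum_inv_sq_edge_le m
    rw [← hm2] at hsum
    have hcd : 0 ≤ 1 / (c * d) := by positivity
    calc chainQFI γ K 1 N ≤ ∑ p ∈ Finset.Icc 1 (N / 2),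
          (1 / (c * d) * (1 / (Real.pi - momentum N p) ^ 2) +
            1 / (c * d ^ 2) * (N / (η * Real.pi))) := Finset.sum_le_sum hterm
      _ = 1 / (c * d) * ∑ p ∈ Finset.Icc 1 m, (1 / (Real.pi - momentum N p) ^ 2) +
          m * (1 / (c * d ^ 2) * (N / (η * Real.pi))) := by
        rw [Finset.sum_add_distrib, ← Finset.mul_sum, Finset.sum_const, Nat.card_Icc,
          show N / 2 = m by omega, nsmul_eq_mul, Nat.add_sub_cancel]
      _ ≤ 1 / (c * d) * (latticeSum / Real.pi ^ 2 * (N : ℝ) ^ 2) +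
          m * (1 / (c * d ^ 2) * (N / (η * Real.pi))) := by gcongr
      _ = _ := by
        have : (N : ℝ) = 2 * m := by exact_mod_cast hm2
        rw [this]
        field_simp

end Critical

/-! ### The exceptional point -/

section Exceptional

variable {γ K : ℝ}

theorem hExc_sq (h : |K| < |γ|) : hExc γ K ^ 2 = 1 + γ ^ 2 - K ^ 2 := by
  have hsq : K ^ 2 < γ ^ 2 := sq_lt_sq.2 h
  rw [hExc, Real.sq_sqrt (by linarith)]

theorem one_lt_hExc (h : |K| < |γ|) : 1 < hExc γ K := by
  have hsq : K ^ 2 < γ ^ 2 := sq_lt_sq.2 h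
  rw [hExc, Real.lt_sqrt one_pos.le]
  linarith

theorem cos_omegaExc (h : |K| < |γ|) : Real.cos (omegaExc γ K) = -1 / hExc γ K := by
  have h1 := one_lt_hExc h
  rw [omegaExc, Real.cos_arccos]
  · rw [le_div_iff₀ (by linarith)]; linarith
  · rw [div_le_one (by linarith)]; linarith

theorem omegaExc_pos (h : |K| < |γ|) : 0 < omegaExc γ K := by
  have h1 := one_lt_hExc h
  rw [omegaExc, Real.arccos_pos, div_lt_one (by linarith)]
  linarith

theorem omegaExc_lt_pi (h : |K| < |γ|) : omegaExc γ K < Real.pi := by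
  refine lt_of_le_of_ne (Real.arccos_le_pi _) fun h1 => ?_
  have h2 := cos_omegaExc h
  have h3 := one_lt_hExc h
  rw [show omegaExc γ K = Real.pi from h1, Real.cos_pi, eq_div_iff (by linarith)] at h2
  linarith

/-- At the exceptional point `ε²` is a perfect square, so the spectrum is real. -/
theorem energySq_hExc (h : |K| < |γ|) (φ : ℝ) : energySq γ K (hExc γ K) φ =
    (hExc γ K * (Real.cos φ - Real.cos (omegaExc γ K))) ^ 2 := by
  have h1 := one_lt_hExc h
  have h2 := hExc_sq h
  have h3 := Real.sin_sq_add_cos_sq φ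
  rw [cos_omegaExc h, energySq]
  have h4 : hExc γ K * (Real.cos φ - -1 / hExc γ K) = hExc γ K * Real.cos φ + 1 := by
    field_simp
    ring
  rw [h4]
  linear_combination (K ^ 2 - γ ^ 2) * h3 + (1 - Real.cos φ ^ 2) * h2

theorem exists_blockQFI_hExc_le (h : |K| < |γ|) (hγ : γ ≠ 0) :
    ∃ B : ℝ, 0 < B ∧ ∀ φ, 0 < φ → φ < Real.pi → φ ≠ omegaExc γ K →
      energySq γ K (hExc γ K) φ ≠ 0 ∧
        blockQFI γ K (hExc γ K) φ ≤ B * (1 / (φ - omegaExc γ K) ^ 2) := by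
  obtain ⟨c, hc, hcos⟩ := exists_mul_abs_sub_le_abs_cos_sub (omegaExc_pos h) (omegaExc_lt_pi h)
  have h1 := one_lt_hExc h
  refine ⟨1 / (hExc γ K * c) ^ 2, by positivity, fun φ hφ0 hφ1 hne => ?_⟩
  have h2 : (hExc γ K * c) ^ 2 * (φ - omegaExc γ K) ^ 2 ≤ energySq γ K (hExc γ K) φ := by
    rw [energySq_hExc h, mul_pow, mul_pow, ← sq_abs (φ - _), ← sq_abs (Real.cos φ - _),
      mul_assoc, ← mul_pow]
    have := hcos φ hφ0 hφ1
    gcongr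
  have h3 : 0 < (φ - omegaExc γ K) ^ 2 := by
    have := sub_ne_zero.2 hne
    positivity
  have h4 : 0 < (hExc γ K * c) ^ 2 * (φ - omegaExc γ K) ^ 2 := by positivity
  refine ⟨(h4.trans_le h2).ne', ?_⟩
  refine (blockQFI_le hγ h.ne (Real.sin_pos_of_pos_of_lt_pi hφ0 hφ1).ne').trans ?_
  rw [div_mul_div_comm, one_mul]
  exact one_div_le_one_div_of_le h4 (h2.trans (le_abs_self _))

/-- Near `ω` the block contributes at least of the order of the inverse squared distance. -/
theorem exists_le_blockQFI_hExc (h : |K| < |γ|) :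
    ∃ c : ℝ, 0 < c ∧ ∀ φ, |φ - omegaExc γ K| ≤ Real.sin (omegaExc γ K) / 2 →
      energySq γ K (hExc γ K) φ ≠ 0 →
        c * (1 / (φ - omegaExc γ K) ^ 2) ≤ blockQFI γ K (hExc γ K) φ := by
  have h1 := one_lt_hExc h
  have hsq : K ^ 2 < γ ^ 2 := sq_lt_sq.2 h
  have hD : γ ^ 2 - K ^ 2 ≠ 0 := by linarith
  have hs0 := Real.sin_pos_of_pos_of_lt_pi (omegaExc_pos h) (omegaExc_lt_pi h)
  set ω := omegaExc γ K with hω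
  set e := hExc γ K with he
  set M := ((|γ| + |K|) * (e * 2)) ^ 2 + (γ ^ 2 - K ^ 2) ^ 2 with hM
  have hM0 : 0 < M := by positivity
  refine ⟨(γ ^ 2 - K ^ 2) ^ 2 * (Real.sin ω / 2) ^ 2 / (e ^ 2 * M), by positivity,
    fun φ hφ hne => ?_⟩
  have hq := energySq_hExc h φ
  rw [← he, ← hω] at hq
  have hpos : 0 < energySq γ K e φ := lt_of_le_of_ne (hq ▸ sq_nonneg _) hne.symm
  have hsqrt : √(energySq γ K e φ) = |e * (Real.cos φ - Real.cos ω)| := by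
    rw [hq, Real.sqrt_sq_eq_abs]
  have hsin : Real.sin ω / 2 ≤ Real.sin φ := by
    have h2 : |Real.sin φ - Real.sin ω| ≤ |φ - ω| := by
      have := abs_cos_sub_cos_le (Real.pi / 2 - φ) (Real.pi / 2 - ω)
      rw [Real.cos_pi_div_two_sub, Real.cos_pi_div_two_sub] at this
      refine this.trans (le_of_eq ?_)
      rw [abs_sub_comm]
      congr 1; ring
    have := (abs_le.1 (h2.trans hφ)).1
    linarith
  have hsin1 : Real.sin φ ^ 2 ≤ 1 := Real.sin_sq_le_one φ
  have hroot : √(energySq γ K e φ) ≤ e * 2 := by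
    rw [hsqrt, abs_mul, abs_of_pos (by linarith : 0 < e)]
    have h2 : |Real.cos φ - Real.cos ω| ≤ 2 := by
      rw [abs_le]
      constructor <;> linarith [Real.neg_one_le_cos φ, Real.cos_le_one φ, Real.neg_one_le_cos ω,
        Real.cos_le_one ω]
    gcongr
  have hg : |e + Real.cos φ| ≤ e * 2 := by
    rw [abs_le]
    constructor <;> linarith [Real.neg_one_le_cos φ, Real.cos_le_one φ]
  have hY : (γ * √(energySq γ K e φ) + K * (e + Real.cos φ)) ^ 2 ≤
      ((|γ| + |K|) * (e * 2)) ^ 2 := by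
    rw [sq_le_sq, abs_of_nonneg (show 0 ≤ (|γ| + |K|) * (e * 2) by positivity)]
    refine (abs_add_le _ _).trans ?_
    rw [abs_mul, abs_mul, abs_of_nonneg (Real.sqrt_nonneg _), add_mul]
    gcongr
  have hq2 : energySq γ K e φ ≤ e ^ 2 * (φ - ω) ^ 2 := by
    rw [hq, mul_pow, ← sq_abs (φ - ω), ← sq_abs (Real.cos φ - _)]
    have := abs_cos_sub_cos_le φ ω
    gcongr
  have hne0 : 0 < (φ - ω) ^ 2 := by
    by_contra hcon
    have : (φ - ω) ^ 2 = 0 := le_antisymm (not_lt.1 hcon) (sq_nonneg _)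
    rw [this, mul_zero] at hq2
    exact absurd hpos (not_lt.2 hq2)
  rw [blockQFI, if_pos hpos, div_mul_div_comm, mul_one]
  have hDs : 0 < (γ ^ 2 - K ^ 2) ^ 2 * Real.sin φ ^ 2 := by
    have : 0 < Real.sin φ := by linarith
    positivity
  have hden : energySq γ K e φ * ((γ * √(energySq γ K e φ) + K * (e + Real.cos φ)) ^ 2 +
      (γ ^ 2 - K ^ 2) ^ 2 * Real.sin φ ^ 2) ≤ e ^ 2 * M * (φ - ω) ^ 2 := by
    calc _ ≤ (e ^ 2 * (φ - ω) ^ 2) * (((|γ| + |K|) * (e * 2)) ^ 2 + (γ ^ 2 - K ^ 2) ^ 2 * 1) := by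
          gcongr
      _ = _ := by rw [hM]; ring
  refine div_le_div₀ hDs.le ?_ (mul_pos hpos (by positivity)) hden
  have : 0 ≤ Real.sin ω / 2 := by positivity
  gcongr

/-- Eventually every size has a momentum at distance at most `π/N` from `ω`; if the size is not
defective, its block contributes at least quadratically. -/
theorem exists_near_block_hExc (h : |K| < |γ|) :
    ∃ c : ℝ, 0 < c ∧ ∀ᶠ N : ℕ in atTop, Even N → NonDefective γ K (hExc γ K) N →
      ∃ p ∈ Finset.Icc 1 (N / 2), |momentum N p - omegaExc γ K| ≤ Real.pi / N ∧
        c * ((N : ℝ) / Real.pi) ^ 2 ≤ blockQFI γ K (hExc γ K) (momentum N p) := by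
  obtain ⟨c, hc, hf⟩ := exists_le_blockQFI_hExc h
  have hs0 := Real.sin_pos_of_pos_of_lt_pi (omegaExc_pos h) (omegaExc_lt_pi h)
  have hlim : Tendsto (fun N : ℕ => Real.pi / (N : ℝ)) atTop (𝓝 0) :=
    tendsto_natCast_atTop_atTop.const_div_atTop _
  refine ⟨c, hc, ?_⟩
  filter_upwards [hlim.eventually (gt_mem_nhds (half_pos hs0)), eventually_gt_atTop 0]
    with N hN hN0 hE hnd
  have hN' : (0 : ℝ) < N := by exact_mod_cast hN0
  have hpi := Real.pi_pos
  obtain ⟨p, hp, hnear⟩ := exists_momentum_near (omegaExc_pos h) (omegaExc_lt_pi h) hN0 hE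
  refine ⟨p, hp, hnear, ?_⟩
  have h1 := hf _ (hnear.trans hN.le) (hnd p hp)
  refine le_trans ?_ h1
  have hne : momentum N p ≠ omegaExc γ K := by
    intro heq
    apply hnd p hp
    rw [energySq_hExc h, heq, sub_self, mul_zero, zero_pow two_ne_zero]
  have h2 : (momentum N p - omegaExc γ K) ^ 2 ≤ (Real.pi / N) ^ 2 := by
    rw [← sq_abs]
    exact pow_le_pow_left₀ (abs_nonneg _) hnear 2
  have h3 : 0 < (momentum N p - omegaExc γ K) ^ 2 := by
    have := sub_ne_zero.2 hne
    positivity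
  have h4 := one_div_le_one_div_of_le h3 h2
  have h5 : ((N : ℝ) / Real.pi) ^ 2 = 1 / (Real.pi / N) ^ 2 := by field_simp
  rw [h5]
  gcongr

theorem ne_omega_of_offResonant {η ω : ℝ} (hη : 0 < η) {N p : ℕ} (hoff : OffResonant η ω N)
    (hp : p ∈ Finset.Icc 1 (N / 2)) : momentum N p ≠ ω := by
  intro heq
  have h1 := hoff p hp
  have hN : (0 : ℝ) < N := by exact_mod_cast pos_of_mem_Icc_half hp
  have hpi := Real.pi_pos
  rw [heq, sub_self, abs_zero] at h1
  exact absurd h1 (not_le.2 (by positivity))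

theorem nonDefective_hExc_of_offResonant (h : |K| < |γ|) (hγ : γ ≠ 0) {η : ℝ} (hη : 0 < η) {N : ℕ}
    (hoff : OffResonant η (omegaExc γ K) N) : NonDefective γ K (hExc γ K) N := by
  obtain ⟨B, -, hf⟩ := exists_blockQFI_hExc_le h hγ
  exact fun p hp => (hf _ (momentum_pos hp) (momentum_lt_pi hp)
    (ne_omega_of_offResonant hη hoff hp)).1

theorem exists_chainQFI_hExc_le_of_offResonant (h : |K| < |γ|) (hγ : γ ≠ 0) {η : ℝ}
    (hη : 0 < η) : ∃ C : ℝ, ∀ N : ℕ, 0 < N → OffResonant η (omegaExc γ K) N →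
      chainQFI γ K (hExc γ K) N ≤ C * (N : ℝ) ^ 2 := by
  obtain ⟨B, hB, hf⟩ := exists_blockQFI_hExc_le h hγ
  refine ⟨B * (latticeSum / (min η (1 / 2) * Real.pi) ^ 2), fun N hN hoff => ?_⟩
  calc chainQFI γ K (hExc γ K) N
      ≤ ∑ p ∈ Finset.Icc 1 (N / 2), B * (1 / (momentum N p - omegaExc γ K) ^ 2) :=
        Finset.sum_le_sum fun p hp => (hf _ (momentum_pos hp) (momentum_lt_pi hp)
          (ne_omega_of_offResonant hη hoff hp)).2
    _ ≤ _ := by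
        rw [← Finset.mul_sum, mul_assoc]
        exact mul_le_mul_of_nonneg_left (sum_inv_sq_le_of_offResonant hη hN hoff) hB.le

theorem exists_block_bounds_hExc (h : |K| < |γ|) (hγ : γ ≠ 0) {η : ℝ} (hη : 0 < η) :
    ∃ a b : ℝ, 0 < a ∧ ∀ᶠ N : ℕ in atTop, Even N → OffResonant η (omegaExc γ K) N →
      ∃ p ∈ Finset.Icc 1 (N / 2), |momentum N p - omegaExc γ K| ≤ Real.pi / N ∧
        a * (((N : ℝ) / Real.pi) ^ 2 / (γ ^ 2 - K ^ 2)) ≤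
          blockQFI γ K (hExc γ K) (momentum N p) ∧
        blockQFI γ K (hExc γ K) (momentum N p) ≤
          b * (((N : ℝ) / Real.pi) ^ 2 / (γ ^ 2 - K ^ 2)) := by
  have hsq : K ^ 2 < γ ^ 2 := sq_lt_sq.2 h
  have hD : 0 < γ ^ 2 - K ^ 2 := by linarith
  have hpi := Real.pi_pos
  obtain ⟨B, hB, hf⟩ := exists_blockQFI_hExc_le h hγ
  obtain ⟨c, hc, hlow⟩ := exists_near_block_hExc h
  refine ⟨c * (γ ^ 2 - K ^ 2), B / η ^ 2 * (γ ^ 2 - K ^ 2), by positivity, ?_⟩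
  filter_upwards [hlow, eventually_gt_atTop 0] with N hN hN0 hE hoff
  have hN' : (0 : ℝ) < N := by exact_mod_cast hN0
  obtain ⟨p, hp, hnear, hge⟩ := hN hE (nonDefective_hExc_of_offResonant h hγ hη hoff)
  refine ⟨p, hp, hnear, ?_, ?_⟩
  · refine le_trans (le_of_eq ?_) hge
    field_simp
  · refine (hf _ (momentum_pos hp) (momentum_lt_pi hp) (ne_omega_of_offResonant hη hoff hp)).2.trans
      ?_
    have h1 : (η * (Real.pi / N)) ^ 2 ≤ (momentum N p - omegaExc γ K) ^ 2 := by
      rw [← sq_abs (momentum N p - _)]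
      exact pow_le_pow_left₀ (by positivity) (hoff p hp) 2
    calc B * (1 / (momentum N p - omegaExc γ K) ^ 2) ≤ B * (1 / (η * (Real.pi / N)) ^ 2) := by
          gcongr
      _ = _ := by field_simp

end Exceptional

theorem chainQFI_eq_sum_range (γ K h : ℝ) {N m : ℕ} (hN : N = 2 * m) :
    chainQFI γ K h N = ∑ p ∈ Finset.range m, blockQFI γ K h (momentum N (p + 1)) := by
  rw [chainQFI, show N / 2 = m by omega, Finset.range_eq_Ico,
    Finset.sum_Ico_add' (fun p => blockQFI γ K h (momentum N p)) 0 m 1]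
  rfl

end IKSEA

end

theorem theorem1 (γ K : ℝ) (hγ : γ ≠ 0) (hγK : |K| ≠ |γ|) :
    ∃ (F : ℝ → ℕ → ℝ) (f : ℝ → ℕ → ℕ → ℝ),
      -- `f h N p` is the QFI of the ground state of the momentum block `p`
      (∀ (h : ℝ) (N : ℕ), Even N → 0 < N → ∀ p ∈ Finset.Icc 1 (N / 2),
        IKSEA.energySq γ K h (IKSEA.momentum N p) ≠ 0 →
          IKSEA.HasGroundQFI (IKSEA.blockH γ K (IKSEA.momentum N p)) ⊤ h (f h N p)) ∧
      -- `F h N` is the QFI of the ground state of the spin chain, the sum over the blocks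
      (∀ (h : ℝ) (N : ℕ), Even N → 0 < N → IKSEA.NonDefective γ K h N →
        IKSEA.HasGroundQFI (IKSEA.chainH N γ K) (IKSEA.evenSector N) h (F h N) ∧
          F h N = ∑ p ∈ Finset.Icc 1 (N / 2), f h N p) ∧
      -- the critical point `h = 1` in the regime `|K| > |γ|`
      (|γ| < |K| →
        (∀ N : ℕ, Even N → 0 < N → IKSEA.NonDefective γ K 1 N) ∧
        (∃ c C : ℝ, 0 < c ∧ ∀ᶠ N : ℕ in atTop, Even N →
          c * (N : ℝ) ^ 2 ≤ F 1 N ∧ F 1 N ≤ C * (N : ℝ) ^ 2) ∧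
        Tendsto (fun m : ℕ => f 1 (2 * m) m / (((2 * m : ℕ) : ℝ) / Real.pi) ^ 2) atTop
          (𝓝 (1 / K ^ 2)) ∧
        (∀ᶠ m : ℕ in atTop, ∀ p ∈ Finset.Icc 1 m, f 1 (2 * m) p ≤ f 1 (2 * m) m)) ∧
      -- the regime `|K| < |γ|`
      (|K| < |γ| →
        -- the critical point `h = 1`
        ((∃ c : ℝ, 0 < c ∧ ∀ᶠ N : ℕ in atTop, Even N → IKSEA.NonDefective γ K 1 N →
            c * (N : ℝ) ^ 2 ≤ F 1 N) ∧
          (∀ η : ℝ, 0 < η → ∃ C : ℝ, ∀ᶠ N : ℕ in atTop, Even N →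
            IKSEA.OffResonant η (IKSEA.omegaCrit γ K) N →
              IKSEA.NonDefective γ K 1 N ∧ F 1 N ≤ C * (N : ℝ) ^ 2) ∧
          (∃ η : ℝ, 0 < η ∧ ∀ N : ℕ, Even N →
            IKSEA.OffResonant η (IKSEA.omegaCrit γ K) N ∨
              IKSEA.OffResonant η (IKSEA.omegaCrit γ K) (N + 2)) ∧
          Tendsto (fun m : ℕ => f 1 (2 * m) m / (((2 * m : ℕ) : ℝ) / Real.pi) ^ 2) atTop
            (𝓝 (1 / γ ^ 2))) ∧
        -- the exceptional point `h = h_e`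
        ((∃ c : ℝ, 0 < c ∧ ∀ᶠ N : ℕ in atTop, Even N →
            IKSEA.NonDefective γ K (IKSEA.hExc γ K) N →
              c * (N : ℝ) ^ 2 ≤ F (IKSEA.hExc γ K) N) ∧
          (∀ η : ℝ, 0 < η → ∃ C : ℝ, ∀ᶠ N : ℕ in atTop, Even N →
            IKSEA.OffResonant η (IKSEA.omegaExc γ K) N →
              IKSEA.NonDefective γ K (IKSEA.hExc γ K) N ∧
                F (IKSEA.hExc γ K) N ≤ C * (N : ℝ) ^ 2) ∧
          (∃ η : ℝ, 0 < η ∧ ∀ N : ℕ, Even N →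
            IKSEA.OffResonant η (IKSEA.omegaExc γ K) N ∨
              IKSEA.OffResonant η (IKSEA.omegaExc γ K) (N + 2)) ∧
          (∀ η : ℝ, 0 < η → ∃ a b : ℝ, 0 < a ∧ ∀ᶠ N : ℕ in atTop, Even N →
            IKSEA.OffResonant η (IKSEA.omegaExc γ K) N →
              ∃ p ∈ Finset.Icc 1 (N / 2),
                |IKSEA.momentum N p - IKSEA.omegaExc γ K| ≤ Real.pi / N ∧
                a * (((N : ℝ) / Real.pi) ^ 2 / (γ ^ 2 - K ^ 2)) ≤ f (IKSEA.hExc γ K) N p ∧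
                f (IKSEA.hExc γ K) N p ≤
                  b * (((N : ℝ) / Real.pi) ^ 2 / (γ ^ 2 - K ^ 2))))) := by
  refine ⟨IKSEA.chainQFI γ K,
    fun h N p => IKSEA.blockQFI γ K h (IKSEA.momentum N p), ?_, ?_, ?_, ?_⟩
  · intro h N _ _ p hp h0
    exact IKSEA.hasGroundQFI_blockH hγ hγK (IKSEA.sin_momentum_pos hp).ne' h0
  · intro h N hE hN hnd
    refine ⟨?_, rfl⟩
    obtain ⟨m, hm⟩ := hE
    have hN2 : N = 2 * m := by omega
    have hmem : ∀ p < m, p + 1 ∈ Finset.Icc 1 (N / 2) := fun p hp => by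
      rw [Finset.mem_Icc]; omega
    rw [IKSEA.chainQFI_eq_sum_range γ K h hN2]
    exact IKSEA.hasGroundQFI_chainH hN2 (by omega) hγ hγK
      (fun p hp => (IKSEA.sin_momentum_pos (hmem p hp)).ne') fun p hp => hnd _ (hmem p hp)
  · intro h
    have hK : 0 < 1 / K ^ 2 := by
      have : K ≠ 0 := fun h0 => absurd h (not_lt.2 (by rw [h0, abs_zero]; exact abs_nonneg γ))
      positivity
    have hlim := IKSEA.tendsto_blockQFI_of_lt h
    refine ⟨fun N _ _ => IKSEA.nonDefective_one h N, ?_, IKSEA.tendsto_edge_block hlim,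
      IKSEA.eventually_blockQFI_le_edge h hγ⟩
    obtain ⟨c, hc, hlow⟩ := IKSEA.exists_le_chainQFI_of_tendsto hK hlim
    obtain ⟨C, hup⟩ := IKSEA.exists_chainQFI_one_le h hγ
    refine ⟨c, C, hc, ?_⟩
    filter_upwards [hlow] with N hN hE using ⟨hN hE, hup N hE⟩
  · intro h
    have hlim := IKSEA.tendsto_blockQFI_of_gt h
    refine ⟨⟨?_, ?_, ?_, IKSEA.tendsto_edge_block hlim⟩, ?_, ?_, ?_, ?_⟩
    · obtain ⟨c, hc, hlow⟩ := IKSEA.exists_le_chainQFI_of_tendsto (by positivity) hlim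
      refine ⟨c, hc, ?_⟩
      filter_upwards [hlow] with N hN hE _ using hN hE
    · intro η hη
      obtain ⟨C, hC⟩ := IKSEA.exists_chainQFI_one_le_of_offResonant h hγ hη
      exact ⟨C, Eventually.of_forall hC⟩
    · exact IKSEA.exists_offResonant (IKSEA.omegaCrit_pos h) (IKSEA.omegaCrit_lt_pi h)
    · obtain ⟨c, hc, hlow⟩ := IKSEA.exists_near_block_hExc h
      refine ⟨c / Real.pi ^ 2, div_pos hc (pow_pos Real.pi_pos 2), ?_⟩
      filter_upwards [hlow] with N hN hE hnd
      obtain ⟨p, hp, -, hle⟩ := hN hE hnd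
      refine le_trans (le_of_eq ?_) (hle.trans (IKSEA.blockQFI_le_chainQFI γ K _ hp))
      ring
    · intro η hη
      obtain ⟨C, hC⟩ := IKSEA.exists_chainQFI_hExc_le_of_offResonant h hγ hη
      refine ⟨C, ?_⟩
      filter_upwards [eventually_gt_atTop 0] with N hN _ hoff using
        ⟨IKSEA.nonDefective_hExc_of_offResonant h hγ hη hoff, hC N hN hoff⟩
    · exact IKSEA.exists_offResonant (IKSEA.omegaExc_pos h) (IKSEA.omegaExc_lt_pi h)
    · intro η hη
      exact IKSEA.exists_block_bounds_hExc h hγ hη
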